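/- **Setting.** Let $S$ be an irreducible scheme of finite type over $\mathbb C$, let $X$ be a non-singular (smooth over $\mathbb C$) integral scheme and let $\pi\colon X\to S$ be a smooth morphism. $T_X$ and $T_S$ denote the sheaves of $\mathbb C$-derivations of $\mathcal O_X$ and $\mathcal O_S$, and $T_{X|S}\subseteq T_X$ the sheaf of $\pi^{-1}\mathcal O_S$-linear derivations. A *Lie algebroid* on $X$ is a reflexive coherent sheaf $\mathcal A$ with an $\mathcal O_X$-linear anchor $a\colon\mathcal A\to T_X$ and a $\mathbb C$-bilinear, skew-symmetric bracket satisfying the Jacobi identity and $\{gs,t\}=g\{s,t\}-a(t)(g)\,s$. A *family of Lie algebroids* over $\pi$ is a reflexive coherent sheaf $\mathcal A_S$ on $X$, flat over $S$, with an $\mathcal O_X$-linear anchor $a_S\colon \mathcal A_S\to T_{X|S}$ and a $\pi^{-1}\mathcal O_S$-bilinear bracket with the same properties. An *unfolding* of $\mathcal A_S$ is a Lie algebroid $(\mathcal A,a)$ on $X$ together with an injection $\mathcal A_S\hookrightarrow\mathcal A$ compatible with anchors and brackets such that $\mathcal A_S=a^{-1}(\operatorname{Im}a_S)$ and $\operatorname{rank}\mathcal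 A=\operatorname{rank}\mathcal A_S+\dim S$. It is *transversal* if the induced map $\operatorname{Coker}(a_S\colon\mathcal A_S\to T_{X|S})\to\operatorname{Coker}(a\colon\mathcal A\to T_X)$ is an isomorphism of sheaves. Two unfoldings are identified if there is an isomorphism of Lie algebroids between them that is the identity on $\mathcal A_S$. Let $\mathcal U$ be the sheaf of $\mathbb C$-linear differential operators $\psi$ of order $\le1$ on $\mathcal A_S$ with symbol $\sigma(\psi)\in T_X$ (so $\psi(gs)=g\psi(s)+\sigma(\psi)(g)\,s$; if $\mathcal A_S=0$ the symbol is part of the datum) which are derivations of the bracket of $\mathcal A_S$ and whose symbol is basic, i.e. has image in $\pi^{-1}T_S\subseteq\pi^*T_S$. Let $\mathfrak u(\mathcal A_S)=\mathcal U/\mathcal A_S$ be the quotient sheaf by the image of $\mathcal A_S\to\mathcal U$, $s\mapsto\{s,-\}$ (with symbol $a_S(s)$). It is a sheaf of Lie algebras and of $\pi^{-1}\mathcal O_S$-modules, and the symbol induces $\sigma\colon\mathfrak u(\mathcal A_S)\to\pi^{-1}T_S$. **Theorem.** For every transversal unfolding $\mathcal A$ of $\mathcal A_S$ there is a $\pi^{-1}\mathcal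 O_S$-linear morphism of sheaves of Lie algebras $\upsilon_{\mathcal A}\colon\pi^{-1}T_S\to\mathfrak u(\mathcal A_S)$ with $\sigma\circ\upsilon_{\mathcal A}=\mathrm{id}$, depending only on the isomorphism class of $\mathcal A$, which sends a local vector field $v$ of $S$ to the class of the operator $\{x,-\}|_{\mathcal A_S}$ (with symbol $a(x)$), for any local section $x$ of $\mathcal A$ such that $a(x)$ is mapped to $v$ in $\pi^*T_S$. If the map $\mathcal A_S\to\mathcal U$ is injective (so that $\mathcal A_S$ is a subsheaf of $\mathcal U$), then $\mathcal A\mapsto\upsilon_{\mathcal A}$ is a bijection $$\{\text{transversal unfoldings of }\mathcal A_S\}/\!\cong\ \longleftrightarrow\ \{\pi^{-1}\mathcal O_S\text{-linear morphisms }\upsilon\colon\pi^{-1}T_S\to\mathfrak u(\mathcal A_S)\text{ respecting brackets with }\sigma\circ\upsilon=\mathrm{id}\}.$$ -/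

import Mathlib

open CategoryTheory AlgebraicGeometry TopologicalSpace Opposite

noncomputable section

namespace LieAlgd

variable {X Y S : Scheme.{0}}

/-! ### Restriction and pull-back of functions, restriction of sections -/

/-- Restriction of functions from `U` to `V ≤ U`. -/
def fres {U V : X.Opens} (h : V ≤ U) : Γ(X, U) →+* Γ(X, V) :=
  (X.presheaf.map (homOfLE h).op).hom

/-- Pull-back of functions `Γ(Y, W) → Γ(X, U)` along `f`, for `U ≤ f⁻¹ W`. -/
def pull (f : X ⟶ Y) {W : Y.Opens} {U : X.Opens} (e : U ≤ f ⁻¹ᵁ W) : Γ(Y, W) →+* Γ(X, U) :=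
  (f.appLE W U e).hom

/-- Restriction of sections of a sheaf of modules from `U` to `V ≤ U`. -/
def mres (M : X.Modules) {U V : X.Opens} (h : V ≤ U) : Γ(M, U) →+ Γ(M, V) :=
  (M.presheaf.map (homOfLE h).op).hom

theorem fres_fres {U V W : X.Opens} (h : V ≤ U) (h' : W ≤ V) (g : Γ(X, U)) :
    fres h' (fres h g) = fres (h'.trans h) g := by
  have := X.presheaf.map_comp (homOfLE h).op (homOfLE h').op
  exact (congr($(this).hom g)).symm

theorem fres_self {U : X.Opens} (h : U ≤ U) (g : Γ(X, U)) : fres h g = g := by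
  have := X.presheaf.map_id (op U)
  exact congr($(this).hom g)

theorem mres_mres (M : X.Modules) {U V W : X.Opens} (h : V ≤ U) (h' : W ≤ V) (s : Γ(M, U)) :
    mres M h' (mres M h s) = mres M (h'.trans h) s := by
  have := M.presheaf.map_comp (homOfLE h).op (homOfLE h').op
  exact (congr($(this).hom s)).symm

theorem mres_self (M : X.Modules) {U : X.Opens} (h : U ≤ U) (s : Γ(M, U)) : mres M h s = s := by
  have := M.presheaf.map_id (op U)
  exact congr($(this).hom s)

theorem mres_smul (M : X.Modules) {U V : X.Opens} (h : V ≤ U) (g : Γ(X, U)) (s : Γ(M, U)) :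
    mres M h (g • s) = fres h g • mres M h s :=
  Scheme.Modules.map_smul M (homOfLE h) g s

theorem fres_pull (f : X ⟶ Y) {W : Y.Opens} {U V : X.Opens} (e : U ≤ f ⁻¹ᵁ W) (h : V ≤ U)
    (g : Γ(Y, W)) : fres h (pull f e g) = pull f (h.trans e) g := by
  have := f.appLE_map e (homOfLE h).op
  exact congr($(this).hom g)

theorem pull_fres (f : X ⟶ Y) {W W' : Y.Opens} {U : X.Opens} (h : W' ≤ W) (e : U ≤ f ⁻¹ᵁ W')
    (g : Γ(Y, W)) :
    pull f e (fres h g) = pull f (e.trans ((Opens.map f.base).map (homOfLE h)).le) g := by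
  have := f.map_appLE e (homOfLE h).op
  exact congr($(this).hom g)

theorem pull_comp (f : X ⟶ Y) (g : Y ⟶ S) {W : S.Opens} {U : X.Opens}
    (e : U ≤ (f ≫ g) ⁻¹ᵁ W) (c : Γ(S, W)) :
    pull (f ≫ g) e c = pull f (W := g ⁻¹ᵁ W) e (pull g le_rfl c) := by
  have := Scheme.Hom.appLE_comp_appLE f g W (g ⁻¹ᵁ W) U le_rfl e
  exact (congr($(this).hom c)).symm

/-! ### Relative tangent sheaves -/

/-- Sections over `U` of the relative tangent sheaf `T_{X|Y}` of `f : X ⟶ Y`: derivations of the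
sheaf of rings `𝒪_X|_U` into itself which vanish on (the pull-back of) functions from `Y`. -/
def tangentSubgroup (f : X ⟶ Y) (U : X.Opens) :
    AddSubgroup (∀ V : {V : X.Opens // V ≤ U}, Derivation ℤ Γ(X, V.1) Γ(X, V.1)) where
  carrier := {D |
    (∀ (V W : {V : X.Opens // V ≤ U}) (h : W.1 ≤ V.1) (g : Γ(X, V.1)),
      fres h (D V g) = D W (fres h g)) ∧
    (∀ (V : {V : X.Opens // V ≤ U}) (W : Y.Opens) (e : V.1 ≤ f ⁻¹ᵁ W) (c : Γ(Y, W)),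
      D V (pull f e c) = 0)}
  zero_mem' := ⟨fun V W h g => by simp, fun V W e c => by simp⟩
  add_mem' := by
    rintro D E ⟨hD, hD'⟩ ⟨hE, hE'⟩
    exact ⟨fun V W h g => by simp [hD V W h, hE V W h],
      fun V W e c => by simp [hD' V W e, hE' V W e]⟩
  neg_mem' := by
    rintro D ⟨hD, hD'⟩
    exact ⟨fun V W h g => by simp [hD V W h], fun V W e c => by simp [hD' V W e]⟩

/-- The group of sections over `U` of the relative tangent sheaf `T_{X|Y}`. -/
abbrev tangent (f : X ⟶ Y) (U : X.Opens) : Type := tangentSubgroup f U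

namespace tangent

variable {f : X ⟶ Y} {U : X.Opens}

/-- The derivation of `Γ(X, V)` given by a vector field on `U`, for `V ≤ U`. -/
def der (D : tangent f U) {V : X.Opens} (h : V ≤ U) : Derivation ℤ Γ(X, V) Γ(X, V) :=
  D.1 ⟨V, h⟩

theorem ext {D E : tangent f U}
    (H : ∀ (V : X.Opens) (h : V ≤ U) (g : Γ(X, V)), D.der h g = E.der h g) : D = E :=
  Subtype.ext (funext fun V => Derivation.ext fun g => H V.1 V.2 g)

theorem fres_der (D : tangent f U) {V W : X.Opens} (h : V ≤ U) (h' : W ≤ V) (g : Γ(X, V)) :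
    fres h' (D.der h g) = D.der (h'.trans h) (fres h' g) :=
  D.2.1 ⟨V, h⟩ ⟨W, h'.trans h⟩ h' g

theorem der_pull (D : tangent f U) {V : X.Opens} (h : V ≤ U) {W : Y.Opens} (e : V ≤ f ⁻¹ᵁ W)
    (c : Γ(Y, W)) : D.der h (pull f e c) = 0 :=
  D.2.2 ⟨V, h⟩ W e c

instance : SMul Γ(X, U) (tangent f U) where
  smul g D := ⟨fun V => fres V.2 g • D.1 V, by
    constructor
    · intro V W h k
      change fres h (fres V.2 g * D.1 V k) = fres W.2 g * D.1 W (fres h k)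
      rw [map_mul, D.2.1 V W h, fres_fres]
    · intro V W e c
      change fres V.2 g * D.1 V (pull f e c) = 0
      rw [D.2.2 V W e c, mul_zero]⟩

@[simp] theorem zero_der {V : X.Opens} (h : V ≤ U) : (0 : tangent f U).der h = 0 := rfl

@[simp] theorem add_der (D E : tangent f U) {V : X.Opens} (h : V ≤ U) :
    (D + E).der h = D.der h + E.der h := rfl

@[simp] theorem neg_der (D : tangent f U) {V : X.Opens} (h : V ≤ U) :
    (-D).der h = -D.der h := rfl

@[simp] theorem smul_der (g : Γ(X, U)) (D : tangent f U) {V : X.Opens} (h : V ≤ U) :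
    (g • D).der h = fres h g • D.der h := rfl

instance : Module Γ(X, U) (tangent f U) where
  one_smul D := ext fun V h k => by simp
  mul_smul a b D := ext fun V h k => by simp [mul_assoc]
  smul_zero a := ext fun V h k => by simp
  smul_add a D E := ext fun V h k => by simp
  add_smul a b D := ext fun V h k => by simp [add_mul]
  zero_smul D := ext fun V h k => by simp

/-- The commutator of vector fields. -/
instance : Bracket (tangent f U) (tangent f U) where
  bracket D E := ⟨fun V => ⁅D.1 V, E.1 V⁆, by
    constructor
    · intro V W h k
      simp only [Derivation.commutator_apply, map_sub]
      rw [D.2.1 V W h, E.2.1 V W h, E.2.1 V W h, D.2.1 V W h]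
    · intro V W e c
      simp only [Derivation.commutator_apply]
      rw [D.2.2 V W e, E.2.2 V W e, map_zero, map_zero, sub_zero]⟩

@[simp] theorem lie_der (D E : tangent f U) {V : X.Opens} (h : V ≤ U) :
    ⁅D, E⁆.der h = ⁅D.der h, E.der h⁆ := rfl

/-- Restriction of vector fields. -/
def res {U V : X.Opens} (h : V ≤ U) : tangent f U →+ tangent f V where
  toFun D := ⟨fun W => D.1 ⟨W.1, W.2.trans h⟩,
    fun V' W h' g => D.2.1 ⟨V'.1, V'.2.trans h⟩ ⟨W.1, W.2.trans h⟩ h' g,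
    fun V' W e c => D.2.2 ⟨V'.1, V'.2.trans h⟩ W e c⟩
  map_zero' := rfl
  map_add' _ _ := rfl

@[simp] theorem res_der (D : tangent f U) {V W : X.Opens} (h : V ≤ U) (h' : W ≤ V) :
    (res h D).der h' = D.der (h'.trans h) := rfl

/-- The inclusion `T_{X|S} ⊆ T_{X|Y}` for `X ⟶ S ⟶ Y`. -/
def incl (π : X ⟶ S) (p : S ⟶ Y) (U : X.Opens) : tangent π U →+ tangent (π ≫ p) U where
  toFun D := ⟨D.1, D.2.1, fun V W e c => by
    rw [pull_comp]
    exact D.2.2 V _ _ _⟩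
  map_zero' := rfl
  map_add' _ _ := rfl

@[simp] theorem incl_der (π : X ⟶ S) (p : S ⟶ Y) (D : tangent π U) {V : X.Opens} (h : V ≤ U) :
    (incl π p U D).der h = D.der h := rfl

/-- The relative tangent sheaf of `f`, as a (pre)sheaf of abelian groups. -/
def presheaf (f : X ⟶ Y) : TopCat.Presheaf Ab X where
  obj U := AddCommGrpCat.of (tangent f U.unop)
  map i := AddCommGrpCat.ofHom (res i.unop.le)
  map_id _ := rfl
  map_comp _ _ := rfl

end tangent

/-- A vector field `D` on `U ⊆ X` is `π`-related to a vector field `v` on `W ⊆ S`, where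
`U ≤ π⁻¹ W`: `D (π^♯ c) = π^♯ (v c)` for all local functions `c` of `S`.  In other words, the image
`dπ(D)` of `D` in `π^* T_S` is the pull-back of the section `v` of `T_S`. -/
def Related (π : X ⟶ S) (p : S ⟶ Y) {U : X.Opens} {W : S.Opens}
    (D : tangent (π ≫ p) U) (v : tangent p W) : Prop :=
  ∀ (V : X.Opens) (hV : V ≤ U) (W' : S.Opens) (hW : W' ≤ W) (e : V ≤ π ⁻¹ᵁ W') (c : Γ(S, W')),
    D.der hV (pull π e c) = pull π e (v.der hW c)

/-- Basic vector fields on `U`: those whose image in `π^* T_S` lies in `π⁻¹ T_S`, i.e. which are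
locally on `X` `π`-related to local vector fields of `S`. -/
def IsBasic (π : X ⟶ S) (p : S ⟶ Y) {U : X.Opens} (D : tangent (π ≫ p) U) : Prop :=
  ∀ x ∈ U, ∃ (V : X.Opens) (h : V ≤ U) (W : S.Opens) (v : tangent p W),
    x ∈ V ∧ V ≤ π ⁻¹ᵁ W ∧ Related π p (tangent.res h D) v

/-! ### Lie algebroids, families of Lie algebroids -/

/-- A Lie algebroid on `X` relative to `f : X ⟶ Y`: a reflexive coherent sheaf `𝒜` with an
`𝒪_X`-linear anchor `a : 𝒜 ⟶ T_{X|Y}` and an `f⁻¹ 𝒪_Y`-bilinear Lie bracket such that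
`{g s, t} = g {s, t} - a(t)(g) s`.  For `Y = Spec ℂ` this is a Lie algebroid on `X`. -/
structure LieAlgebroid (f : X ⟶ Y) where
  /-- the underlying sheaf of modules -/
  sheaf : X.Modules
  quasicoherent : SheafOfModules.IsQuasicoherent sheaf
  finite : ∀ U : X.Opens, IsAffineOpen U → Module.Finite Γ(X, U) Γ(sheaf, U)
  reflexive : ∀ U : X.Opens, IsAffineOpen U → Module.IsReflexive Γ(X, U) Γ(sheaf, U)
  /-- the anchor -/
  anchor : ∀ U : X.Opens, Γ(sheaf, U) →ₗ[Γ(X, U)] tangent f U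
  anchor_res : ∀ {U V : X.Opens} (h : V ≤ U) (s : Γ(sheaf, U)),
    anchor V (mres sheaf h s) = tangent.res h (anchor U s)
  /-- the Lie bracket -/
  bracket : ∀ U : X.Opens, Γ(sheaf, U) →+ Γ(sheaf, U) →+ Γ(sheaf, U)
  bracket_res : ∀ {U V : X.Opens} (h : V ≤ U) (s t : Γ(sheaf, U)),
    mres sheaf h (bracket U s t) = bracket V (mres sheaf h s) (mres sheaf h t)
  bracket_smul_base : ∀ {U : X.Opens} {W : Y.Opens} (e : U ≤ f ⁻¹ᵁ W) (c : Γ(Y, W))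
    (s t : Γ(sheaf, U)), bracket U (pull f e c • s) t = pull f e c • bracket U s t
  skew : ∀ {U : X.Opens} (s t : Γ(sheaf, U)), bracket U s t = -bracket U t s
  jacobi : ∀ {U : X.Opens} (s t r : Γ(sheaf, U)),
    bracket U s (bracket U t r) + bracket U t (bracket U r s) + bracket U r (bracket U s t) = 0
  leibniz : ∀ {U : X.Opens} (g : Γ(X, U)) (s t : Γ(sheaf, U)),
    bracket U (g • s) t = g • bracket U s t - (anchor U t).der le_rfl g • s

/-- A family of Lie algebroids over `π : X ⟶ S`: a Lie algebroid relative to `π` (so the anchor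
takes values in `T_{X|S}` and the bracket is `π⁻¹ 𝒪_S`-bilinear) whose underlying sheaf is flat
over `S`. -/
structure Family (π : X ⟶ S) extends LieAlgebroid π where
  flat : ∀ (U : X.Opens) (W : S.Opens) (e : U ≤ π ⁻¹ᵁ W), IsAffineOpen U → IsAffineOpen W →
    letI : Module Γ(S, W) Γ(sheaf, U) := Module.compHom _ (pull π e)
    Module.Flat Γ(S, W) Γ(sheaf, U)

/-- The presheaf cokernel of the anchor. -/
def LieAlgebroid.normalPresheaf {f : X ⟶ Y} (A : LieAlgebroid f) : TopCat.Presheaf Ab X where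
  obj U := AddCommGrpCat.of (tangent f U.unop ⧸ (A.anchor U.unop).toAddMonoidHom.range)
  map {U V} i := AddCommGrpCat.ofHom (QuotientAddGroup.map _ _ (tangent.res i.unop.le) (by
    rintro _ ⟨s, rfl⟩
    exact ⟨mres A.sheaf i.unop.le s, A.anchor_res i.unop.le s⟩))
  map_id U := by ext D; rfl
  map_comp i j := by ext D; rfl

/-! ### Differential operators, and the sheaf `𝔲` -/

/-- A section over `U` of `Der_Lie(𝒜_S) ∩ D^{≤ 1}_X(𝒜_S)` with basic symbol: an additive
endomorphism `ψ` of the sheaf `𝒜_S|_U` together with its symbol, a vector field `σ` on `U`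
(a derivation of `𝒪_X|_U` which is `p`-linear, i.e. `ℂ`-linear for `Y = Spec ℂ`), such that
`ψ (g s) = g ψ(s) + σ(g) s`, such that `ψ` is a derivation of the Lie bracket, and such that the
image of `σ` in `π^* T_S` lies in `π⁻¹ T_S`.  If `𝒜_S` is torsion-free and non-zero, the symbol is
determined by `ψ`. -/
def basicOpSubgroup {π : X ⟶ S} (F : Family π) (p : S ⟶ Y) (U : X.Opens) :
    AddSubgroup (tangent (π ≫ p) U ×
      (∀ V : {V : X.Opens // V ≤ U}, Γ(F.sheaf, V.1) →+ Γ(F.sheaf, V.1))) where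
  carrier := {P |
    (∀ (V W : {V : X.Opens // V ≤ U}) (h : W.1 ≤ V.1) (s : Γ(F.sheaf, V.1)),
      mres F.sheaf h (P.2 V s) = P.2 W (mres F.sheaf h s)) ∧
    (∀ (V : {V : X.Opens // V ≤ U}) (g : Γ(X, V.1)) (s : Γ(F.sheaf, V.1)),
      P.2 V (g • s) = g • P.2 V s + P.1.der V.2 g • s) ∧
    (∀ (V : {V : X.Opens // V ≤ U}) (s t : Γ(F.sheaf, V.1)),
      P.2 V (F.bracket V.1 s t) = F.bracket V.1 (P.2 V s) t + F.bracket V.1 s (P.2 V t)) ∧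
    IsBasic π p P.1}
  zero_mem' := by
    refine ⟨fun V W h s => by simp, fun V g s => by simp, fun V s t => by simp, fun x hx => ?_⟩
    refine ⟨U, le_rfl, ⊤, 0, hx, fun _ _ => trivial, fun V hV W' hW e c => ?_⟩
    simp
  add_mem' := by
    rintro P Q ⟨h1, h2, h3, h4⟩ ⟨k1, k2, k3, k4⟩
    refine ⟨fun V W h s => by simp [h1 V W h, k1 V W h], fun V g s => ?_, fun V s t => ?_,
      fun x hx => ?_⟩
    · simp only [Prod.snd_add, Pi.add_apply, AddMonoidHom.add_apply, h2, k2, Prod.fst_add,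
        tangent.add_der, Derivation.add_apply, smul_add, add_smul]
      abel
    · simp only [Prod.snd_add, Pi.add_apply, AddMonoidHom.add_apply, h3, k3, map_add]
      abel
    · obtain ⟨V, hV, W, v, hxV, hVW, hr⟩ := h4 x hx
      obtain ⟨V', hV', W', v', hxV', hVW', hr'⟩ := k4 x hx
      refine ⟨V ⊓ V', inf_le_left.trans hV, W ⊓ W',
        tangent.res inf_le_left v + tangent.res inf_le_right v', ⟨hxV, hxV'⟩,
        fun y hy => ⟨hVW hy.1, hVW' hy.2⟩, fun V1 hV1 W1 hW1 e c => ?_⟩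
      have a1 := hr V1 (hV1.trans inf_le_left) W1 (hW1.trans inf_le_left) e c
      have a2 := hr' V1 (hV1.trans inf_le_right) W1 (hW1.trans inf_le_right) e c
      simp only [tangent.res_der] at a1 a2
      simp [a1, a2]
  neg_mem' := by
    rintro P ⟨h1, h2, h3, h4⟩
    refine ⟨fun V W h s => by simp [h1 V W h], fun V g s => ?_, fun V s t => ?_,
      fun x hx => ?_⟩
    · simp only [Prod.snd_neg, Pi.neg_apply, AddMonoidHom.neg_apply, h2, Prod.fst_neg,
        tangent.neg_der, Derivation.neg_apply, smul_neg, neg_smul]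
      abel
    · simp only [Prod.snd_neg, Pi.neg_apply, AddMonoidHom.neg_apply, h3, map_neg]
      abel
    · obtain ⟨V, hV, W, v, hxV, hVW, hr⟩ := h4 x hx
      refine ⟨V, hV, W, -v, hxV, hVW, fun V1 hV1 W1 hW1 e c => ?_⟩
      have a1 := hr V1 hV1 W1 hW1 e c
      simp only [tangent.res_der] at a1
      simp [a1]

/-- The group of sections over `U` of `Der_Lie(𝒜_S) ∩ D^{≤ 1}_X(𝒜_S)` with basic symbol. -/
abbrev BasicOp {π : X ⟶ S} (F : Family π) (p : S ⟶ Y) (U : X.Opens) : Type :=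
  basicOpSubgroup F p U

namespace BasicOp

variable {π : X ⟶ S} {F : Family π} {p : S ⟶ Y} {U : X.Opens}

/-- The symbol. -/
def symbol (P : BasicOp F p U) : tangent (π ≫ p) U := P.1.1

/-- The action on sections over `V ≤ U`. -/
def act (P : BasicOp F p U) {V : X.Opens} (h : V ≤ U) : Γ(F.sheaf, V) →+ Γ(F.sheaf, V) :=
  P.1.2 ⟨V, h⟩

theorem act_smul (P : BasicOp F p U) {V : X.Opens} (h : V ≤ U) (g : Γ(X, V))
    (s : Γ(F.sheaf, V)) : P.act h (g • s) = g • P.act h s + P.symbol.der h g • s :=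
  P.2.2.1 ⟨V, h⟩ g s

theorem act_bracket (P : BasicOp F p U) {V : X.Opens} (h : V ≤ U) (s t : Γ(F.sheaf, V)) :
    P.act h (F.bracket V s t) = F.bracket V (P.act h s) t + F.bracket V s (P.act h t) :=
  P.2.2.2.1 ⟨V, h⟩ s t

theorem mres_act (P : BasicOp F p U) {V W : X.Opens} (h : V ≤ U) (h' : W ≤ V)
    (s : Γ(F.sheaf, V)) :
    mres F.sheaf h' (P.act h s) = P.act (h'.trans h) (mres F.sheaf h' s) :=
  P.2.1 ⟨V, h⟩ ⟨W, h'.trans h⟩ h' s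

theorem symbol_basic (P : BasicOp F p U) : IsBasic π p P.symbol := P.2.2.2.2

/-- Restriction of operators. -/
def res {U V : X.Opens} (h : V ≤ U) : BasicOp F p U →+ BasicOp F p V where
  toFun P := ⟨(tangent.res h P.symbol, fun W => P.act (W.2.trans h)),
    fun V' W h' s => P.mres_act (V'.2.trans h) h' s,
    fun V' g s => P.act_smul (V'.2.trans h) g s,
    fun V' s t => P.act_bracket (V'.2.trans h) s t,
    fun x hx => by
      obtain ⟨V1, hV1, W, v, hxV, hVW, hr⟩ := P.symbol_basic x (h hx)
      exact ⟨V1 ⊓ V, inf_le_right, W, v, ⟨hxV, hx⟩, inf_le_left.trans hVW,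
        fun V2 hV2 W1 hW1 e c => hr V2 (hV2.trans inf_le_left) W1 hW1 e c⟩⟩
  map_zero' := rfl
  map_add' _ _ := rfl

/-- The commutator of operators (the symbol of a commutator is the commutator of the symbols). -/
instance : Bracket (BasicOp F p U) (BasicOp F p U) where
  bracket P Q := ⟨(⁅P.symbol, Q.symbol⁆,
      fun V => (P.act V.2).comp (Q.act V.2) - (Q.act V.2).comp (P.act V.2)), by
    refine ⟨fun V W h s => ?_, fun V g s => ?_, fun V s t => ?_, fun x hx => ?_⟩
    · simp only [AddMonoidHom.sub_apply, AddMonoidHom.comp_apply, map_sub, mres_act]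
    · simp only [AddMonoidHom.sub_apply, AddMonoidHom.comp_apply, act_smul, map_add,
        tangent.lie_der, Derivation.commutator_apply, sub_smul, smul_sub]
      abel
    · simp only [AddMonoidHom.sub_apply, AddMonoidHom.comp_apply, act_bracket, map_add, map_sub]
      abel
    · obtain ⟨V, hV, W, v, hxV, hVW, hr⟩ := P.symbol_basic x hx
      obtain ⟨V', hV', W', v', hxV', hVW', hr'⟩ := Q.symbol_basic x hx
      refine ⟨V ⊓ V', inf_le_left.trans hV, W ⊓ W',
        ⁅tangent.res (V := W ⊓ W') inf_le_left v, tangent.res (V := W ⊓ W') inf_le_right v'⁆,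
        ⟨hxV, hxV'⟩,
        fun y hy => ⟨hVW hy.1, hVW' hy.2⟩, fun V1 hV1 W1 hW1 e c => ?_⟩
      have a1 := hr V1 (hV1.trans inf_le_left) W1 (hW1.trans inf_le_left) e
      have a2 := hr' V1 (hV1.trans inf_le_right) W1 (hW1.trans inf_le_right) e
      simp only [tangent.res_der] at a1 a2
      simp [Derivation.commutator_apply, a1, a2]⟩

/-- Multiplication of an operator by a local function of `S`. -/
def smulBase {W : S.Opens} (e : U ≤ π ⁻¹ᵁ W) (b : Γ(S, W)) (P : BasicOp F p U) :
    BasicOp F p U :=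
  ⟨(pull π e b • P.symbol, fun V =>
      { toFun := fun s => pull π (V.2.trans e) b • P.act V.2 s
        map_zero' := by simp
        map_add' := fun s t => by simp }), by
    have bil : ∀ (V : X.Opens) (h : V ≤ U) (s t : Γ(F.sheaf, V)),
        F.bracket V s (pull π (h.trans e) b • t) = pull π (h.trans e) b • F.bracket V s t := by
      intro V h s t
      rw [F.skew, F.bracket_smul_base, F.skew t s, smul_neg, neg_neg]
    refine ⟨fun V W h s => ?_, fun V g s => ?_, fun V s t => ?_, fun x hx => ?_⟩
    · change mres F.sheaf h (pull π (V.2.trans e) b • P.act V.2 s) =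
        pull π (W.2.trans e) b • P.act W.2 (mres F.sheaf h s)
      rw [mres_smul, fres_pull, mres_act]
    · change pull π (V.2.trans e) b • P.act V.2 (g • s) =
        g • (pull π (V.2.trans e) b • P.act V.2 s) + (pull π e b • P.symbol).der V.2 g • s
      rw [act_smul, smul_add, smul_comm]
      simp only [tangent.smul_der, Derivation.smul_apply, fres_pull, smul_eq_mul, mul_smul]
    · change pull π (V.2.trans e) b • P.act V.2 (F.bracket V.1 s t) =
        F.bracket V.1 (pull π (V.2.trans e) b • P.act V.2 s) t +
          F.bracket V.1 s (pull π (V.2.trans e) b • P.act V.2 t)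
      rw [act_bracket, smul_add, F.bracket_smul_base, bil V.1 V.2]
    · obtain ⟨V, hV, W', v, hxV, hVW, hr⟩ := P.symbol_basic x hx
      refine ⟨V, hV, W ⊓ W', fres (V := W ⊓ W') inf_le_left b • tangent.res (V := W ⊓ W') inf_le_right v,
        hxV,
        fun y hy => ⟨e (hV hy), hVW hy⟩, fun V1 hV1 W1 hW1 e' c => ?_⟩
      have a1 := hr V1 hV1 W1 (hW1.trans inf_le_right) e' c
      change fres _ (pull π e b) * P.symbol.der _ (pull π e' c) =
        pull π e' (fres hW1 (fres inf_le_left b) * v.der _ c)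
      rw [fres_pull, fres_fres, map_mul, pull_fres, ← a1]
      rfl⟩

/-- The operator `{s, -}` on `𝒜_S` given by a section `s` of `𝒜_S`, with symbol `a_S(s)`. -/
def ad (F : Family π) (p : S ⟶ Y) (U : X.Opens) : Γ(F.sheaf, U) →+ BasicOp F p U where
  toFun s := ⟨(tangent.incl π p U (F.anchor U s), fun V => F.bracket V.1 (mres F.sheaf V.2 s)), by
    refine ⟨fun V W h t => ?_, fun V g t => ?_, fun V t r => ?_, fun x hx => ?_⟩
    · change mres F.sheaf h (F.bracket V.1 _ t) = F.bracket W.1 _ _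
      rw [F.bracket_res, mres_mres]
    · change F.bracket V.1 _ (g • t) = g • F.bracket V.1 _ t + _
      rw [F.skew, F.leibniz, F.skew t, F.anchor_res]
      simp only [tangent.res_der, tangent.incl_der, smul_neg, neg_sub, sub_neg_eq_add]
      abel
    · change F.bracket V.1 _ _ = F.bracket V.1 (F.bracket V.1 _ t) r
        + F.bracket V.1 t (F.bracket V.1 _ r)
      have h1 := F.jacobi (mres F.sheaf V.2 s) t r
      rw [F.skew r (mres F.sheaf V.2 s), map_neg, F.skew r] at h1
      rw [← sub_eq_zero, ← h1]
      abel
    · refine ⟨U, le_rfl, ⊤, 0, hx, fun _ _ => trivial, fun V hV W' hW e c => ?_⟩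
      simpa using (F.anchor U s).der_pull hV e c⟩
  map_zero' := by
    apply Subtype.ext
    refine Prod.ext ?_ (funext fun V => ?_)
    · change tangent.incl π p U (F.anchor U 0) = 0
      simp
    · change F.bracket V.1 (mres F.sheaf V.2 0) = 0
      simp
  map_add' s t := by
    apply Subtype.ext
    refine Prod.ext ?_ (funext fun V => ?_)
    · change tangent.incl π p U (F.anchor U (s + t)) = tangent.incl π p U (F.anchor U s)
        + tangent.incl π p U (F.anchor U t)
      simp
    · change F.bracket V.1 (mres F.sheaf V.2 (s + t)) = F.bracket V.1 (mres F.sheaf V.2 s)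
        + F.bracket V.1 (mres F.sheaf V.2 t)
      simp

theorem res_ad (F : Family π) (p : S ⟶ Y) {U V : X.Opens} (h : V ≤ U) (s : Γ(F.sheaf, U)) :
    res h (ad F p U s) = ad F p V (mres F.sheaf h s) := by
  apply Subtype.ext
  refine Prod.ext ?_ (funext fun W => ?_)
  · change tangent.res h (tangent.incl π p U (F.anchor U s)) = tangent.incl π p V (F.anchor V _)
    rw [F.anchor_res]
    rfl
  · change F.bracket W.1 (mres F.sheaf _ s) = F.bracket W.1 (mres F.sheaf _ (mres F.sheaf _ s))
    rw [mres_mres]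

end BasicOp

/-- The presheaf quotient of `BasicOp` by (the image of) `𝒜_S`. -/
def uPresheaf {π : X ⟶ S} (F : Family π) (p : S ⟶ Y) : TopCat.Presheaf Ab X where
  obj U := AddCommGrpCat.of (BasicOp F p U.unop ⧸ (BasicOp.ad F p U.unop).range)
  map {U V} i := AddCommGrpCat.ofHom (QuotientAddGroup.map _ _ (BasicOp.res i.unop.le) (by
    rintro _ ⟨s, rfl⟩
    exact ⟨mres F.sheaf i.unop.le s, (BasicOp.res_ad F p i.unop.le s).symm⟩))
  map_id U := by ext D; rfl
  map_comp i j := by ext D; rfl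

/-- The sheaf `𝔲(𝒜_S)`: the quotient, as a sheaf, of the operators in
`Der_Lie(𝒜_S) ∩ D^{≤ 1}_X(𝒜_S)` with basic symbol by `𝒜_S`. -/
def uSheaf {π : X ⟶ S} (F : Family π) (p : S ⟶ Y) : TopCat.Presheaf Ab X :=
  sheafify (Opens.grothendieckTopology X) (uPresheaf F p)

/-- The section of `𝔲(𝒜_S)` over `U` given by an operator over `U`. -/
def uClass {π : X ⟶ S} {F : Family π} {p : S ⟶ Y} {U : X.Opens} (P : BasicOp F p U) :
    (uSheaf F p).obj (op U) :=
  (toSheafify (Opens.grothendieckTopology X) (uPresheaf F p)).app (op U)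
    (QuotientAddGroup.mk P : BasicOp F p U ⧸ (BasicOp.ad F p U).range)

/-- The inverse image sheaf `π⁻¹ T_S`. -/
def invTangent (π : X ⟶ S) (p : S ⟶ Y) : TopCat.Presheaf Ab X :=
  sheafify (Opens.grothendieckTopology X)
    ((TopCat.Presheaf.pullback Ab π.base).obj (tangent.presheaf p))

/-- The section `π⁻¹ v` over `U` of `π⁻¹ T_S`, for `v` a section of `T_S` over `W` and
`U ≤ π⁻¹ W`. -/
def invSection (π : X ⟶ S) {p : S ⟶ Y} {W : S.Opens} {U : X.Opens} (e : U ≤ π ⁻¹ᵁ W)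
    (v : tangent p W) : (invTangent π p).obj (op U) :=
  (invTangent π p).map (homOfLE e).op
    ((toSheafify (Opens.grothendieckTopology X)
        ((TopCat.Presheaf.pullback Ab π.base).obj (tangent.presheaf p))).app (op (π ⁻¹ᵁ W))
      (((TopCat.Presheaf.pullbackPushforwardAdjunction Ab π.base).unit.app
        (tangent.presheaf p)).app (op W) v))

/-- A morphism of sheaves of `π⁻¹ 𝒪_S`-Lie algebras `π⁻¹ T_S ⟶ 𝔲(𝒜_S)` which is a section of the
symbol map `𝔲(𝒜_S) ⟶ π⁻¹ T_S`.  The module structure and the bracket of `𝔲(𝒜_S)` are those induced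
by the multiplication of operators by functions of `S` and by the commutator of operators. -/
structure FlatSection {π : X ⟶ S} (F : Family π) (p : S ⟶ Y) where
  /-- the morphism of sheaves of abelian groups -/
  hom : invTangent π p ⟶ uSheaf F p
  symbol : ∀ {W : S.Opens} {U : X.Opens} (e : U ≤ π ⁻¹ᵁ W) (v : tangent p W) (P : BasicOp F p U),
    hom.app (op U) (invSection π e v) = uClass P → Related π p P.symbol v
  smul : ∀ {W : S.Opens} {U : X.Opens} (e : U ≤ π ⁻¹ᵁ W) (b : Γ(S, W)) (v : tangent p W)
    (P : BasicOp F p U), hom.app (op U) (invSection π e v) = uClass P →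
      hom.app (op U) (invSection π e (b • v)) = uClass (BasicOp.smulBase e b P)
  lie : ∀ {W : S.Opens} {U : X.Opens} (e : U ≤ π ⁻¹ᵁ W) (v w : tangent p W)
    (P Q : BasicOp F p U), hom.app (op U) (invSection π e v) = uClass P →
      hom.app (op U) (invSection π e w) = uClass Q →
        hom.app (op U) (invSection π e ⁅v, w⁆) = uClass ⁅P, Q⁆

/-! ### Unfoldings -/

/-- An unfolding of a family `𝒜_S` over `π : X ⟶ S` (where `p : S ⟶ Y` is the structure morphism,
`Y = Spec ℂ`): a Lie algebroid `𝒜` on `X` with an inclusion `ι : 𝒜_S ⟶ 𝒜` compatible with anchors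
and brackets, such that `𝒜_S = a⁻¹(Im a_S)` and `rank 𝒜 = rank 𝒜_S + dim S`.  Here `Im a_S` is the
image sheaf, and the rank is the rank over `Γ(X, U)` for any non-empty affine open `U`. -/
structure Unfolding {π : X ⟶ S} (F : Family π) (p : S ⟶ Y) where
  /-- the Lie algebroid on `X` -/
  alg : LieAlgebroid (π ≫ p)
  /-- the inclusion of the family -/
  ι : F.sheaf ⟶ alg.sheaf
  ι_injective : ∀ U : X.Opens, Function.Injective (ι.app U)
  anchor_ι : ∀ (U : X.Opens) (s : Γ(F.sheaf, U)),
    alg.anchor U (ι.app U s) = tangent.incl π p U (F.anchor U s)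
  bracket_ι : ∀ (U : X.Opens) (s t : Γ(F.sheaf, U)),
    alg.bracket U (ι.app U s) (ι.app U t) = ι.app U (F.bracket U s t)
  preimage : ∀ (U : X.Opens) (x : Γ(alg.sheaf, U)),
    (∀ y ∈ U, ∃ (V : X.Opens) (h : V ≤ U) (s : Γ(F.sheaf, V)), y ∈ V ∧
      tangent.res h (alg.anchor U x) = tangent.incl π p V (F.anchor V s)) →
    ∃ s : Γ(F.sheaf, U), ι.app U s = x
  rank : ∀ U : X.Opens, IsAffineOpen U → (U : Set X).Nonempty →
    ((Module.finrank Γ(X, U) Γ(alg.sheaf, U) : ℕ) : WithBot ℕ∞) =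
      ((Module.finrank Γ(X, U) Γ(F.sheaf, U) : ℕ) : WithBot ℕ∞) + topologicalKrullDim S

namespace Unfolding

variable {π : X ⟶ S} {F : Family π} {p : S ⟶ Y}

/-- The map between the presheaf cokernels of `a_S` and `a` induced by `T_{X|S} ⊆ T_X`. -/
def normalMap (A : Unfolding F p) : F.normalPresheaf ⟶ A.alg.normalPresheaf where
  app U := AddCommGrpCat.ofHom (QuotientAddGroup.map _ _ (tangent.incl π p U.unop) (by
    rintro _ ⟨s, rfl⟩
    exact ⟨A.ι.app U.unop s, A.anchor_ι U.unop s⟩))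
  naturality U V i := by
    ext D
    obtain ⟨D, rfl⟩ := QuotientAddGroup.mk_surjective D
    rfl

/-- The unfolding is transversal if the induced map `N_S 𝒜 ⟶ N 𝒜` between the cokernel sheaves of
the anchors is an isomorphism. -/
def IsTransversal (A : Unfolding F p) : Prop :=
  IsIso (sheafifyMap (Opens.grothendieckTopology X) A.normalMap)

/-- An isomorphism of Lie algebroids which is the identity on the family. -/
def IsIsomorphic (A B : Unfolding F p) : Prop :=
  ∃ φ : A.alg.sheaf ≅ B.alg.sheaf,
    A.ι ≫ φ.hom = B.ι ∧
    (∀ (U : X.Opens) (x : Γ(A.alg.sheaf, U)),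
      B.alg.anchor U (φ.hom.app U x) = A.alg.anchor U x) ∧
    (∀ (U : X.Opens) (x y : Γ(A.alg.sheaf, U)),
      φ.hom.app U (A.alg.bracket U x y) = B.alg.bracket U (φ.hom.app U x) (φ.hom.app U y))

/-- The operator `P` on `𝒜_S` is induced by the section `x` of `𝒜`: its symbol is `a(x)`, and
`P` is the restriction of `{x, -}` to `𝒜_S`. -/
def Induces (A : Unfolding F p) {U : X.Opens} (x : Γ(A.alg.sheaf, U)) (P : BasicOp F p U) : Prop :=
  P.symbol = A.alg.anchor U x ∧
  ∀ (V : X.Opens) (h : V ≤ U) (s : Γ(F.sheaf, V)),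
    A.ι.app V (P.act h s) = A.alg.bracket V (mres A.alg.sheaf h x) (A.ι.app V s)

theorem hom_inv_app {M N : X.Modules} (φ : M ≅ N) (U : X.Opens) (x : Γ(M, U)) :
    φ.inv.app U (φ.hom.app U x) = x := by
  have h : (φ.hom ≫ φ.inv).app U = 𝟙 _ := by rw [φ.hom_inv_id]; rfl
  exact congr($(h).hom x)

theorem inv_hom_app {M N : X.Modules} (φ : M ≅ N) (U : X.Opens) (x : Γ(N, U)) :
    φ.hom.app U (φ.inv.app U x) = x := hom_inv_app φ.symm U x

end Unfolding

/-- Transversal unfoldings of a family. -/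
def TransversalUnfolding {π : X ⟶ S} (F : Family π) (p : S ⟶ Y) :=
  {A : Unfolding F p // A.IsTransversal}

/-- Transversal unfoldings, identified when they are isomorphic over the given family. -/
instance transversalSetoid {π : X ⟶ S} (F : Family π) (p : S ⟶ Y) :
    Setoid (TransversalUnfolding F p) where
  r A B := A.1.IsIsomorphic B.1
  iseqv :=
    { refl := fun A => ⟨Iso.refl _, by simp, fun _ _ => rfl, fun _ _ _ => rfl⟩
      symm := by
        rintro A B ⟨φ, h1, h2, h3⟩
        refine ⟨φ.symm, by rw [← h1]; simp, fun U x => ?_, fun U x y => ?_⟩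
        · have := h2 U (φ.inv.app U x)
          rw [Unfolding.inv_hom_app] at this
          exact this.symm
        · have := congrArg (φ.inv.app U) (h3 U (φ.inv.app U x) (φ.inv.app U y))
          rw [Unfolding.inv_hom_app, Unfolding.inv_hom_app, Unfolding.hom_inv_app] at this
          exact this.symm
      trans := by
        rintro A B C ⟨φ, h1, h2, h3⟩ ⟨φ', h1', h2', h3'⟩
        refine ⟨φ ≪≫ φ', by rw [← h1', ← h1]; simp, fun U x => ?_, fun U x y => ?_⟩
        · exact (h2' U (φ.hom.app U x)).trans (h2 U x)
        · change φ'.hom.app U (φ.hom.app U _) = _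
          rw [h3, h3']
          rfl }

end LieAlgd

end

/-!
# Transversal unfoldings and flat sections of `𝔲(𝒜_S)`

*From unfoldings to sections.* Let `𝒜` be a transversal unfolding. A vector field `v` of `S` lifts
locally to `X`, because `π` is smooth (`hasLifts_of_smooth`), and, by transversality, to a section
`x` of `𝒜` (`Unfolding.IsTransversal.exists_related`). The anchor of `{x, s}`, for `s` in `𝒜_S`, is
vertical, since `a(x)` is basic, so `{x, -}` preserves `𝒜_S = a⁻¹(Im a_S)`. Two choices of `x` have
the same image in `π^* T_S`, hence differ by a section of `𝒜_S`, and the class of `{x, -}` in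
`𝔲(𝒜_S)` depends on `v` only. These classes glue to the flat section
(`Unfolding.IsTransversal.exists_flatSection`).

*Coordinates.* The smoothness of `X` and of `π` forces `Ω_S` to be locally free along the image
of `π`, of rank `dim S`. So `X` is covered by domains of frames (`Frame`, `exists_hasFrames`):
functions `t_1, …, t_n` on `S`, `n = dim S`, with dual vector fields `v_1, …, v_n`. No smoothness of
`S` away from the image of `π` is used.

*Injectivity.* If two transversal unfoldings define the same flat section, local lifts of the same
vector field to them can be chosen to induce the same operator. Locally both are the direct sum of
`𝒜_S` and the free module on lifts of the `v_i`. The `𝒪_X`-span of the pairs of sections inducing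
the same operator is the graph of an isomorphism: the injectivity of `𝒜_S → 𝒰` shows that the
components in these decompositions agree (`Unfolding.isIsomorphic_of_haveCommonLifts`).

*Surjectivity.* Let `υ` be a flat section. The unfolding is to be generated over `𝒪_X` by the
operators `P` which lift values of `υ`. As operators on `𝒜_S` cannot be multiplied by functions of
`X`, one fixes a frame on a single non-empty open subset `V₀` together with operators `P_i` lifting
`υ(v_i)` (`LiftedFrame`). Over `V₀` a lift of a value of `υ` is uniquely of the form
`P = {s, -} + ∑ σ(P)(t_i) P_i`. Sections of the unfolding over `U` are taken as pairs `(D, s)` of a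
vector field `D` on `U` and a section `s` of `𝒜_S` over `U ∩ V₀`, which stand for
`s + ∑ D(t_i) P_i`, with the bracket dictated by the Leibniz rule; the unfolding is the sheaf locally
spanned by the pairs which come from lifts (`LiftedFrame.Amb`, `LiftedFrame.sheaf`). On these pairs
the bracket is the commutator of operators (`LiftedFrame.Amb.IsGen.lie`), which gives the Jacobi
identity. In the domain of any other frame the sheaf is `𝒜_S` plus the free module on the lifts of
the coordinate vector fields (`LiftedFrame.IsGens.exists_eq`). Hence it is quasi-coherent, and over
an affine open subset the quotient by `𝒜_S` is finite projective of rank `dim S`; so the sheaf is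
coherent and reflexive, of the required rank, and transversal.
-/


noncomputable section

namespace LieAlgd

/-! ### Gluing sections of sheaves -/

section Gluing

set_option linter.unusedSectionVars false

variable {C : Type*} [Category C] {FC : C → C → Type*} {CC : C → Type*}
  [∀ A B, FunLike (FC A B) (CC A) (CC B)] [ConcreteCategory C FC]
  [Limits.HasLimitsOfSize.{0, 0} C] [(forget C).ReflectsIsomorphisms]
  [Limits.PreservesLimitsOfSize.{0, 0} (forget C)]
  {X : TopCat.{0}} {F : TopCat.Presheaf C X}

theorem map_homOfLE_comp {U V W : Opens X} (h : V ≤ U) (h' : W ≤ V)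
    (s : ToType (F.obj (op U))) :
    F.map (homOfLE h').op (F.map (homOfLE h).op s) = F.map (homOfLE (h'.trans h)).op s := by
  rw [← ConcreteCategory.comp_apply, ← F.map_comp]
  rfl

theorem eq_of_locally_eq (hF : F.IsSheaf) {U : Opens X} (s t : ToType (F.obj (op U)))
    (H : ∀ x ∈ U, ∃ (V : Opens X) (h : V ≤ U), x ∈ V ∧
      F.map (homOfLE h).op s = F.map (homOfLE h).op t) : s = t := by
  choose V hV hx e using H
  refine TopCat.Sheaf.eq_of_locally_eq' ⟨F, hF⟩ (fun x : U => V x.1 x.2) U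
    (fun x => homOfLE (hV x.1 x.2)) ?_ s t (fun x => e x.1 x.2)
  exact fun x hxU => Opens.mem_iSup.mpr ⟨⟨x, hxU⟩, hx x hxU⟩

/-- Gluing of sections which are locally characterized by a property `Q`: if `Q` is stable under
restriction and locally has exactly one solution, then there is a section restricting to every
local solution of `Q`. -/
theorem exists_glue (hF : F.IsSheaf) (U : Opens X)
    (Q : ∀ V : Opens X, ToType (F.obj (op V)) → Prop)
    (hex : ∀ x ∈ U, ∃ V : Opens X, V ≤ U ∧ x ∈ V ∧ ∃ s, Q V s)
    (huniq : ∀ V, V ≤ U → ∀ s s', Q V s → Q V s' → s = s')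
    (hres : ∀ V V' (h : V' ≤ V), V ≤ U → ∀ s, Q V s → Q V' (F.map (homOfLE h).op s)) :
    ∃ s : ToType (F.obj (op U)), ∀ V (h : V ≤ U) s', Q V s' → F.map (homOfLE h).op s = s' := by
  let ι := {p : Σ V : Opens X, ToType (F.obj (op V)) // p.1 ≤ U ∧ Q p.1 p.2}
  obtain ⟨s, hs, -⟩ := TopCat.Sheaf.existsUnique_gluing' ⟨F, hF⟩ (fun i : ι => i.1.1) U
    (fun i => homOfLE i.2.1) (fun x hx => by
      obtain ⟨V, h, hxV, s, hs⟩ := hex x hx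
      exact Opens.mem_iSup.mpr ⟨⟨⟨V, s⟩, h, hs⟩, hxV⟩) (fun i => i.1.2) (by
      intro i j
      exact huniq _ (inf_le_left.trans i.2.1) _ _
        (hres _ _ inf_le_left i.2.1 _ i.2.2) (hres _ _ inf_le_right j.2.1 _ j.2.2))
  exact ⟨s, fun V h s' hs' => hs ⟨⟨V, s'⟩, h, hs'⟩⟩

end Gluing

variable {X Y S : Scheme.{0}}

theorem fres_eq_of_locally {U : X.Opens} (s t : Γ(X, U))
    (H : ∀ x ∈ U, ∃ (V : X.Opens) (h : V ≤ U), x ∈ V ∧ fres h s = fres h t) : s = t :=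
  eq_of_locally_eq (F := X.presheaf) X.sheaf.property s t H

theorem mres_eq_of_locally (M : X.Modules) {U : X.Opens} (s t : Γ(M, U))
    (H : ∀ x ∈ U, ∃ (V : X.Opens) (h : V ≤ U), x ∈ V ∧ mres M h s = mres M h t) : s = t :=
  eq_of_locally_eq (F := M.presheaf) M.isSheaf s t H

theorem exists_fglue (U : X.Opens) (Q : ∀ V : X.Opens, Γ(X, V) → Prop)
    (hex : ∀ x ∈ U, ∃ V : X.Opens, V ≤ U ∧ x ∈ V ∧ ∃ s, Q V s)
    (huniq : ∀ V, V ≤ U → ∀ s s', Q V s → Q V s' → s = s')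
    (hres : ∀ V V' (h : V' ≤ V), V ≤ U → ∀ s, Q V s → Q V' (fres h s)) :
    ∃ s : Γ(X, U), ∀ V (h : V ≤ U) s', Q V s' → fres h s = s' :=
  exists_glue (F := X.presheaf) X.sheaf.property U Q hex huniq hres

theorem exists_mglue (M : X.Modules) (U : X.Opens) (Q : ∀ V : X.Opens, Γ(M, V) → Prop)
    (hex : ∀ x ∈ U, ∃ V : X.Opens, V ≤ U ∧ x ∈ V ∧ ∃ s, Q V s)
    (huniq : ∀ V, V ≤ U → ∀ s s', Q V s → Q V s' → s = s')
    (hres : ∀ V V' (h : V' ≤ V), V ≤ U → ∀ s, Q V s → Q V' (mres M h s)) :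
    ∃ s : Γ(M, U), ∀ V (h : V ≤ U) s', Q V s' → mres M h s = s' :=
  exists_glue (F := M.presheaf) M.isSheaf U Q hex huniq hres

namespace tangent

variable {f : X ⟶ Y} {U : X.Opens}

theorem res_smul {V : X.Opens} (h : V ≤ U) (g : Γ(X, U)) (D : tangent f U) :
    res h (g • D) = fres h g • res h D :=
  ext fun W hW k => by
    rw [res_der, smul_der, smul_der, fres_fres, res_der]

theorem res_lie {V : X.Opens} (h : V ≤ U) (D E : tangent f U) :
    res h ⁅D, E⁆ = ⁅res h D, res h E⁆ := rfl

theorem sub_der (D E : tangent f U) {V : X.Opens} (h : V ≤ U) :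
    (D - E).der h = D.der h - E.der h := rfl

theorem sum_der {ι : Type*} (s : Finset ι) (D : ι → tangent f U) {V : X.Opens} (h : V ≤ U)
    (g : Γ(X, V)) : (∑ i ∈ s, D i).der h g = ∑ i ∈ s, (D i).der h g := by
  classical
  induction s using Finset.induction_on with
  | empty => simp
  | insert i s hi ih => rw [Finset.sum_insert hi, Finset.sum_insert hi, add_der,
      Derivation.add_apply, ih]

theorem eq_of_locally (D E : tangent f U)
    (H : ∀ x ∈ U, ∃ (V : X.Opens) (h : V ≤ U), x ∈ V ∧ res h D = res h E) : D = E := by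
  refine ext fun V hV g => fres_eq_of_locally _ _ fun x hx => ?_
  obtain ⟨W, hW, hxW, e⟩ := H x (hV hx)
  refine ⟨V ⊓ W, inf_le_left, ⟨hx, hxW⟩, ?_⟩
  rw [fres_der, fres_der]
  exact congr($(e).der inf_le_right (fres inf_le_left g))

/-- Vector fields glue. -/
theorem exists_glue (U : X.Opens) (Q : ∀ V : X.Opens, tangent f V → Prop)
    (hex : ∀ x ∈ U, ∃ V : X.Opens, V ≤ U ∧ x ∈ V ∧ ∃ s, Q V s)
    (huniq : ∀ V, V ≤ U → ∀ s s', Q V s → Q V s' → s = s')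
    (hres : ∀ V V' (h : V' ≤ V), V ≤ U → ∀ s, Q V s → Q V' (res h s)) :
    ∃ s : tangent f U, ∀ V (h : V ≤ U) s', Q V s' → res h s = s' := by
  -- The value on a function `g` is glued from the values of the local solutions.
  have key : ∀ (V : X.Opens) (hV : V ≤ U) (g : Γ(X, V)), ∃ k : Γ(X, V),
      ∀ (W : X.Opens) (hW : W ≤ V) (D : tangent f W), Q W D →
        fres hW k = D.der le_rfl (fres hW g) := by
    intro V hV g
    obtain ⟨k, hk⟩ := exists_fglue V (fun W k => ∃ (hW : W ≤ V) (D : tangent f W), Q W D ∧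
      k = D.der le_rfl (fres hW g)) (fun x hx => by
        obtain ⟨W, hW, hxW, D, hD⟩ := hex x (hV hx)
        exact ⟨W ⊓ V, inf_le_right, ⟨hxW, hx⟩, _, inf_le_right, _,
          hres _ _ inf_le_left hW _ hD, rfl⟩) (by
        rintro W hW _ _ ⟨h1, D, hD, rfl⟩ ⟨h2, E, hE, rfl⟩
        rw [huniq W (hW.trans hV) D E hD hE]) (by
        rintro W W' h hW _ ⟨h1, D, hD, rfl⟩
        exact ⟨h.trans h1, _, hres _ _ h (hW.trans hV) _ hD, by rw [fres_der, fres_fres]; rfl⟩)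
    exact ⟨k, fun W hW D hD => hk W hW _ ⟨hW, D, hD, rfl⟩⟩
  choose d hd using key
  have loc : ∀ (V : X.Opens) (hV : V ≤ U) (a b : Γ(X, V)),
      (∀ (W : X.Opens) (hW : W ≤ V) (D : tangent f W), Q W D → fres hW a = fres hW b) → a = b := by
    intro V hV a b H
    refine fres_eq_of_locally _ _ fun x hx => ?_
    obtain ⟨W, hW, hxW, D, hD⟩ := hex x (hV hx)
    exact ⟨W ⊓ V, inf_le_right, ⟨hxW, hx⟩, H _ _ _ (hres _ _ inf_le_left hW _ hD)⟩
  refine ⟨⟨fun V => Derivation.mk' (AddMonoidHom.toIntLinearMap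
      { toFun := d V.1 V.2
        map_zero' := loc _ V.2 _ _ fun W hW D hD => by rw [hd _ _ _ W hW D hD]; simp
        map_add' := fun a b => loc _ V.2 _ _ fun W hW D hD => by
          rw [map_add, hd _ _ _ W hW D hD, hd _ _ _ W hW D hD, hd _ _ _ W hW D hD]; simp })
      fun a b => loc _ V.2 _ _ fun W hW D hD => by
        change fres hW (d V.1 V.2 (a * b)) = fres hW (a * d V.1 V.2 b + b * d V.1 V.2 a)
        rw [map_add, map_mul, map_mul, hd _ _ _ W hW D hD, hd _ _ _ W hW D hD,
          hd _ _ _ W hW D hD]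
        simp, ?_, ?_⟩, ?_⟩
  · intro V W h g
    change fres h (d V.1 V.2 g) = d W.1 W.2 (fres h g)
    refine loc _ W.2 _ _ fun W' hW' D hD => ?_
    rw [hd _ _ _ W' hW' D hD, fres_fres, hd _ _ _ W' (hW'.trans h) D hD, fres_fres]
  · intro V W e c
    change d V.1 V.2 (pull f e c) = 0
    refine loc _ V.2 _ _ fun W' hW' D hD => ?_
    rw [hd _ _ _ W' hW' D hD, fres_pull, der_pull, map_zero]
  · intro V hV D hD
    refine ext fun W hW g => ?_
    change d W (hW.trans hV) g = _
    have := hd W (hW.trans hV) g W le_rfl (res hW D) (hres _ _ hW hV _ hD)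
    rw [fres_self, fres_self] at this
    exact this

theorem incl_injective (π : X ⟶ S) (p : S ⟶ Y) (U : X.Opens) :
    Function.Injective (incl π p U) := fun _ _ h =>
  ext fun _ hV g => congr($(h).der hV g)

theorem incl_res (π : X ⟶ S) (p : S ⟶ Y) {U V : X.Opens} (h : V ≤ U) (D : tangent π U) :
    res h (incl π p U D) = incl π p V (res h D) := rfl

theorem incl_smul (π : X ⟶ S) (p : S ⟶ Y) {U : X.Opens} (g : Γ(X, U)) (D : tangent π U) :
    incl π p U (g • D) = g • incl π p U D := rfl

/-- A vector field on `X` which kills the functions of `S` is vertical. -/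
theorem exists_incl_eq {π : X ⟶ S} {p : S ⟶ Y} {U : X.Opens} (D : tangent (π ≫ p) U)
    (H : ∀ (V : X.Opens) (hV : V ≤ U) (W : S.Opens) (e : V ≤ π ⁻¹ᵁ W) (c : Γ(S, W)),
      D.der hV (pull π e c) = 0) : ∃ E : tangent π U, incl π p U E = D :=
  ⟨⟨D.1, D.2.1, fun V W e c => H V.1 V.2 W e c⟩, rfl⟩

end tangent

/-! ### Relatedness of vector fields -/

section Related

variable {π : X ⟶ S} {p : S ⟶ Y} {U : X.Opens} {W : S.Opens}

theorem Related.res {D : tangent (π ≫ p) U} {v : tangent p W} (H : Related π p D v)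
    {V : X.Opens} {W' : S.Opens} (h : V ≤ U) (h' : W' ≤ W) :
    Related π p (tangent.res h D) (tangent.res h' v) :=
  fun V1 hV1 W1 hW1 e c => H V1 (hV1.trans h) W1 (hW1.trans h') e c

theorem Related.res_left {D : tangent (π ≫ p) U} {v : tangent p W} (H : Related π p D v)
    {V : X.Opens} (h : V ≤ U) : Related π p (tangent.res h D) v := H.res h le_rfl

theorem Related.add {D E : tangent (π ≫ p) U} {v w : tangent p W} (H : Related π p D v)
    (K : Related π p E w) : Related π p (D + E) (v + w) :=
  fun V1 hV1 W1 hW1 e c => by simp [H V1 hV1 W1 hW1 e c, K V1 hV1 W1 hW1 e c]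

theorem Related.sub {D E : tangent (π ≫ p) U} {v w : tangent p W} (H : Related π p D v)
    (K : Related π p E w) : Related π p (D - E) (v - w) :=
  fun V1 hV1 W1 hW1 e c => by
    simp [tangent.sub_der, H V1 hV1 W1 hW1 e c, K V1 hV1 W1 hW1 e c]

theorem Related.lie {D E : tangent (π ≫ p) U} {v w : tangent p W} (H : Related π p D v)
    (K : Related π p E w) : Related π p ⁅D, E⁆ ⁅v, w⁆ :=
  fun V1 hV1 W1 hW1 e c => by
    simp [Derivation.commutator_apply, H V1 hV1 W1 hW1 e, K V1 hV1 W1 hW1 e]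

theorem related_incl (D : tangent π U) : Related π p (tangent.incl π p U D) (0 : tangent p W) :=
  fun V1 hV1 W1 _ e c => by simp [D.der_pull hV1 e c]

theorem Related.isBasic {D : tangent (π ≫ p) U} {v : tangent p W} (H : Related π p D v)
    (e : U ≤ π ⁻¹ᵁ W) : IsBasic π p D :=
  fun _ hx => ⟨U, le_rfl, W, v, hx, e, H⟩

theorem IsBasic.res {D : tangent (π ≫ p) U} (H : IsBasic π p D) {V : X.Opens} (h : V ≤ U) :
    IsBasic π p (tangent.res h D) := by
  intro x hx
  obtain ⟨V1, hV1, W, v, hxV, hVW, hr⟩ := H x (h hx)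
  exact ⟨V1 ⊓ V, inf_le_right, W, v, ⟨hxV, hx⟩, inf_le_left.trans hVW, hr.res_left inf_le_left⟩

/-- A vertical vector field kills the derivatives of functions of `S` along a basic field. -/
theorem IsBasic.der_der_pull {D : tangent (π ≫ p) U} (H : IsBasic π p D) (E : tangent π U)
    {V : X.Opens} (hV : V ≤ U) {W : S.Opens} (e : V ≤ π ⁻¹ᵁ W) (c : Γ(S, W)) :
    E.der hV (D.der hV (pull π e c)) = 0 := by
  refine fres_eq_of_locally _ _ fun x hx => ?_
  obtain ⟨V1, hV1, W1, v, hxV, hVW, hr⟩ := H x (hV hx)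
  refine ⟨V ⊓ V1, inf_le_left, ⟨hx, hxV⟩, ?_⟩
  have e' : V ⊓ V1 ≤ π ⁻¹ᵁ (W ⊓ W1) := fun y hy => ⟨e hy.1, hVW hy.2⟩
  have := hr (V ⊓ V1) inf_le_right (W ⊓ W1) inf_le_right e' (fres inf_le_left c)
  rw [pull_fres, tangent.res_der] at this
  rw [tangent.fres_der, tangent.fres_der, fres_pull, this, E.der_pull, map_zero]

/-- The bracket of a basic and a vertical vector field is vertical. -/
theorem IsBasic.exists_lie_incl {D : tangent (π ≫ p) U} (H : IsBasic π p D) (E : tangent π U) :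
    ∃ E' : tangent π U, tangent.incl π p U E' = ⁅D, tangent.incl π p U E⁆ := by
  refine tangent.exists_incl_eq _ fun V hV W e c => ?_
  rw [tangent.lie_der, Derivation.commutator_apply, tangent.incl_der, E.der_pull,
    H.der_der_pull, map_zero, sub_zero]

theorem related_of_locally {D : tangent (π ≫ p) U} {v : tangent p W}
    (H : ∀ x ∈ U, ∃ (V : X.Opens) (h : V ≤ U), x ∈ V ∧ Related π p (tangent.res h D) v) :
    Related π p D v := by
  intro V hV W' hW e c
  refine fres_eq_of_locally _ _ fun x hx => ?_
  obtain ⟨V1, hV1, hxV, hr⟩ := H x (hV hx)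
  refine ⟨V ⊓ V1, inf_le_left, ⟨hx, hxV⟩, ?_⟩
  have := hr (V ⊓ V1) inf_le_right W' hW (inf_le_left.trans e) c
  rw [tangent.fres_der, fres_pull, fres_pull]
  exact this

/-- The difference of two vector fields related to the same vector field is vertical. -/
theorem Related.exists_incl_sub {D E : tangent (π ≫ p) U} {v : tangent p W}
    (H : Related π p D v) (K : Related π p E v) (e : U ≤ π ⁻¹ᵁ W) :
    ∃ E' : tangent π U, tangent.incl π p U E' = D - E := by
  refine tangent.exists_incl_eq _ fun V hV W' e' c => ?_
  have e2 : V ≤ π ⁻¹ᵁ (W' ⊓ W) := fun y hy => ⟨e' hy, e (hV hy)⟩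
  have h1 := (H.sub K) V hV (W' ⊓ W) inf_le_right e2 (fres inf_le_left c)
  rw [pull_fres, sub_self] at h1
  rw [h1]; simp

end Related

/-! ### Differential operators -/

namespace BasicOp

variable {π : X ⟶ S} {F : Family π} {p : S ⟶ Y} {U : X.Opens}

theorem ext {P Q : BasicOp F p U} (hs : P.symbol = Q.symbol)
    (H : ∀ (V : X.Opens) (h : V ≤ U) (s : Γ(F.sheaf, V)), P.act h s = Q.act h s) : P = Q :=
  Subtype.ext (Prod.ext hs (funext fun V => AddMonoidHom.ext fun s => H V.1 V.2 s))

@[simp] theorem symbol_res {V : X.Opens} (h : V ≤ U) (P : BasicOp F p U) :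
    (res h P).symbol = tangent.res h P.symbol := rfl

@[simp] theorem act_res {V W : X.Opens} (h : V ≤ U) (h' : W ≤ V) (P : BasicOp F p U)
    (s : Γ(F.sheaf, W)) : (res h P).act h' s = P.act (h'.trans h) s := rfl

theorem res_res {V W : X.Opens} (h : V ≤ U) (h' : W ≤ V) (P : BasicOp F p U) :
    res h' (res h P) = res (h'.trans h) P := rfl

theorem symbol_add (P Q : BasicOp F p U) : (P + Q).symbol = P.symbol + Q.symbol := rfl

theorem act_add (P Q : BasicOp F p U) {V : X.Opens} (h : V ≤ U) (s : Γ(F.sheaf, V)) :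
    (P + Q).act h s = P.act h s + Q.act h s := rfl

theorem symbol_lie (P Q : BasicOp F p U) : ⁅P, Q⁆.symbol = ⁅P.symbol, Q.symbol⁆ := rfl

theorem act_lie (P Q : BasicOp F p U) {V : X.Opens} (h : V ≤ U) (s : Γ(F.sheaf, V)) :
    ⁅P, Q⁆.act h s = P.act h (Q.act h s) - Q.act h (P.act h s) := rfl

theorem res_lie {V : X.Opens} (h : V ≤ U) (P Q : BasicOp F p U) :
    res h ⁅P, Q⁆ = ⁅res h P, res h Q⁆ := rfl

theorem symbol_smulBase {W : S.Opens} (e : U ≤ π ⁻¹ᵁ W) (b : Γ(S, W)) (P : BasicOp F p U) :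
    (smulBase e b P).symbol = pull π e b • P.symbol := rfl

theorem act_smulBase {W : S.Opens} (e : U ≤ π ⁻¹ᵁ W) (b : Γ(S, W)) (P : BasicOp F p U)
    {V : X.Opens} (h : V ≤ U) (s : Γ(F.sheaf, V)) :
    (smulBase e b P).act h s = pull π (h.trans e) b • P.act h s := rfl

theorem res_smulBase {W : S.Opens} (e : U ≤ π ⁻¹ᵁ W) (b : Γ(S, W)) (P : BasicOp F p U)
    {V : X.Opens} (h : V ≤ U) :
    res h (smulBase e b P) = smulBase (h.trans e) b (res h P) := by
  refine ext ?_ fun V' h' s => rfl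
  rw [symbol_res, symbol_smulBase, symbol_smulBase, tangent.res_smul, fres_pull, symbol_res]

theorem symbol_ad (s : Γ(F.sheaf, U)) :
    (ad F p U s).symbol = tangent.incl π p U (F.anchor U s) := rfl

theorem act_ad (s : Γ(F.sheaf, U)) {V : X.Opens} (h : V ≤ U) (t : Γ(F.sheaf, V)) :
    (ad F p U s).act h t = F.bracket V (mres F.sheaf h s) t := rfl

theorem eq_of_locally (P Q : BasicOp F p U)
    (H : ∀ x ∈ U, ∃ (V : X.Opens) (h : V ≤ U), x ∈ V ∧ res h P = res h Q) : P = Q := by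
  refine ext (tangent.eq_of_locally _ _ fun x hx => ?_) fun V hV s =>
    mres_eq_of_locally _ _ _ fun x hx => ?_
  · obtain ⟨V, h, hxV, e⟩ := H x hx
    exact ⟨V, h, hxV, congrArg symbol e⟩
  · obtain ⟨W, hW, hxW, e⟩ := H x (hV hx)
    refine ⟨V ⊓ W, inf_le_left, ⟨hx, hxW⟩, ?_⟩
    rw [mres_act, mres_act]
    exact congr($(e).act inf_le_right (mres F.sheaf inf_le_left s))

/-- An operator commutes with `{s, -}` up to `{P s, -}`. -/
theorem lie_ad (P : BasicOp F p U) (s : Γ(F.sheaf, U))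
    (hs : ⁅P.symbol, tangent.incl π p U (F.anchor U s)⁆ =
      tangent.incl π p U (F.anchor U (P.act le_rfl s))) :
    ⁅P, ad F p U s⁆ = ad F p U (P.act le_rfl s) := by
  refine ext hs fun V hV t => ?_
  rw [act_lie, act_ad, act_ad, act_ad, act_bracket, mres_act]
  abel

/-- If `𝒜_S ⟶ 𝒰` is injective, operators locally of the form `{s, -}` are so globally. -/
theorem exists_ad_eq (hinj : ∀ U : X.Opens, Function.Injective (ad F p U)) (P : BasicOp F p U)
    (H : ∀ x ∈ U, ∃ (V : X.Opens) (h : V ≤ U), x ∈ V ∧ ∃ s, res h P = ad F p V s) :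
    ∃ s, P = ad F p U s := by
  obtain ⟨s, hs⟩ := exists_mglue F.sheaf U
    (fun V s => ∃ h : V ≤ U, res h P = ad F p V s) (fun x hx => by
      obtain ⟨V, h, hxV, s, hs⟩ := H x hx
      exact ⟨V, h, hxV, s, h, hs⟩) (by
      rintro V hV s s' ⟨h, hs⟩ ⟨_, hs'⟩
      exact hinj V (hs.symm.trans hs')) (by
      rintro V V' h hV s ⟨h1, hs⟩
      exact ⟨h.trans h1, by rw [← res_ad, ← hs, res_res]⟩)
  refine ⟨s, eq_of_locally _ _ fun x hx => ?_⟩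
  obtain ⟨V, h, hxV, s', hs'⟩ := H x hx
  exact ⟨V, h, hxV, by rw [res_ad, hs V h s' ⟨h, hs'⟩, hs']⟩

end BasicOp

end LieAlgd

end

noncomputable section

namespace LieAlgd

/-! ### Sheafification of presheaves of abelian groups -/

section Sheafify

variable {X : TopCat.{0}} {P Q : TopCat.Presheaf Ab.{0} X}

theorem sheafify_isSheaf (P : TopCat.Presheaf Ab.{0} X) :
    TopCat.Presheaf.IsSheaf (sheafify (Opens.grothendieckTopology X) P) :=
  ((presheafToSheaf (Opens.grothendieckTopology X) Ab).obj P).property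

theorem exists_local_toSheafify {U : Opens X}
    (s : ToType ((sheafify (Opens.grothendieckTopology X) P).obj (op U))) :
    ∀ x ∈ U, ∃ (V : Opens X) (h : V ≤ U) (t : ToType (P.obj (op V))), x ∈ V ∧
      (sheafify (Opens.grothendieckTopology X) P).map (homOfLE h).op s =
        (toSheafify (Opens.grothendieckTopology X) P).app (op V) t := by
  intro x hx
  obtain ⟨V, i, ⟨t, ht⟩, hxV⟩ := Presheaf.imageSieve_mem (Opens.grothendieckTopology X)
    (toSheafify (Opens.grothendieckTopology X) P) s x hx
  exact ⟨V, i.le, t, hxV, ht.symm⟩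

theorem toSheafify_eq_iff {U : Opens X} (s t : ToType (P.obj (op U))) :
    (toSheafify (Opens.grothendieckTopology X) P).app (op U) s =
        (toSheafify (Opens.grothendieckTopology X) P).app (op U) t ↔
      ∀ x ∈ U, ∃ (V : Opens X) (h : V ≤ U), x ∈ V ∧
        P.map (homOfLE h).op s = P.map (homOfLE h).op t := by
  constructor
  · intro h x hx
    obtain ⟨V, i, e, hxV⟩ := Presheaf.equalizerSieve_mem (Opens.grothendieckTopology X)
      (toSheafify (Opens.grothendieckTopology X) P) s t h x hx
    exact ⟨V, i.le, hxV, e⟩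
  · intro H
    refine eq_of_locally_eq (sheafify_isSheaf P) _ _ fun x hx => ?_
    obtain ⟨V, h, hxV, e⟩ := H x hx
    refine ⟨V, h, hxV, ?_⟩
    rw [← NatTrans.naturality_apply, ← NatTrans.naturality_apply, e]

theorem isIso_sheafifyMap_iff (f : P ⟶ Q) :
    IsIso (sheafifyMap (Opens.grothendieckTopology X) f) ↔
      (∀ (U : Opens X) (s : ToType (P.obj (op U))), f.app (op U) s = 0 →
        ∀ x ∈ U, ∃ (V : Opens X) (h : V ≤ U), x ∈ V ∧ P.map (homOfLE h).op s = 0) ∧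
      (∀ (U : Opens X) (t : ToType (Q.obj (op U))), ∀ x ∈ U, ∃ (V : Opens X) (h : V ≤ U)
        (s : ToType (P.obj (op V))), x ∈ V ∧ f.app (op V) s = Q.map (homOfLE h).op t) := by
  have h1 : IsIso (sheafifyMap (Opens.grothendieckTopology X) f) ↔
      (Opens.grothendieckTopology X).W f := by
    rw [GrothendieckTopology.W_iff]
    exact isIso_iff_of_reflects_iso ((presheafToSheaf (Opens.grothendieckTopology X) Ab).map f)
      (sheafToPresheaf _ _)
  rw [h1, GrothendieckTopology.W_iff_isLocallyBijective]
  constructor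
  · rintro ⟨hi, hs⟩
    refine ⟨fun U s h x hx => ?_, fun U t x hx => ?_⟩
    · obtain ⟨V, i, e, hxV⟩ := Presheaf.equalizerSieve_mem (Opens.grothendieckTopology X)
        f s 0 (by rw [h, map_zero]) x hx
      exact ⟨V, i.le, hxV, e.trans (map_zero _)⟩
    · obtain ⟨V, i, ⟨s, hs⟩, hxV⟩ := Presheaf.imageSieve_mem (Opens.grothendieckTopology X)
        f t x hx
      exact ⟨V, i.le, s, hxV, hs⟩
  · rintro ⟨hi, hs⟩
    refine ⟨⟨fun {U} s t h x hx => ?_⟩, ⟨fun {U} t x hx => ?_⟩⟩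
    · obtain ⟨V, hV, hxV, e⟩ := hi U.unop (s - t) (by
        rw [map_sub]; exact sub_eq_zero.mpr h) x hx
      rw [map_sub, sub_eq_zero] at e
      exact ⟨V, homOfLE hV, e, hxV⟩
    · obtain ⟨V, hV, s, hxV, e⟩ := hs U t x hx
      exact ⟨V, homOfLE hV, ⟨s, e⟩, hxV⟩

end Sheafify

variable {X Y S : Scheme.{0}} {π : X ⟶ S} {F : Family π} {p : S ⟶ Y} {U : X.Opens}

/-! ### Sections of `𝔲(𝒜_S)` -/

theorem uSheaf_isSheaf (F : Family π) (p : S ⟶ Y) : (uSheaf F p).IsSheaf := sheafify_isSheaf _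

/-- Restriction of sections of `𝔲(𝒜_S)`. -/
def ures (F : Family π) (p : S ⟶ Y) {U V : X.Opens} (h : V ≤ U) :
    (uSheaf F p).obj (op U) →+ (uSheaf F p).obj (op V) :=
  ((uSheaf F p).map (homOfLE h).op).hom

theorem ures_ures {V W : X.Opens} (h : V ≤ U) (h' : W ≤ V) (u : (uSheaf F p).obj (op U)) :
    ures F p h' (ures F p h u) = ures F p (h'.trans h) u :=
  map_homOfLE_comp (F := uSheaf F p) h h' u

theorem ures_uClass {V : X.Opens} (h : V ≤ U) (P : BasicOp F p U) :
    ures F p h (uClass P) = uClass (BasicOp.res h P) := by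
  have := (NatTrans.naturality_apply
    (toSheafify (Opens.grothendieckTopology X) (uPresheaf F p)) (homOfLE h).op
    (QuotientAddGroup.mk P : BasicOp F p U ⧸ (BasicOp.ad F p U).range))
  exact this.symm

theorem uClass_add (P Q : BasicOp F p U) : uClass (P + Q) = uClass P + uClass Q :=
  map_add ((toSheafify (Opens.grothendieckTopology X) (uPresheaf F p)).app (op U)).hom
    (QuotientAddGroup.mk P : BasicOp F p U ⧸ (BasicOp.ad F p U).range) (QuotientAddGroup.mk Q)

theorem uSheaf_eq_of_locally (s t : (uSheaf F p).obj (op U))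
    (H : ∀ x ∈ U, ∃ (V : X.Opens) (h : V ≤ U), x ∈ V ∧ ures F p h s = ures F p h t) : s = t :=
  eq_of_locally_eq (uSheaf_isSheaf F p) s t H

theorem exists_uglue (U : X.Opens) (Q : ∀ V : X.Opens, (uSheaf F p).obj (op V) → Prop)
    (hex : ∀ x ∈ U, ∃ V : X.Opens, V ≤ U ∧ x ∈ V ∧ ∃ s, Q V s)
    (huniq : ∀ V, V ≤ U → ∀ s s', Q V s → Q V s' → s = s')
    (hres : ∀ V V' (h : V' ≤ V), V ≤ U → ∀ s, Q V s → Q V' (ures F p h s)) :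
    ∃ s : (uSheaf F p).obj (op U), ∀ V (h : V ≤ U) s', Q V s' → ures F p h s = s' :=
  exists_glue (uSheaf_isSheaf F p) U Q hex huniq hres

/-- Every section of `𝔲(𝒜_S)` is locally the class of an operator. -/
theorem exists_local_uClass (u : (uSheaf F p).obj (op U)) :
    ∀ x ∈ U, ∃ (V : X.Opens) (h : V ≤ U) (P : BasicOp F p V), x ∈ V ∧
      ures F p h u = uClass P := by
  intro x hx
  obtain ⟨V, h, t, hxV, e⟩ := exists_local_toSheafify u x hx
  obtain ⟨P, rfl⟩ := QuotientAddGroup.mk_surjective (s := (BasicOp.ad F p V).range) t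
  exact ⟨V, h, P, hxV, e⟩

theorem uClass_eq_iff (P Q : BasicOp F p U) : uClass P = uClass Q ↔
    ∀ x ∈ U, ∃ (V : X.Opens) (h : V ≤ U) (s : Γ(F.sheaf, V)), x ∈ V ∧
      BasicOp.res h P = BasicOp.res h Q + BasicOp.ad F p V s := by
  refine (toSheafify_eq_iff (P := uPresheaf F p)
    (QuotientAddGroup.mk P : BasicOp F p U ⧸ (BasicOp.ad F p U).range)
    (QuotientAddGroup.mk Q : BasicOp F p U ⧸ (BasicOp.ad F p U).range)).trans
    (forall₂_congr fun _ _ => exists_congr fun V => exists_congr fun h => ?_)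
  have key : (uPresheaf F p).map (homOfLE h).op
      (QuotientAddGroup.mk P : BasicOp F p U ⧸ (BasicOp.ad F p U).range) =
        (uPresheaf F p).map (homOfLE h).op
        (QuotientAddGroup.mk Q : BasicOp F p U ⧸ (BasicOp.ad F p U).range) ↔
      (QuotientAddGroup.mk (BasicOp.res h P) : BasicOp F p V ⧸ (BasicOp.ad F p V).range) =
        QuotientAddGroup.mk (BasicOp.res h Q) := Iff.rfl
  rw [key, QuotientAddGroup.eq_iff_sub_mem, AddMonoidHom.mem_range]
  constructor
  · rintro ⟨hxV, s, hs⟩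
    exact ⟨s, hxV, by rw [hs]; abel⟩
  · rintro ⟨s, hxV, hs⟩
    exact ⟨hxV, s, by rw [hs]; abel⟩

theorem uClass_ad (s : Γ(F.sheaf, U)) (P : BasicOp F p U) :
    uClass (P + BasicOp.ad F p U s) = uClass P :=
  (uClass_eq_iff _ _).mpr fun _ hx => ⟨U, le_rfl, s, hx, rfl⟩

/-- If `𝒜_S ⟶ 𝒰` is injective, two operators with the same class in `𝔲(𝒜_S)` differ by a global
inner operator. -/
theorem exists_eq_add_ad (hinj : ∀ U : X.Opens, Function.Injective (BasicOp.ad F p U))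
    {P Q : BasicOp F p U} (h : uClass P = uClass Q) : ∃ s, P = Q + BasicOp.ad F p U s := by
  obtain ⟨s, hs⟩ := BasicOp.exists_ad_eq hinj (P - Q) (fun x hx => by
    obtain ⟨V, hV, s, hxV, e⟩ := (uClass_eq_iff P Q).mp h x hx
    exact ⟨V, hV, hxV, s, by rw [map_sub, e]; abel⟩)
  exact ⟨s, by rw [← hs]; abel⟩

/-! ### Morphisms out of `π⁻¹ T_S` -/

/-- The morphism from the inverse image presheaf of `T_S` to the inverse image sheaf. -/
def toInvTangent (π : X ⟶ S) (p : S ⟶ Y) :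
    (TopCat.Presheaf.pullback Ab π.base).obj (tangent.presheaf p) ⟶ invTangent π p :=
  toSheafify (Opens.grothendieckTopology X) _

theorem toInvTangent_hom_ext {G : TopCat.Presheaf Ab X} (hG : G.IsSheaf)
    (φ ψ : invTangent π p ⟶ G) (h : toInvTangent π p ≫ φ = toInvTangent π p ≫ ψ) : φ = ψ :=
  sheafify_hom_ext (Opens.grothendieckTopology X) _ _ hG h

theorem exists_toInvTangent_comp {G : TopCat.Presheaf Ab X} (hG : G.IsSheaf)
    (η : (TopCat.Presheaf.pullback Ab π.base).obj (tangent.presheaf p) ⟶ G) :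
    ∃ φ : invTangent π p ⟶ G, toInvTangent π p ≫ φ = η :=
  ⟨sheafifyLift (Opens.grothendieckTopology X) η hG, toSheafify_sheafifyLift _ _ _⟩

/-- The morphism `T_S ⟶ π_* π⁻¹ T_S`. -/
def invUnit (π : X ⟶ S) (p : S ⟶ Y) :
    tangent.presheaf p ⟶ (TopCat.Presheaf.pushforward Ab π.base).obj (invTangent π p) :=
  (TopCat.Presheaf.pullbackPushforwardAdjunction Ab π.base).homEquiv _ _
    (toInvTangent π p)

theorem invSection_eq {W : S.Opens} (e : U ≤ π ⁻¹ᵁ W) (v : tangent p W) :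
    invSection π e v = (invTangent π p).map (homOfLE e).op ((invUnit π p).app (op W) v) := by
  rw [invUnit, Adjunction.homEquiv_unit]
  rfl

theorem invSection_add {W : S.Opens} (e : U ≤ π ⁻¹ᵁ W) (v w : tangent p W) :
    invSection π e (v + w) = invSection π e v + invSection π e w := by
  rw [invSection_eq, invSection_eq, invSection_eq, ← map_add]
  congr 1
  exact map_add ((invUnit π p).app (op W)).hom v w

theorem invTangent_map_invSection {V : X.Opens} {W : S.Opens} (e : U ≤ π ⁻¹ᵁ W) (h : V ≤ U)
    (v : tangent p W) :
    (invTangent π p).map (homOfLE h).op (invSection π e v) = invSection π (h.trans e) v := by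
  rw [invSection_eq, invSection_eq, map_homOfLE_comp]

theorem invSection_res {W W' : S.Opens} (h : W' ≤ W) (e : U ≤ π ⁻¹ᵁ W') (v : tangent p W) :
    invSection π e (tangent.res h v) =
      invSection π (e.trans ((Opens.map π.base).map (homOfLE h)).le) v := by
  rw [invSection_eq, invSection_eq]
  have : (invUnit π p).app (op W') (tangent.res h v) =
      (invTangent π p).map (homOfLE ((Opens.map π.base).map (homOfLE h)).le).op
        ((invUnit π p).app (op W) v) :=
    NatTrans.naturality_apply (invUnit π p) (homOfLE h).op v
  rw [this, map_homOfLE_comp]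

/-- A morphism from `π⁻¹ T_S` to a sheaf is determined by its values on the sections `π⁻¹ v`. -/
theorem invTangent_hom_ext {G : TopCat.Presheaf Ab X} (hG : G.IsSheaf)
    (φ ψ : invTangent π p ⟶ G)
    (H : ∀ (W : S.Opens) (v : tangent p W), φ.app (op (π ⁻¹ᵁ W)) (invSection π le_rfl v) =
      ψ.app (op (π ⁻¹ᵁ W)) (invSection π le_rfl v)) : φ = ψ := by
  refine toInvTangent_hom_ext hG _ _
    (((TopCat.Presheaf.pullbackPushforwardAdjunction Ab π.base).homEquiv _ _).injective ?_)
  rw [Adjunction.homEquiv_naturality_right, Adjunction.homEquiv_naturality_right]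
  ext W v
  have : φ.app (op (π ⁻¹ᵁ W)) ((invTangent π p).map (homOfLE le_rfl).op
      ((invUnit π p).app (op W) v)) = ψ.app (op (π ⁻¹ᵁ W)) ((invTangent π p).map
      (homOfLE le_rfl).op ((invUnit π p).app (op W) v)) := by
    have := H W v
    exact (invSection_eq (U := π ⁻¹ᵁ W) le_rfl (v : tangent p W)) ▸ this
  have e : (invTangent π p).map (homOfLE (le_refl (π ⁻¹ᵁ W))).op
      ((invUnit π p).app (op W) v) = (invUnit π p).app (op W) v :=
    congr($((invTangent π p).map_id _).hom _)
  rw [e] at this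
  exact this

/-- A morphism `π⁻¹ T_S ⟶ G` to a sheaf can be defined on the sections `π⁻¹ v`. -/
theorem exists_invTangent_hom {G : TopCat.Presheaf Ab X} (hG : G.IsSheaf)
    (ν : ∀ W : S.Opens, tangent p W →+ G.obj (op (π ⁻¹ᵁ W)))
    (hν : ∀ (W W' : S.Opens) (h : W' ≤ W) (v : tangent p W),
      ν W' (tangent.res h v) =
        G.map (homOfLE ((Opens.map π.base).map (homOfLE h)).le).op (ν W v)) :
    ∃ φ : invTangent π p ⟶ G, ∀ (W : S.Opens) (v : tangent p W) (U : X.Opens)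
      (e : U ≤ π ⁻¹ᵁ W), φ.app (op U) (invSection π e v) = G.map (homOfLE e).op (ν W v) := by
  let η : tangent.presheaf p ⟶ (TopCat.Presheaf.pushforward Ab π.base).obj G :=
    { app := fun W => AddCommGrpCat.ofHom (ν W.unop)
      naturality := fun W W' i => by
        ext v
        exact hν W.unop W'.unop i.unop.le v }
  let adj := TopCat.Presheaf.pullbackPushforwardAdjunction Ab π.base
  obtain ⟨φ, hφ⟩ := exists_toInvTangent_comp hG ((adj.homEquiv _ _).symm η)
  have h1 : invUnit π p ≫ (TopCat.Presheaf.pushforward Ab π.base).map φ = η := by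
    rw [invUnit, ← Adjunction.homEquiv_naturality_right, hφ]
    exact Equiv.apply_symm_apply _ _
  refine ⟨φ, fun W v U e => ?_⟩
  rw [invSection_eq, NatTrans.naturality_apply]
  congr 1
  exact congr($(h1).app (op W) v)

/-! ### Flat sections -/

namespace FlatSection

/-- Two flat sections agree if they agree locally on the sections `π⁻¹ v`. -/
theorem ext_of_locally {υ υ' : FlatSection F p}
    (H : ∀ (W : S.Opens) (v : tangent p W), ∀ x ∈ π ⁻¹ᵁ W, ∃ (V : X.Opens) (h : V ≤ π ⁻¹ᵁ W),
      x ∈ V ∧ υ.hom.app (op V) (invSection π h v) = υ'.hom.app (op V) (invSection π h v)) :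
    υ = υ' := by
  have : υ.hom = υ'.hom := by
    refine invTangent_hom_ext (uSheaf_isSheaf F p) _ _ fun W v => ?_
    refine uSheaf_eq_of_locally _ _ fun x hx => ?_
    obtain ⟨V, h, hxV, e⟩ := H W v x hx
    refine ⟨V, h, hxV, ?_⟩
    have k (χ : FlatSection F p) : ures F p h (χ.hom.app (op (π ⁻¹ᵁ W)) (invSection π le_rfl v)) =
        χ.hom.app (op V) (invSection π h v) := by
      rw [← invTangent_map_invSection le_rfl h, NatTrans.naturality_apply]
      rfl
    rw [k, k, e]
  cases υ; cases υ'; congr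

variable (υ : FlatSection F p)

/-- The value of a flat section on `π⁻¹ v`. -/
def val {W : S.Opens} (e : U ≤ π ⁻¹ᵁ W) (v : tangent p W) : (uSheaf F p).obj (op U) :=
  υ.hom.app (op U) (invSection π e v)

theorem ures_val {V : X.Opens} {W : S.Opens} (e : U ≤ π ⁻¹ᵁ W) (v : tangent p W) (h : V ≤ U) :
    ures F p h (υ.val e v) = υ.val (h.trans e) v := by
  rw [val, val, ← invTangent_map_invSection e h, NatTrans.naturality_apply]
  rfl

theorem val_res {W W' : S.Opens} (h : W' ≤ W) (e : U ≤ π ⁻¹ᵁ W') (v : tangent p W) :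
    υ.val e (tangent.res h v) = υ.val (e.trans ((Opens.map π.base).map (homOfLE h)).le) v := by
  rw [val, val, invSection_res]

theorem val_add {W : S.Opens} (e : U ≤ π ⁻¹ᵁ W) (v w : tangent p W) :
    υ.val e (v + w) = υ.val e v + υ.val e w := by
  rw [val, invSection_add]
  exact map_add (υ.hom.app (op U)).hom _ _

end FlatSection

/-! ### Transversality -/

namespace Unfolding

/-- The transversality condition in terms of sections. -/
theorem isTransversal_iff (A : Unfolding F p) : A.IsTransversal ↔
    (∀ (U : X.Opens) (D : tangent π U) (x : Γ(A.alg.sheaf, U)),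
      tangent.incl π p U D = A.alg.anchor U x → ∀ y ∈ U, ∃ (V : X.Opens) (h : V ≤ U)
        (s : Γ(F.sheaf, V)), y ∈ V ∧ tangent.res h D = F.anchor V s) ∧
    (∀ (U : X.Opens) (D : tangent (π ≫ p) U), ∀ y ∈ U, ∃ (V : X.Opens) (h : V ≤ U)
      (E : tangent π V) (x : Γ(A.alg.sheaf, V)), y ∈ V ∧
        tangent.res h D = tangent.incl π p V E + A.alg.anchor V x) := by
  have zero_iff : ∀ (U V : X.Opens) (h : V ≤ U) (D : tangent π U),
      F.normalPresheaf.map (homOfLE h).op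
        (QuotientAddGroup.mk D : tangent π U ⧸ (F.anchor U).toAddMonoidHom.range) =
        (0 : tangent π V ⧸ (F.anchor V).toAddMonoidHom.range) ↔
      ∃ s, F.anchor V s = tangent.res h D := fun U V h D =>
    (QuotientAddGroup.eq_zero_iff (N := (F.anchor V).toAddMonoidHom.range)
      (tangent.res h D)).trans AddMonoidHom.mem_range
  have app_zero_iff : ∀ (U : X.Opens) (D : tangent π U),
      A.normalMap.app (op U)
        (QuotientAddGroup.mk D : tangent π U ⧸ (F.anchor U).toAddMonoidHom.range) =
        (0 : tangent (π ≫ p) U ⧸ (A.alg.anchor U).toAddMonoidHom.range) ↔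
      ∃ x, A.alg.anchor U x = tangent.incl π p U D := fun U D =>
    (QuotientAddGroup.eq_zero_iff (N := (A.alg.anchor U).toAddMonoidHom.range)
      (tangent.incl π p U D)).trans AddMonoidHom.mem_range
  have eq_iff : ∀ (U V : X.Opens) (h : V ≤ U) (E : tangent π V) (D : tangent (π ≫ p) U),
      A.normalMap.app (op V)
        (QuotientAddGroup.mk E : tangent π V ⧸ (F.anchor V).toAddMonoidHom.range) =
      A.alg.normalPresheaf.map (homOfLE h).op
        (QuotientAddGroup.mk D : tangent (π ≫ p) U ⧸ (A.alg.anchor U).toAddMonoidHom.range) ↔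
      ∃ x, A.alg.anchor V x = -tangent.incl π p V E + tangent.res h D := fun U V h E D =>
    (QuotientAddGroup.eq (s := (A.alg.anchor V).toAddMonoidHom.range)
      (a := tangent.incl π p V E) (b := tangent.res h D)).trans AddMonoidHom.mem_range
  rw [IsTransversal, isIso_sheafifyMap_iff]
  refine and_congr ⟨fun H U D x hx y hy => ?_, fun H U D hD y hy => ?_⟩
    ⟨fun H U D y hy => ?_, fun H U D y hy => ?_⟩
  · obtain ⟨V, h, hyV, e⟩ := H U (QuotientAddGroup.mk D :
      tangent π U ⧸ (F.anchor U).toAddMonoidHom.range) ((app_zero_iff U D).mpr ⟨x, hx.symm⟩) y hy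
    obtain ⟨s, hs⟩ := (zero_iff U V h D).mp e
    exact ⟨V, h, s, hyV, hs.symm⟩
  · obtain ⟨D, rfl⟩ := QuotientAddGroup.mk_surjective
      (s := (F.anchor U).toAddMonoidHom.range) D
    obtain ⟨x, hx⟩ := (app_zero_iff U D).mp hD
    obtain ⟨V, h, s, hyV, hs⟩ := H U D x hx.symm y hy
    exact ⟨V, h, hyV, (zero_iff U V h D).mpr ⟨s, hs.symm⟩⟩
  · obtain ⟨V, h, E, hyV, e⟩ := H U (QuotientAddGroup.mk D :
      tangent (π ≫ p) U ⧸ (A.alg.anchor U).toAddMonoidHom.range) y hy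
    obtain ⟨E, rfl⟩ := QuotientAddGroup.mk_surjective
      (s := (F.anchor V).toAddMonoidHom.range) E
    obtain ⟨x, hx⟩ := (eq_iff U V h E D).mp e
    exact ⟨V, h, E, x, hyV, by rw [hx]; abel⟩
  · obtain ⟨D, rfl⟩ := QuotientAddGroup.mk_surjective
      (s := (A.alg.anchor U).toAddMonoidHom.range) D
    obtain ⟨V, h, E, x, hyV, e⟩ := H U D y hy
    exact ⟨V, h, (QuotientAddGroup.mk E : tangent π V ⧸ (F.anchor V).toAddMonoidHom.range), hyV,
      (eq_iff U V h E D).mpr ⟨x, by rw [e]; abel⟩⟩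

end Unfolding

end LieAlgd

end

noncomputable section

namespace LieAlgd

variable {X Y S : Scheme.{0}}

/-! ### Consequences of the axioms of a Lie algebroid -/

section Modules

variable {M N : X.Modules}

theorem app_mres (φ : M ⟶ N) {U V : X.Opens} (h : V ≤ U) (s : Γ(M, U)) :
    φ.app V (mres M h s) = mres N h (φ.app U s) :=
  NatTrans.naturality_apply φ.mapPresheaf (homOfLE h).op s

end Modules

theorem fres_injective [IsIntegral X] {U V : X.Opens} (h : V ≤ U) (hV : (V : Set X).Nonempty) :
    Function.Injective (fres h) := by
  have : Nonempty V := hV.to_subtype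
  exact map_injective_of_isIntegral X (homOfLE h)

namespace LieAlgebroid

variable {f : X ⟶ Y} (A : LieAlgebroid f) {U : X.Opens}

theorem bracket_smul_right (g : Γ(X, U)) (s t : Γ(A.sheaf, U)) :
    A.bracket U s (g • t) = g • A.bracket U s t + (A.anchor U s).der le_rfl g • t := by
  rw [A.skew, A.leibniz, A.skew t s, smul_neg]
  abel

theorem jacobi_left (s t r : Γ(A.sheaf, U)) :
    A.bracket U s (A.bracket U t r) =
      A.bracket U (A.bracket U s t) r + A.bracket U t (A.bracket U s r) := by
  have h := A.jacobi s t r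
  rw [A.skew r s, map_neg, A.skew r (A.bracket U s t)] at h
  rw [← sub_eq_zero, ← h]
  abel

/-- The anchor is a morphism of Lie algebras: by the Jacobi and Leibniz identities
`a({s, t}) - [a(s), a(t)]` kills `𝒜`, which is torsion-free, and vanishes where `s` does. -/
theorem anchor_bracket [IsIntegral X] (s t : Γ(A.sheaf, U)) :
    A.anchor U (A.bracket U s t) = ⁅A.anchor U s, A.anchor U t⁆ := by
  have key : ∀ (V : X.Opens) (s t r : Γ(A.sheaf, V)) (g : Γ(X, V)),
      ((A.anchor V (A.bracket V s t)).der le_rfl g -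
        ⁅A.anchor V s, A.anchor V t⁆.der le_rfl g) • r = 0 := by
    intro V s t r g
    have h := A.jacobi_left s t (g • r)
    have h' := A.jacobi_left s t r
    simp only [bracket_smul_right, map_add, h'] at h
    rw [tangent.lie_der, Derivation.commutator_apply, sub_smul, sub_smul]
    rw [smul_add] at h
    rw [← sub_eq_zero] at h
    rw [← neg_eq_zero, ← h]
    abel
  refine tangent.ext fun V hV g => ?_
  by_contra hne
  obtain ⟨x, hx⟩ : (V : Set X).Nonempty := by
    by_contra hV'
    exact hne (fres_eq_of_locally _ _ fun x hx => (hV' ⟨x, hx⟩).elim)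
  obtain ⟨W, hW, hxW, hWV⟩ := Opens.isBasis_iff_nbhd.mp X.isBasis_affineOpens hx
  have hW : IsAffineOpen W := hW
  have : Nonempty W := ⟨⟨x, hxW⟩⟩
  have := A.reflexive W hW
  have h0 := key W (mres A.sheaf (hWV.trans hV) s) (mres A.sheaf (hWV.trans hV) t)
    (mres A.sheaf (hWV.trans hV) s) (fres hWV g)
  rw [← A.bracket_res, A.anchor_res, A.anchor_res, A.anchor_res, ← tangent.res_lie,
    tangent.res_der, tangent.res_der, ← tangent.fres_der _ hV, ← tangent.fres_der _ hV,
    ← map_sub] at h0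
  rcases smul_eq_zero.mp h0 with h0 | h0
  · rw [map_eq_zero_iff _ (fres_injective hWV ⟨x, hxW⟩), sub_eq_zero] at h0
    exact hne h0
  · apply hne
    apply fres_injective hWV ⟨x, hxW⟩
    have e1 : tangent.res (hWV.trans hV) (A.anchor U (A.bracket U s t)) = 0 := by
      rw [← A.anchor_res, A.bracket_res, h0]; simp
    have e2 : tangent.res (hWV.trans hV) (A.anchor U s) = 0 := by
      rw [← A.anchor_res, h0]; simp
    have e3 : tangent.res (hWV.trans hV) ⁅A.anchor U s, A.anchor U t⁆ = 0 := by
      rw [tangent.res_lie, e2]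
      exact tangent.ext fun V h g => by simp
    rw [tangent.fres_der, tangent.fres_der]
    exact congr($(e1.trans e3.symm).der le_rfl _)

end LieAlgebroid

/-! ### The flat section of a transversal unfolding -/

/-- Vector fields of `S` lift locally to `π`-related vector fields of `X`. -/
def HasLifts (π : X ⟶ S) (p : S ⟶ Y) : Prop :=
  ∀ (W : S.Opens) (v : tangent p W), ∀ x ∈ π ⁻¹ᵁ W, ∃ (V : X.Opens) (_ : V ≤ π ⁻¹ᵁ W)
    (D : tangent (π ≫ p) V), x ∈ V ∧ Related π p D v

namespace Unfolding

variable {π : X ⟶ S} {F : Family π} {p : S ⟶ Y} {U : X.Opens} (A : Unfolding F p)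

theorem ι_mres {V : X.Opens} (h : V ≤ U) (s : Γ(F.sheaf, U)) :
    A.ι.app V (mres F.sheaf h s) = mres A.alg.sheaf h (A.ι.app U s) := app_mres A.ι h s

theorem ι_smul (g : Γ(X, U)) (s : Γ(F.sheaf, U)) : A.ι.app U (g • s) = g • A.ι.app U s :=
  Scheme.Modules.Hom.app_smul A.ι g s

variable {A}

/-- For a transversal unfolding, sections of `𝒜` with vertical anchor belong to `𝒜_S`. -/
theorem IsTransversal.exists_ι_eq (hA : A.IsTransversal) (x : Γ(A.alg.sheaf, U))
    (D : tangent π U) (h : tangent.incl π p U D = A.alg.anchor U x) :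
    ∃ s, A.ι.app U s = x := by
  refine A.preimage U x fun y hy => ?_
  obtain ⟨V, hV, s, hyV, e⟩ := ((isTransversal_iff A).mp hA).1 U D x h y hy
  exact ⟨V, hV, s, hyV, by rw [← h, tangent.incl_res, e]⟩

theorem Induces.res {x : Γ(A.alg.sheaf, U)} {P : BasicOp F p U} (h : A.Induces x P)
    {V : X.Opens} (hV : V ≤ U) : A.Induces (mres A.alg.sheaf hV x) (BasicOp.res hV P) := by
  refine ⟨by rw [BasicOp.symbol_res, h.1, A.alg.anchor_res], fun W hW s => ?_⟩
  rw [BasicOp.act_res, h.2, mres_mres]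

theorem Induces.eq {x : Γ(A.alg.sheaf, U)} {P Q : BasicOp F p U} (h : A.Induces x P)
    (h' : A.Induces x Q) : P = Q :=
  BasicOp.ext (h.1.trans h'.1.symm) fun V hV s =>
    A.ι_injective V ((h.2 V hV s).trans (h'.2 V hV s).symm)

theorem Induces.add {x y : Γ(A.alg.sheaf, U)} {P Q : BasicOp F p U} (h : A.Induces x P)
    (h' : A.Induces y Q) : A.Induces (x + y) (P + Q) := by
  refine ⟨by rw [BasicOp.symbol_add, h.1, h'.1, map_add], fun W hW s => ?_⟩
  rw [BasicOp.act_add, map_add, h.2, h'.2, map_add, map_add, AddMonoidHom.add_apply]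

theorem Induces.smulBase {x : Γ(A.alg.sheaf, U)} {P : BasicOp F p U} (h : A.Induces x P)
    {W : S.Opens} (e : U ≤ π ⁻¹ᵁ W) (b : Γ(S, W)) :
    A.Induces (pull π e b • x) (BasicOp.smulBase e b P) := by
  refine ⟨by rw [BasicOp.symbol_smulBase, h.1, map_smul], fun V hV s => ?_⟩
  -- pulled-back functions are killed by the vertical vector field `a_S(s)`
  rw [BasicOp.act_smulBase, ι_smul, h.2, mres_smul, fres_pull, A.alg.leibniz, A.anchor_ι,
    tangent.incl_der, tangent.der_pull, zero_smul, sub_zero]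

theorem induces_ι (s : Γ(F.sheaf, U)) : A.Induces (A.ι.app U s) (BasicOp.ad F p U s) := by
  refine ⟨(A.anchor_ι U s).symm, fun V hV t => ?_⟩
  rw [BasicOp.act_ad, ← A.bracket_ι, ι_mres]

theorem Induces.lie [IsIntegral X] {x y : Γ(A.alg.sheaf, U)} {P Q : BasicOp F p U}
    (h : A.Induces x P) (h' : A.Induces y Q) : A.Induces (A.alg.bracket U x y) ⁅P, Q⁆ := by
  refine ⟨by rw [BasicOp.symbol_lie, A.alg.anchor_bracket, h.1, h'.1], fun V hV s => ?_⟩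
  rw [BasicOp.act_lie, map_sub, h.2, h'.2, h'.2, h.2, A.alg.bracket_res, A.alg.jacobi_left]
  abel

/-- Sections of a transversal unfolding with basic anchor induce operators on the family. -/
theorem IsTransversal.exists_induces [IsIntegral X] (hA : A.IsTransversal)
    (x : Γ(A.alg.sheaf, U)) (hx : IsBasic π p (A.alg.anchor U x)) : ∃ P, A.Induces x P := by
  have key : ∀ (V : {V : X.Opens // V ≤ U}) (s : Γ(F.sheaf, V.1)), ∃ t : Γ(F.sheaf, V.1),
      A.ι.app V.1 t = A.alg.bracket V.1 (mres A.alg.sheaf V.2 x) (A.ι.app V.1 s) := by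
    intro V s
    obtain ⟨E, hE⟩ := (hx.res V.2).exists_lie_incl (F.anchor V.1 s)
    refine hA.exists_ι_eq _ E ?_
    rw [hE, A.alg.anchor_bracket, A.anchor_ι, A.alg.anchor_res]
  choose d hd using key
  have inj := fun V => A.ι_injective V
  refine ⟨⟨(A.alg.anchor U x, fun V =>
    { toFun := d V
      map_zero' := inj _ (by rw [hd, map_zero, map_zero])
      map_add' := fun s t => inj _ (by rw [hd, map_add, map_add, map_add, hd, hd]) }),
    fun V W h s => ?_, fun V g s => ?_, fun V s t => ?_, hx⟩, rfl, fun V hV s => hd ⟨V, hV⟩ s⟩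
  · change mres F.sheaf h (d V s) = d W (mres F.sheaf h s)
    apply inj
    rw [hd, ι_mres, hd, A.alg.bracket_res, mres_mres, ι_mres]
  · change d V (g • s) = g • d V s + (A.alg.anchor U x).der V.2 g • s
    apply inj
    rw [hd, map_add, ι_smul, ι_smul, ι_smul, hd, LieAlgebroid.bracket_smul_right, A.alg.anchor_res]
    rfl
  · change d V (F.bracket V.1 s t) = F.bracket V.1 (d V s) t + F.bracket V.1 s (d V t)
    apply inj
    rw [hd, map_add, ← A.bracket_ι, ← A.bracket_ι, ← A.bracket_ι, hd, hd,
      LieAlgebroid.jacobi_left]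

/-- Local lifts of vector fields of `S` to a transversal unfolding. -/
theorem IsTransversal.exists_related (hA : A.IsTransversal) (hl : HasLifts π p) {W : S.Opens}
    (v : tangent p W) : ∀ x ∈ π ⁻¹ᵁ W, ∃ (V : X.Opens) (_ : V ≤ π ⁻¹ᵁ W)
      (z : Γ(A.alg.sheaf, V)), x ∈ V ∧ Related π p (A.alg.anchor V z) v := by
  intro x hx
  obtain ⟨V, hV, D, hxV, hD⟩ := hl W v x hx
  obtain ⟨V', hV', E, z, hxV', e⟩ := ((isTransversal_iff A).mp hA).2 V D x hxV
  refine ⟨V', hV'.trans hV, z, hxV', ?_⟩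
  have : A.alg.anchor V' z = tangent.res hV' D - tangent.incl π p V' E := by rw [e]; abel
  rw [this, ← sub_zero v]
  exact (hD.res_left hV').sub (related_incl E)

theorem IsTransversal.uClass_eq (hA : A.IsTransversal) {W : S.Opens} (e : U ≤ π ⁻¹ᵁ W)
    {v : tangent p W} {x y : Γ(A.alg.sheaf, U)} {P Q : BasicOp F p U}
    (hx : Related π p (A.alg.anchor U x) v) (hy : Related π p (A.alg.anchor U y) v)
    (hP : A.Induces x P) (hQ : A.Induces y Q) : uClass P = uClass Q := by
  obtain ⟨E, hE⟩ := hx.exists_incl_sub hy e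
  obtain ⟨s, hs⟩ := hA.exists_ι_eq (x - y) E (by rw [hE, map_sub])
  have : P = Q + BasicOp.ad F p U s := by
    refine Induces.eq (x := x) hP ?_
    have := hQ.add (induces_ι (A := A) s)
    rwa [hs, add_sub_cancel] at this
  rw [this, uClass_ad]

/-- The defining property of the value at `v` of the flat section of `A`. -/
def IsValue (A : Unfolding F p) {W : S.Opens} (v : tangent p W) (V : X.Opens)
    (u : (uSheaf F p).obj (op V)) : Prop :=
  V ≤ π ⁻¹ᵁ W ∧ ∃ (x : Γ(A.alg.sheaf, V)) (P : BasicOp F p V),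
    Related π p (A.alg.anchor V x) v ∧ A.Induces x P ∧ u = uClass P

theorem IsValue.res {W W' : S.Opens} {v : tangent p W} {V V' : X.Opens}
    {u : (uSheaf F p).obj (op V)} (H : A.IsValue v V u) (h : V' ≤ V) (h' : W' ≤ W)
    (e : V' ≤ π ⁻¹ᵁ W') : A.IsValue (tangent.res h' v) V' (ures F p h u) := by
  obtain ⟨_, x, P, hx, hP, rfl⟩ := H
  refine ⟨e, _, _, ?_, hP.res h, ures_uClass h P⟩
  rw [A.alg.anchor_res]
  exact hx.res h h'

/-- The morphism `π⁻¹ T_S ⟶ 𝔲(𝒜_S)` of a transversal unfolding. -/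
theorem IsTransversal.exists_hom [IsIntegral X] (hA : A.IsTransversal) (hl : HasLifts π p) :
    ∃ φ : invTangent π p ⟶ uSheaf F p, ∀ (W : S.Opens) (v : tangent p W) (V : X.Opens)
      (e : V ≤ π ⁻¹ᵁ W) (x : Γ(A.alg.sheaf, V)) (P : BasicOp F p V),
      Related π p (A.alg.anchor V x) v → A.Induces x P →
        φ.app (op V) (invSection π e v) = uClass P := by
  have ex : ∀ (W : S.Opens) (v : tangent p W), ∀ x ∈ π ⁻¹ᵁ W, ∃ V : X.Opens,
      V ≤ π ⁻¹ᵁ W ∧ x ∈ V ∧ ∃ u, A.IsValue v V u := by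
    intro W v x hx
    obtain ⟨V, hV, z, hxV, hz⟩ := hA.exists_related hl v x hx
    obtain ⟨P, hP⟩ := hA.exists_induces z (hz.isBasic hV)
    exact ⟨V, hV, hxV, _, hV, z, P, hz, hP, rfl⟩
  have key : ∀ (W : S.Opens) (v : tangent p W), ∃ u : (uSheaf F p).obj (op (π ⁻¹ᵁ W)),
      ∀ V (h : V ≤ π ⁻¹ᵁ W) u', A.IsValue v V u' → ures F p h u = u' := by
    intro W v
    refine exists_uglue _ _ (ex W v) ?_ (fun V V' h hV u H => H.res h le_rfl (h.trans hV))
    rintro V hV _ _ ⟨-, x, P, hx, hP, rfl⟩ ⟨-, y, Q, hy, hQ, rfl⟩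
    exact hA.uClass_eq hV hx hy hP hQ
  choose ν hν using key
  have loc : ∀ (W : S.Opens) (v : tangent p W) (W' : S.Opens) (h : W' ≤ W)
      (a b : (uSheaf F p).obj (op (π ⁻¹ᵁ W'))),
      (∀ (V : X.Opens) (hV : V ≤ π ⁻¹ᵁ W') (u : (uSheaf F p).obj (op V)),
        A.IsValue (tangent.res h v) V u → ures F p hV a = ures F p hV b) → a = b := by
    intro W v W' h a b H
    refine uSheaf_eq_of_locally _ _ fun x hx => ?_
    obtain ⟨V, hV, hxV, u, hu⟩ := ex W' (tangent.res h v) x hx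
    exact ⟨V, hV, hxV, H V hV u hu⟩
  have hadd : ∀ (W : S.Opens) (v w : tangent p W), ν W (v + w) = ν W v + ν W w := by
    intro W v w
    refine uSheaf_eq_of_locally _ _ fun x hx => ?_
    obtain ⟨V, hV, hxV, u, hu⟩ := ex W v x hx
    obtain ⟨V', hV', hxV', u', hu'⟩ := ex W w x hx
    have h1 := hu.res (W' := W) (V' := V ⊓ V') inf_le_left le_rfl (inf_le_left.trans hV)
    have h2 := hu'.res (W' := W) (V' := V ⊓ V') inf_le_right le_rfl (inf_le_left.trans hV)
    refine ⟨V ⊓ V', inf_le_left.trans hV, ⟨hxV, hxV'⟩, ?_⟩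
    rw [map_add, hν W v _ _ _ h1, hν W w _ _ _ h2]
    obtain ⟨_, x, P, hx, hP, h1⟩ := h1
    obtain ⟨_, y, Q, hy, hQ, h2⟩ := h2
    refine hν W (v + w) _ _ _ ⟨inf_le_left.trans hV, x + y, P + Q, ?_, hP.add hQ, ?_⟩
    · rw [map_add]
      exact hx.add hy
    · rw [uClass_add, h1, h2]
  have hres : ∀ (W W' : S.Opens) (h : W' ≤ W) (v : tangent p W), ν W' (tangent.res h v) =
      ures F p ((Opens.map π.base).map (homOfLE h)).le (ν W v) := by
    intro W W' h v
    refine loc W v W' h _ _ fun V hV u hu => ?_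
    rw [hν W' _ V hV u hu, ures_ures]
    obtain ⟨_, x, P, hx, hP, rfl⟩ := hu
    have e : V ≤ π ⁻¹ᵁ W := hV.trans ((Opens.map π.base).map (homOfLE h)).le
    refine (hν W v V e _ ⟨e, x, P, fun V1 hV1 W1 hW1 e1 c => ?_, hP, rfl⟩).symm
    have e2 : V1 ≤ π ⁻¹ᵁ (W1 ⊓ W') := fun y hy => ⟨e1 hy, hV (hV1 hy)⟩
    have := hx V1 hV1 (W1 ⊓ W') inf_le_right e2 (fres inf_le_left c)
    rwa [pull_fres, tangent.res_der, ← tangent.fres_der _ hW1, pull_fres] at this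
  obtain ⟨φ, hφ⟩ := exists_invTangent_hom (π := π) (uSheaf_isSheaf F p)
    (fun W => AddMonoidHom.mk' (ν W) (hadd W)) (fun W W' h v => hres W W' h v)
  exact ⟨φ, fun W v V e x P hx hP => (hφ W v V e).trans (hν W v V e _ ⟨e, x, P, hx, hP, rfl⟩)⟩

/-- The flat section of a transversal unfolding. -/
theorem IsTransversal.exists_flatSection [IsIntegral X] (hA : A.IsTransversal)
    (hl : HasLifts π p) :
    ∃ υ : FlatSection F p, ∀ (W : S.Opens) (v : tangent p W) (V : X.Opens)
      (e : V ≤ π ⁻¹ᵁ W) (x : Γ(A.alg.sheaf, V)) (P : BasicOp F p V),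
      Related π p (A.alg.anchor V x) v → A.Induces x P → υ.val e v = uClass P := by
  obtain ⟨φ, hφ⟩ := hA.exists_hom hl
  -- locally, every operator representing `φ(v)` is induced by a section of `A` lifting `v`
  have loc : ∀ (W : S.Opens) (V : X.Opens) (e : V ≤ π ⁻¹ᵁ W) (v : tangent p W)
      (P : BasicOp F p V), φ.app (op V) (invSection π e v) = uClass P → ∀ x ∈ V,
        ∃ (V' : X.Opens) (h : V' ≤ V) (z : Γ(A.alg.sheaf, V')), x ∈ V' ∧
          Related π p (A.alg.anchor V' z) v ∧ A.Induces z (BasicOp.res h P) := by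
    intro W V e v P hP x hx
    obtain ⟨V1, hV1, z, hxV1, hz⟩ := hA.exists_related hl v x (e hx)
    obtain ⟨Q, hQ⟩ := hA.exists_induces z (hz.isBasic hV1)
    have h1 : uClass (BasicOp.res inf_le_left P : BasicOp F p (V ⊓ V1)) =
        uClass (BasicOp.res inf_le_right Q) := by
      rw [← ures_uClass, ← ures_uClass, ← hP, ← hφ W v V1 hV1 z Q hz hQ]
      have k : ∀ (V2 V3 : X.Opens) (e2 : V2 ≤ π ⁻¹ᵁ W) (h : V3 ≤ V2),
          ures F p h (φ.app (op V2) (invSection π e2 v)) =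
            φ.app (op V3) (invSection π (h.trans e2) v) := by
        intro V2 V3 e2 h
        rw [← invTangent_map_invSection e2 h, NatTrans.naturality_apply]
        rfl
      rw [k, k]
    obtain ⟨V2, hV2, s, hxV2, e2⟩ := (uClass_eq_iff _ _).mp h1 x ⟨hx, hxV1⟩
    refine ⟨V2, hV2.trans inf_le_left, mres _ (hV2.trans inf_le_right) z + A.ι.app V2 s, hxV2,
      ?_, ?_⟩
    · rw [map_add, A.alg.anchor_res, A.anchor_ι, ← add_zero v]
      exact (hz.res_left _).add (related_incl _)
    · rw [BasicOp.res_res, BasicOp.res_res] at e2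
      rw [e2]
      exact (hQ.res _).add (induces_ι s)
  have glob : ∀ (W : S.Opens) (V : X.Opens) (e : V ≤ π ⁻¹ᵁ W) (v : tangent p W)
      (P : BasicOp F p V), (∀ x ∈ V, ∃ (V' : X.Opens) (h : V' ≤ V) (z : Γ(A.alg.sheaf, V')),
        x ∈ V' ∧ Related π p (A.alg.anchor V' z) v ∧ A.Induces z (BasicOp.res h P)) →
      φ.app (op V) (invSection π e v) = uClass P := by
    intro W V e v P H
    refine uSheaf_eq_of_locally _ _ fun x hx => ?_
    obtain ⟨V', h, z, hxV', hz, hP⟩ := H x hx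
    refine ⟨V', h, hxV', ?_⟩
    rw [ures_uClass, ← hφ W v V' (h.trans e) z _ hz hP, ← invTangent_map_invSection e h,
      NatTrans.naturality_apply]
    rfl
  refine ⟨⟨φ, ?_, ?_, ?_⟩, fun W v V e x P hx hP => hφ W v V e x P hx hP⟩
  · intro W V e v P hP
    refine related_of_locally fun x hx => ?_
    obtain ⟨V', h, z, hxV', hz, hP'⟩ := loc W V e v P hP x hx
    exact ⟨V', h, hxV', by rwa [← BasicOp.symbol_res, hP'.1]⟩
  · intro W V e b v P hP
    refine glob W V e _ _ fun x hx => ?_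
    obtain ⟨V', h, z, hxV', hz, hP'⟩ := loc W V e v P hP x hx
    refine ⟨V', h, pull π (h.trans e) b • z, hxV', ?_, ?_⟩
    · intro V1 hV1 W1 hW1 e1 c
      rw [map_smul, tangent.smul_der, tangent.smul_der, Derivation.smul_apply,
        Derivation.smul_apply, hz V1 hV1 W1 hW1 e1 c, smul_eq_mul, smul_eq_mul, map_mul, fres_pull,
        pull_fres]
    · rw [BasicOp.res_smulBase]
      exact hP'.smulBase _ b
  · intro W V e v w P Q hP hQ
    refine glob W V e _ _ fun x hx => ?_
    obtain ⟨V1, h1, z, hxV1, hz, hP'⟩ := loc W V e v P hP x hx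
    obtain ⟨V2, h2, z', hxV2, hz', hQ'⟩ := loc W V e w Q hQ x hx
    refine ⟨V1 ⊓ V2, inf_le_left.trans h1, A.alg.bracket _ (mres _ inf_le_left z)
      (mres _ inf_le_right z'), ⟨hxV1, hxV2⟩, ?_, ?_⟩
    · rw [A.alg.anchor_bracket, A.alg.anchor_res, A.alg.anchor_res]
      exact (hz.res_left _).lie (hz'.res_left _)
    · exact (hP'.res inf_le_left).lie (hQ'.res inf_le_right)

end Unfolding

end LieAlgd

end

noncomputable section

namespace LieAlgd

variable {X Y S : Scheme.{0}} {π : X ⟶ S} {F : Family π} {p : S ⟶ Y} {U : X.Opens} {n : ℕ}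

/-! ### Coordinates on the base -/

/-- Coordinates on the base over an open `V` of `X`: functions `t_i` and vector fields `v_i` on an
open `W` of `S` with `V ≤ π⁻¹ W` and `v_i(t_j) = δ_ij`, such that vector fields on `X` and on `S` are
determined, modulo vertical ones, by their values on the functions `t_i`. -/
structure Frame (π : X ⟶ S) (p : S ⟶ Y) (n : ℕ) (V : X.Opens) where
  /-- the open subset of the base -/
  W : S.Opens
  le : V ≤ π ⁻¹ᵁ W
  /-- the coordinate functions -/
  t : Fin n → Γ(S, W)
  /-- the coordinate vector fields -/
  v : Fin n → tangent p W
  dual : ∀ i j, (v i).der le_rfl (t j) = if i = j then 1 else 0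
  vertical : ∀ (U : X.Opens) (h : U ≤ V) (D : tangent (π ≫ p) U),
    (∀ i, D.der le_rfl (pull π (h.trans le) (t i)) = 0) → ∃ E, tangent.incl π p U E = D
  eq_zero : ∀ (W' : S.Opens) (h : W' ≤ W) (w : tangent p W'),
    (∀ i, w.der le_rfl (fres h (t i)) = 0) → w = 0

/-- The points of `X` have neighbourhoods with `n` coordinates on the base. -/
def HasFrames (π : X ⟶ S) (p : S ⟶ Y) (n : ℕ) : Prop :=
  ∀ x : X, ∃ V : X.Opens, x ∈ V ∧ Nonempty (Frame π p n V)

namespace Frame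

variable {V : X.Opens}

/-- Restriction of coordinates. -/
def res (Fr : Frame π p n V) {V' : X.Opens} (h : V' ≤ V) : Frame π p n V' where
  W := Fr.W
  le := h.trans Fr.le
  t := Fr.t
  v := Fr.v
  dual := Fr.dual
  vertical U hU D hD := Fr.vertical U (hU.trans h) D hD
  eq_zero := Fr.eq_zero

/-- The coefficients of the image of a vector field in `π^* T_S`. -/
def coef (Fr : Frame π p n V) (h : U ≤ V) (D : tangent (π ≫ p) U) (i : Fin n) : Γ(X, U) :=
  D.der le_rfl (pull π (h.trans Fr.le) (Fr.t i))

variable (Fr : Frame π p n V)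

theorem coef_add (h : U ≤ V) (D E : tangent (π ≫ p) U) (i : Fin n) :
    Fr.coef h (D + E) i = Fr.coef h D i + Fr.coef h E i := rfl

theorem coef_zero (h : U ≤ V) (i : Fin n) : Fr.coef h (0 : tangent (π ≫ p) U) i = 0 := rfl

theorem coef_sub (h : U ≤ V) (D E : tangent (π ≫ p) U) (i : Fin n) :
    Fr.coef h (D - E) i = Fr.coef h D i - Fr.coef h E i := rfl

theorem coef_smul (h : U ≤ V) (g : Γ(X, U)) (D : tangent (π ≫ p) U) (i : Fin n) :
    Fr.coef h (g • D) i = g * Fr.coef h D i := by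
  simp [coef, fres_self]

theorem coef_incl (h : U ≤ V) (E : tangent π U) (i : Fin n) :
    Fr.coef h (tangent.incl π p U E) i = 0 := E.der_pull _ _ _

theorem fres_coef (h : U ≤ V) (D : tangent (π ≫ p) U) (i : Fin n) {U' : X.Opens} (h' : U' ≤ U) :
    fres h' (Fr.coef h D i) = Fr.coef (h'.trans h) (tangent.res h' D) i := by
  rw [coef, tangent.fres_der, fres_pull]
  rfl

theorem coef_related (h : U ≤ V) {D : tangent (π ≫ p) U} {i : Fin n}
    (hD : Related π p D (Fr.v i)) (j : Fin n) : Fr.coef h D j = if i = j then 1 else 0 := by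
  rw [coef, hD U le_rfl Fr.W le_rfl (h.trans Fr.le), Fr.dual]
  split_ifs <;> simp

/-- The coefficients of a basic vector field are killed by vertical vector fields. -/
theorem der_coef (h : U ≤ V) {D : tangent (π ≫ p) U} (hD : IsBasic π p D) (E : tangent π U)
    (i : Fin n) : E.der le_rfl (Fr.coef h D i) = 0 := hD.der_der_pull E _ _ _

theorem coef_sum_smul (h : U ≤ V) {D : Fin n → tangent (π ≫ p) U}
    (hD : ∀ i, Related π p (D i) (Fr.v i)) (f : Fin n → Γ(X, U)) (j : Fin n) :
    Fr.coef h (∑ i, f i • D i) j = f j := by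
  rw [coef, tangent.sum_der]
  have : ∀ i, (f i • D i).der le_rfl (pull π (h.trans Fr.le) (Fr.t j)) =
      f i * if i = j then 1 else 0 := fun i => by
    rw [← Fr.coef_related h (hD i) j]
    exact Fr.coef_smul h (f i) (D i) j
  rw [Finset.sum_congr rfl fun i _ => this i]
  simp

/-- A vector field agrees up to a vertical one with the combination of lifts of the coordinate
vector fields given by its coefficients. -/
theorem exists_incl_eq_sub (h : U ≤ V) {D : Fin n → tangent (π ≫ p) U}
    (hD : ∀ i, Related π p (D i) (Fr.v i)) (E : tangent (π ≫ p) U) :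
    ∃ E' : tangent π U, tangent.incl π p U E' = E - ∑ i, Fr.coef h E i • D i := by
  refine Fr.vertical U h _ fun j => ?_
  change Fr.coef h (E - ∑ i, Fr.coef h E i • D i) j = 0
  rw [coef_sub, Fr.coef_sum_smul h hD, sub_self]

/-- Expansion of a vector field of `S` in the coordinate vector fields. -/
theorem eq_sum_smul {W' : S.Opens} (h : W' ≤ Fr.W) (w : tangent p W') :
    w = ∑ i, w.der le_rfl (fres h (Fr.t i)) • tangent.res h (Fr.v i) := by
  rw [← sub_eq_zero]
  refine Fr.eq_zero W' h _ fun j => ?_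
  rw [tangent.sub_der, Derivation.sub_apply, tangent.sum_der, sub_eq_zero]
  have : ∀ i, ((w.der le_rfl (fres h (Fr.t i)) • tangent.res h (Fr.v i)).der le_rfl)
      (fres h (Fr.t j)) = w.der le_rfl (fres h (Fr.t i)) * if i = j then 1 else 0 := fun i => by
    rw [tangent.smul_der, Derivation.smul_apply, fres_self, tangent.res_der,
      ← tangent.fres_der _ le_rfl, Fr.dual]
    split_ifs <;> simp
  rw [Finset.sum_congr rfl fun i _ => this i]
  simp

end Frame

theorem exists_common_nhd {x : X} (Q : Fin n → X.Opens → Prop)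
    (hQ : ∀ i V V', V' ≤ V → Q i V → Q i V') (H : ∀ i, ∃ V : X.Opens, x ∈ V ∧ Q i V) :
    ∃ V : X.Opens, x ∈ V ∧ ∀ i, Q i V := by
  choose V hx h using H
  refine ⟨⟨⋂ i, (V i : Set X), isOpen_iInter_of_finite fun i => (V i).2⟩,
    Set.mem_iInter.mpr hx, fun i => hQ i (V i) _ (Set.iInter_subset _ i) (h i)⟩

/-! ### Coordinates of operators -/

/-- The operator `P` is `{s, -} + ∑ c_i P_i`. -/
def IsCoord (F : Family π) (p : S ⟶ Y) {U : X.Opens} (P : BasicOp F p U)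
    (Q : Fin n → BasicOp F p U) (c : Fin n → Γ(X, U)) (s : Γ(F.sheaf, U)) : Prop :=
  P.symbol = tangent.incl π p U (F.anchor U s) + ∑ i, c i • (Q i).symbol ∧
  ∀ (V : X.Opens) (h : V ≤ U) (r : Γ(F.sheaf, V)),
    P.act h r = F.bracket V (mres F.sheaf h s) r + ∑ i, fres h (c i) • (Q i).act h r

theorem IsCoord.unique (hinj : ∀ U : X.Opens, Function.Injective (BasicOp.ad F p U))
    {P : BasicOp F p U} {Q : Fin n → BasicOp F p U} {c : Fin n → Γ(X, U)} {s s' : Γ(F.sheaf, U)}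
    (h : IsCoord F p P Q c s) (h' : IsCoord F p P Q c s') : s = s' := by
  refine hinj U (BasicOp.ext ?_ fun V hV r => ?_)
  · exact add_right_cancel (h.1.symm.trans h'.1)
  · exact add_right_cancel ((h.2 V hV r).symm.trans (h'.2 V hV r))

namespace Unfolding

variable {A B : Unfolding F p} {V : X.Opens}

theorem mres_sum {M : X.Modules} (h : V ≤ U) (f : Fin n → Γ(X, U)) (x : Fin n → Γ(M, U)) :
    mres M h (∑ i, f i • x i) = ∑ i, fres h (f i) • mres M h (x i) := by
  rw [map_sum]
  exact Finset.sum_congr rfl fun i _ => mres_smul M h _ _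

/-- Decomposition of sections of a transversal unfolding in coordinates. -/
theorem IsTransversal.exists_eq_ι_add (hA : A.IsTransversal) (Fr : Frame π p n V)
    (h : U ≤ V) {x : Fin n → Γ(A.alg.sheaf, U)}
    (hx : ∀ i, Related π p (A.alg.anchor U (x i)) (Fr.v i)) (z : Γ(A.alg.sheaf, U)) :
    ∃ s, z = A.ι.app U s + ∑ i, Fr.coef h (A.alg.anchor U z) i • x i := by
  obtain ⟨E, hE⟩ := Fr.exists_incl_eq_sub h hx (A.alg.anchor U z)
  obtain ⟨s, hs⟩ := hA.exists_ι_eq (z - ∑ i, Fr.coef h (A.alg.anchor U z) i • x i) E (by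
    rw [hE, map_sub, map_sum]
    simp only [map_smul])
  exact ⟨s, by rw [hs]; abel⟩

/-- If sections `z`, `x_i` of `𝒜` induce operators `P`, `P_i` and `z = s + ∑ c_i x_i` with
coefficients `c_i` killed by vertical vector fields, then `P = {s, -} + ∑ c_i P_i`. -/
theorem isCoord_of_induces {z : Γ(A.alg.sheaf, U)} {P : BasicOp F p U} (hz : A.Induces z P)
    {x : Fin n → Γ(A.alg.sheaf, U)} {Q : Fin n → BasicOp F p U}
    (hx : ∀ i, A.Induces (x i) (Q i)) {c : Fin n → Γ(X, U)}
    (hc : ∀ (V : X.Opens) (h : V ≤ U) (E : tangent π V) (i), E.der le_rfl (fres h (c i)) = 0)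
    {s : Γ(F.sheaf, U)} (e : z = A.ι.app U s + ∑ i, c i • x i) : IsCoord F p P Q c s := by
  constructor
  · rw [hz.1, e, map_add, map_sum, A.anchor_ι]
    simp only [map_smul, (hx _).1]
  · intro V hV r
    apply A.ι_injective V
    rw [hz.2, e, map_add, map_add, AddMonoidHom.add_apply, mres_sum, map_sum,
      AddMonoidHom.finsetSum_apply, map_add, map_sum, ← ι_mres, A.bracket_ι]
    congr 1
    refine Finset.sum_congr rfl fun i _ => ?_
    rw [A.alg.leibniz, A.anchor_ι, tangent.incl_der, hc, zero_smul, sub_zero, ι_smul, (hx i).2]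

/-! ### Unfoldings with the same flat section -/

/-- Pairs of sections of two unfoldings inducing the same operator on the family. -/
def pairs (A B : Unfolding F p) (U : X.Opens) : Set (Γ(A.alg.sheaf, U) × Γ(B.alg.sheaf, U)) :=
  {z | ∃ P : BasicOp F p U, A.Induces z.1 P ∧ B.Induces z.2 P}

/-- The `𝒪_X`-linear span of the pairs of sections inducing the same operator. -/
def pairSpan (A B : Unfolding F p) (U : X.Opens) :
    Submodule Γ(X, U) (Γ(A.alg.sheaf, U) × Γ(B.alg.sheaf, U)) :=
  Submodule.span _ (pairs A B U)

theorem pairSpan_res (h : V ≤ U) {z : Γ(A.alg.sheaf, U) × Γ(B.alg.sheaf, U)}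
    (hz : z ∈ pairSpan A B U) :
    (mres A.alg.sheaf h z.1, mres B.alg.sheaf h z.2) ∈ pairSpan A B V := by
  induction hz using Submodule.span_induction with
  | mem z hz =>
    obtain ⟨P, h1, h2⟩ := hz
    exact Submodule.subset_span ⟨_, h1.res h, h2.res h⟩
  | zero => simp only [Prod.fst_zero, Prod.snd_zero, map_zero]; exact Submodule.zero_mem _
  | add x y _ _ hx hy => simpa using Submodule.add_mem _ hx hy
  | smul g x _ hx => simpa [mres_smul] using Submodule.smul_mem _ (fres h g) hx

theorem pairSpan_swap {z : Γ(A.alg.sheaf, U) × Γ(B.alg.sheaf, U)} (hz : z ∈ pairSpan A B U) :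
    z.swap ∈ pairSpan B A U := by
  induction hz using Submodule.span_induction with
  | mem z hz =>
    obtain ⟨P, h1, h2⟩ := hz
    exact Submodule.subset_span ⟨P, h2, h1⟩
  | zero => exact Submodule.zero_mem _
  | add x y _ _ hx hy => exact Submodule.add_mem _ hx hy
  | smul g x _ hx => exact Submodule.smul_mem _ g hx

theorem anchor_eq_of_mem_pairSpan {z : Γ(A.alg.sheaf, U) × Γ(B.alg.sheaf, U)}
    (hz : z ∈ pairSpan A B U) : B.alg.anchor U z.2 = A.alg.anchor U z.1 := by
  induction hz using Submodule.span_induction with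
  | mem z hz =>
    obtain ⟨P, h1, h2⟩ := hz
    rw [← h1.1, ← h2.1]
  | zero => simp
  | add x y _ _ hx hy => simp [hx, hy]
  | smul g x _ hx => simp [hx]

/-- The span of the pairs inducing the same operator is closed under brackets. -/
theorem bracket_mem_pairSpan [IsIntegral X] {z w : Γ(A.alg.sheaf, U) × Γ(B.alg.sheaf, U)}
    (hz : z ∈ pairSpan A B U) (hw : w ∈ pairSpan A B U) :
    (A.alg.bracket U z.1 w.1, B.alg.bracket U z.2 w.2) ∈ pairSpan A B U := by
  induction hw using Submodule.span_induction with
  | mem w hw =>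
    obtain ⟨Q, k1, k2⟩ := hw
    induction hz using Submodule.span_induction with
    | mem z hz =>
      obtain ⟨P, h1, h2⟩ := hz
      exact Submodule.subset_span ⟨_, h1.lie k1, h2.lie k2⟩
    | zero => simp only [Prod.fst_zero, Prod.snd_zero, map_zero]; exact Submodule.zero_mem _
    | add x y _ _ hx hy => simpa using Submodule.add_mem _ hx hy
    | smul g x hx' hx =>
      have e : B.alg.anchor U w.2 = A.alg.anchor U w.1 := by rw [← k1.1, ← k2.1]
      have := Submodule.sub_mem _ (Submodule.smul_mem _ g hx)
        (Submodule.smul_mem _ ((A.alg.anchor U w.1).der le_rfl g) hx')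
      convert this using 1
      ext <;> simp [LieAlgebroid.leibniz, e]
  | zero => simp only [Prod.fst_zero, Prod.snd_zero, map_zero]; exact Submodule.zero_mem _
  | add x y _ _ hx hy => simpa using Submodule.add_mem _ hx hy
  | smul g x hx' hx =>
    have := Submodule.add_mem _ (Submodule.smul_mem _ g hx)
      (Submodule.smul_mem _ ((A.alg.anchor U z.1).der le_rfl g) hx')
    convert this using 1
    ext <;> simp [LieAlgebroid.bracket_smul_right, anchor_eq_of_mem_pairSpan hz]

theorem ι_mem_pairSpan (s : Γ(F.sheaf, U)) : (A.ι.app U s, B.ι.app U s) ∈ pairSpan A B U :=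
  Submodule.subset_span ⟨_, induces_ι s, induces_ι s⟩

/-- In coordinates, the two components of an element of the span have the same decomposition. -/
theorem exists_eq_of_mem_pairSpan (hinj : ∀ U : X.Opens, Function.Injective (BasicOp.ad F p U))
    (hA : A.IsTransversal) (hB : B.IsTransversal) (Fr : Frame π p n V) (h : U ≤ V)
    {x : Fin n → Γ(A.alg.sheaf, U)} {y : Fin n → Γ(B.alg.sheaf, U)} {Q : Fin n → BasicOp F p U}
    (hx : ∀ i, A.Induces (x i) (Q i)) (hy : ∀ i, B.Induces (y i) (Q i))
    (hQ : ∀ i, Related π p (Q i).symbol (Fr.v i))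
    {z : Γ(A.alg.sheaf, U) × Γ(B.alg.sheaf, U)} (hz : z ∈ pairSpan A B U) :
    ∃ s, z.1 = A.ι.app U s + ∑ i, Fr.coef h (A.alg.anchor U z.1) i • x i ∧
      z.2 = B.ι.app U s + ∑ i, Fr.coef h (A.alg.anchor U z.1) i • y i := by
  induction hz using Submodule.span_induction with
  | mem z hz =>
    obtain ⟨P, h1, h2⟩ := hz
    obtain ⟨s, hs⟩ := hA.exists_eq_ι_add Fr h (fun i => (hx i).1 ▸ hQ i) z.1
    obtain ⟨s', hs'⟩ := hB.exists_eq_ι_add Fr h (fun i => (hy i).1 ▸ hQ i) z.2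
    rw [← h2.1, h1.1] at hs'
    have hc : ∀ (V : X.Opens) (hV : V ≤ U) (E : tangent π V) (i),
        E.der le_rfl (fres hV (Fr.coef h (A.alg.anchor U z.1) i)) = 0 := by
      intro V hV E i
      rw [Fr.fres_coef]
      exact Fr.der_coef _ ((h1.1 ▸ P.symbol_basic).res hV) E i
    obtain rfl : s = s' := (isCoord_of_induces h1 hx hc hs).unique hinj
      (isCoord_of_induces h2 hy hc hs')
    exact ⟨s, hs, hs'⟩
  | zero => exact ⟨0, by simp [Fr.coef_zero], by simp [Fr.coef_zero]⟩
  | add z w _ _ hz hw =>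
    obtain ⟨s, h1, h2⟩ := hz
    obtain ⟨r, k1, k2⟩ := hw
    refine ⟨s + r, ?_, ?_⟩
    · simp only [Prod.fst_add, map_add, Fr.coef_add, add_smul, Finset.sum_add_distrib]
      nth_rewrite 1 [h1, k1]
      abel
    · simp only [Prod.fst_add, Prod.snd_add, map_add, Fr.coef_add, add_smul,
        Finset.sum_add_distrib]
      nth_rewrite 1 [h2, k2]
      abel
  | smul g z _ hz =>
    obtain ⟨s, h1, h2⟩ := hz
    refine ⟨g • s, ?_, ?_⟩
    · simp only [Prod.smul_fst, map_smul, Fr.coef_smul, ι_smul, mul_smul, ← Finset.smul_sum,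
        ← smul_add]
      exact congrArg (g • ·) h1
    · simp only [Prod.smul_fst, Prod.smul_snd, map_smul, Fr.coef_smul, ι_smul, mul_smul,
        ← Finset.smul_sum, ← smul_add]
      exact congrArg (g • ·) h2

/-- Two unfoldings locally lift vector fields of `S` to sections inducing the same operators. -/
def HaveCommonLifts (A B : Unfolding F p) : Prop :=
  ∀ (W : S.Opens) (v : tangent p W), ∀ x ∈ π ⁻¹ᵁ W, ∃ (V : X.Opens) (_ : V ≤ π ⁻¹ᵁ W)
    (a : Γ(A.alg.sheaf, V)) (b : Γ(B.alg.sheaf, V)) (P : BasicOp F p V), x ∈ V ∧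
      A.Induces a P ∧ B.Induces b P ∧ Related π p P.symbol v

theorem HaveCommonLifts.symm (H : HaveCommonLifts A B) : HaveCommonLifts B A := by
  intro W v x hx
  obtain ⟨V, hV, a, b, P, hxV, ha, hb, hP⟩ := H W v x hx
  exact ⟨V, hV, b, a, P, hxV, hb, ha, hP⟩

/-- Transversal unfoldings with the same flat section have common lifts. -/
theorem IsTransversal.haveCommonLifts [IsIntegral X] (hA : A.IsTransversal)
    (hB : B.IsTransversal) (hl : HasLifts π p) (υ : FlatSection F p)
    (hυA : ∀ (W : S.Opens) (v : tangent p W) (V : X.Opens)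
      (e : V ≤ π ⁻¹ᵁ W) (x : Γ(A.alg.sheaf, V)) (P : BasicOp F p V),
      Related π p (A.alg.anchor V x) v → A.Induces x P → υ.val e v = uClass P)
    (hυB : ∀ (W : S.Opens) (v : tangent p W) (V : X.Opens)
      (e : V ≤ π ⁻¹ᵁ W) (x : Γ(B.alg.sheaf, V)) (P : BasicOp F p V),
      Related π p (B.alg.anchor V x) v → B.Induces x P → υ.val e v = uClass P) :
    HaveCommonLifts A B := by
  intro W v x hx
  obtain ⟨V1, hV1, a, hxV1, ha⟩ := hA.exists_related hl v x hx
  obtain ⟨V2, hV2, b, hxV2, hb⟩ := hB.exists_related hl v x hx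
  obtain ⟨P, hP⟩ := hA.exists_induces a (ha.isBasic hV1)
  obtain ⟨Q, hQ⟩ := hB.exists_induces b (hb.isBasic hV2)
  have e : uClass (BasicOp.res inf_le_left P : BasicOp F p (V1 ⊓ V2)) =
      uClass (BasicOp.res inf_le_right Q) := by
    rw [← ures_uClass, ← ures_uClass, ← hυA W v V1 hV1 a P ha hP, ← hυB W v V2 hV2 b Q hb hQ,
      υ.ures_val, υ.ures_val]
  obtain ⟨V, hV, s, hxV, hs⟩ := (uClass_eq_iff _ _).mp e x ⟨hxV1, hxV2⟩
  rw [BasicOp.res_res, BasicOp.res_res] at hs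
  refine ⟨V, (hV.trans inf_le_left).trans hV1, mres _ (hV.trans inf_le_left) a,
    mres _ (hV.trans inf_le_right) b + B.ι.app V s, BasicOp.res (hV.trans inf_le_left) P, hxV,
    hP.res _, ?_, ?_⟩
  · rw [hs]
    exact (hQ.res _).add (induces_ι s)
  · rw [BasicOp.symbol_res, hP.1]
    exact ha.res_left _

/-- Around every point there are coordinates together with common lifts of the coordinate vector
fields. -/
theorem HaveCommonLifts.exists_frame (H : HaveCommonLifts A B) (hF : HasFrames π p n) (x : X) :
    ∃ V : X.Opens, x ∈ V ∧ ∃ (Fr : Frame π p n V) (a : Fin n → Γ(A.alg.sheaf, V))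
      (b : Fin n → Γ(B.alg.sheaf, V)) (Q : Fin n → BasicOp F p V),
      (∀ i, A.Induces (a i) (Q i)) ∧ (∀ i, B.Induces (b i) (Q i)) ∧
        ∀ i, Related π p (Q i).symbol (Fr.v i) := by
  obtain ⟨V, hxV, ⟨Fr⟩⟩ := hF x
  obtain ⟨V', hxV', h⟩ := exists_common_nhd (x := x) (fun (i : Fin n) V' =>
    ∃ (a : Γ(A.alg.sheaf, V')) (b : Γ(B.alg.sheaf, V')) (P : BasicOp F p V'),
      A.Induces a P ∧ B.Induces b P ∧ Related π p P.symbol (Fr.v i)) (by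
    rintro i V1 V2 h ⟨a, b, P, ha, hb, hP⟩
    exact ⟨_, _, _, ha.res h, hb.res h, hP.res_left h⟩) (fun i => by
    obtain ⟨V1, hV1, a, b, P, hxV1, h1, h2, h3⟩ := H Fr.W (Fr.v i) x (Fr.le hxV)
    exact ⟨V1, hxV1, a, b, P, h1, h2, h3⟩)
  choose a b Q h1 h2 h3 using h
  exact ⟨V ⊓ V', ⟨hxV, hxV'⟩, Fr.res inf_le_left, _, _, _, fun i => (h1 i).res inf_le_right,
    fun i => (h2 i).res inf_le_right, fun i => (h3 i).res_left inf_le_right⟩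

/-- Sections of `A` and `B` which correspond to each other: locally, the pair lies in the span of
the pairs inducing the same operator. -/
def Corresp (A B : Unfolding F p) (U : X.Opens) (a : Γ(A.alg.sheaf, U)) (b : Γ(B.alg.sheaf, U)) :
    Prop :=
  ∀ x ∈ U, ∃ (V : X.Opens) (h : V ≤ U), x ∈ V ∧
    (mres A.alg.sheaf h a, mres B.alg.sheaf h b) ∈ pairSpan A B V

theorem Corresp.of_mem {a : Γ(A.alg.sheaf, U)} {b : Γ(B.alg.sheaf, U)}
    (h : (a, b) ∈ pairSpan A B U) : Corresp A B U a b :=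
  fun _ hx => ⟨U, le_rfl, hx, pairSpan_res le_rfl h⟩

theorem Corresp.res {a : Γ(A.alg.sheaf, U)} {b : Γ(B.alg.sheaf, U)} (H : Corresp A B U a b)
    (h : V ≤ U) : Corresp A B V (mres _ h a) (mres _ h b) := by
  intro x hx
  obtain ⟨V', hV', hxV', e⟩ := H x (h hx)
  refine ⟨V ⊓ V', inf_le_left, ⟨hx, hxV'⟩, ?_⟩
  have := pairSpan_res (V := V ⊓ V') inf_le_right e
  simp only [mres_mres] at this ⊢
  exact this

theorem Corresp.of_locally {a : Γ(A.alg.sheaf, U)} {b : Γ(B.alg.sheaf, U)}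
    (H : ∀ x ∈ U, ∃ (V : X.Opens) (h : V ≤ U), x ∈ V ∧ Corresp A B V (mres _ h a) (mres _ h b)) :
    Corresp A B U a b := by
  intro x hx
  obtain ⟨V, h, hxV, k⟩ := H x hx
  obtain ⟨V', h', hxV', e⟩ := k x hxV
  exact ⟨V', h'.trans h, hxV', by simpa only [mres_mres] using e⟩

theorem Corresp.swap {a : Γ(A.alg.sheaf, U)} {b : Γ(B.alg.sheaf, U)} (H : Corresp A B U a b) :
    Corresp B A U b a := by
  intro x hx
  obtain ⟨V, h, hxV, e⟩ := H x hx
  exact ⟨V, h, hxV, pairSpan_swap e⟩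

/-- Correspondence is compatible with every operation compatible with restriction and the span. -/
theorem Corresp.map₂ {a a' : Γ(A.alg.sheaf, U)} {b b' : Γ(B.alg.sheaf, U)}
    (H : Corresp A B U a b) (H' : Corresp A B U a' b') {c : Γ(A.alg.sheaf, U)}
    {d : Γ(B.alg.sheaf, U)}
    (K : ∀ (V : X.Opens) (h : V ≤ U), (mres _ h a, mres _ h b) ∈ pairSpan A B V →
      (mres _ h a', mres _ h b') ∈ pairSpan A B V → (mres _ h c, mres _ h d) ∈ pairSpan A B V) :
    Corresp A B U c d := by
  intro x hx
  obtain ⟨V, h, hxV, e⟩ := H x hx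
  obtain ⟨V', h', hxV', e'⟩ := H' x hx
  refine ⟨V ⊓ V', inf_le_left.trans h, ⟨hxV, hxV'⟩, K _ _ ?_ ?_⟩
  · simpa only [mres_mres] using pairSpan_res (V := V ⊓ V') inf_le_left e
  · simpa only [mres_mres] using pairSpan_res (V := V ⊓ V') inf_le_right e'

theorem Corresp.unique (hinj : ∀ U : X.Opens, Function.Injective (BasicOp.ad F p U))
    (hA : A.IsTransversal) (hB : B.IsTransversal) (hF : HasFrames π p n)
    (hl : HaveCommonLifts A B) {a : Γ(A.alg.sheaf, U)} {b b' : Γ(B.alg.sheaf, U)}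
    (h : Corresp A B U a b) (h' : Corresp A B U a b') : b = b' := by
  refine mres_eq_of_locally _ _ _ fun x hx => ?_
  obtain ⟨V, hxV, Fr, c, d, Q, h1, h2, h3⟩ := hl.exists_frame hF x
  obtain ⟨V1, hV1, hxV1, e1⟩ := h x hx
  obtain ⟨V2, hV2, hxV2, e2⟩ := h' x hx
  let V3 := V1 ⊓ V2 ⊓ V
  have le1 : V3 ≤ V1 := inf_le_left.trans inf_le_left
  have le2 : V3 ≤ V2 := inf_le_left.trans inf_le_right
  have le3 : V3 ≤ V := inf_le_right
  refine ⟨V3, le1.trans hV1, ⟨⟨hxV1, hxV2⟩, hxV⟩, ?_⟩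
  have e1 := pairSpan_res le1 e1
  have e2 := pairSpan_res le2 e2
  simp only [mres_mres] at e1 e2
  obtain ⟨s, k1, k2⟩ := exists_eq_of_mem_pairSpan hinj hA hB Fr le3 (fun i => (h1 i).res le3)
    (fun i => (h2 i).res le3) (fun i => (h3 i).res_left le3) e1
  obtain ⟨s', k1', k2'⟩ := exists_eq_of_mem_pairSpan hinj hA hB Fr le3 (fun i => (h1 i).res le3)
    (fun i => (h2 i).res le3) (fun i => (h3 i).res_left le3) e2
  obtain rfl : s = s' := A.ι_injective _ (add_right_cancel (k1.symm.trans k1'))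
  exact k2.trans k2'.symm

theorem Corresp.exists (hinj : ∀ U : X.Opens, Function.Injective (BasicOp.ad F p U))
    (hA : A.IsTransversal) (hB : B.IsTransversal) (hF : HasFrames π p n)
    (hl : HaveCommonLifts A B) (a : Γ(A.alg.sheaf, U)) : ∃ b, Corresp A B U a b := by
  have ex : ∀ x ∈ U, ∃ V : X.Opens, V ≤ U ∧ x ∈ V ∧ ∃ b, ∃ h : V ≤ U,
      Corresp A B V (mres _ h a) b := by
    intro x hx
    obtain ⟨V, hxV, Fr, c, d, Q, h1, h2, h3⟩ := hl.exists_frame hF x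
    obtain ⟨s, hs⟩ := hA.exists_eq_ι_add Fr (U := U ⊓ V) inf_le_right
      (fun i => by
        rw [← ((h1 i).res inf_le_right).1]
        exact (h3 i).res_left inf_le_right) (mres _ inf_le_left a)
    refine ⟨U ⊓ V, inf_le_left, ⟨hx, hxV⟩, B.ι.app _ s + ∑ i, Fr.coef inf_le_right
      (A.alg.anchor _ (mres _ inf_le_left a)) i • mres _ inf_le_right (d i), inf_le_left, ?_⟩
    rw [hs]
    have key : ∀ f : Fin n → Γ(X, U ⊓ V), (A.ι.app _ s + ∑ i, f i • mres _ inf_le_right (c i),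
        B.ι.app _ s + ∑ i, f i • mres _ inf_le_right (d i)) ∈ pairSpan A B (U ⊓ V) := by
      intro f
      have := Submodule.add_mem _ (ι_mem_pairSpan (A := A) (B := B) s)
        (Submodule.sum_mem (pairSpan A B (U ⊓ V)) (t := Finset.univ)
          (f := fun i => f i • (mres _ inf_le_right (c i), mres _ inf_le_right (d i)))
          fun i _ => Submodule.smul_mem _ _ (Submodule.subset_span
            ⟨_, (h1 i).res inf_le_right, (h2 i).res inf_le_right⟩))
      convert this using 1
      ext
      · simp [Prod.fst_sum]
      · simp [Prod.snd_sum]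
    rw [← hs]
    refine Corresp.of_mem ?_
    have := key (Fr.coef inf_le_right (A.alg.anchor _ (mres _ inf_le_left a)))
    rwa [← hs] at this
  obtain ⟨b, hb⟩ := exists_mglue B.alg.sheaf U
    (fun V b => ∃ h : V ≤ U, Corresp A B V (mres _ h a) b) ex (by
      rintro V hV b b' ⟨h1, hb⟩ ⟨_, hb'⟩
      exact Corresp.unique hinj hA hB hF hl hb hb') (by
      rintro V V' h hV b ⟨h1, hb⟩
      exact ⟨h.trans h1, by simpa only [mres_mres] using hb.res h⟩)
  refine ⟨b, Corresp.of_locally fun x hx => ?_⟩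
  obtain ⟨V, hV, hxV, b', h, hb'⟩ := ex x hx
  exact ⟨V, hV, hxV, by rwa [hb V hV b' ⟨h, hb'⟩]⟩

end Unfolding

/-- A morphism of sheaves of modules given by linear maps compatible with restrictions. -/
def homOfLinear {M N : X.Modules} (φ : ∀ U : X.Opens, Γ(M, U) →ₗ[Γ(X, U)] Γ(N, U))
    (hφ : ∀ (U V : X.Opens) (h : V ≤ U) (s : Γ(M, U)), φ V (mres M h s) = mres N h (φ U s)) :
    M ⟶ N :=
  ⟨PresheafOfModules.homMk (M₁ := M.val) (M₂ := N.val)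
    { app := fun U => AddCommGrpCat.ofHom (φ U.unop).toAddMonoidHom
      naturality := fun U V i => by
        ext s
        exact hφ U.unop V.unop i.unop.le s }
    fun U g s => (φ U.unop).map_smul g s⟩

/-- Transversal unfoldings with common lifts are isomorphic. -/
theorem Unfolding.isIsomorphic_of_haveCommonLifts [IsIntegral X] {A B : Unfolding F p}
    (hinj : ∀ U : X.Opens, Function.Injective (BasicOp.ad F p U))
    (hA : A.IsTransversal) (hB : B.IsTransversal) (hF : HasFrames π p n)
    (hl : HaveCommonLifts A B) : A.IsIsomorphic B := by
  choose φ hφ using fun (U : X.Opens) (a : Γ(A.alg.sheaf, U)) =>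
    Corresp.exists hinj hA hB hF hl a
  have uniq : ∀ (U : X.Opens) (a : Γ(A.alg.sheaf, U)) (b : Γ(B.alg.sheaf, U)),
      Corresp A B U a b → φ U a = b := fun U a b h =>
    Corresp.unique hinj hA hB hF hl (hφ U a) h
  let φl : ∀ U : X.Opens, Γ(A.alg.sheaf, U) →ₗ[Γ(X, U)] Γ(B.alg.sheaf, U) := fun U =>
    { toFun := φ U
      map_add' := fun a a' => uniq _ _ _ <| (hφ U a).map₂ (hφ U a') fun V h e e' => by
        simpa using Submodule.add_mem _ e e'
      map_smul' := fun g a => uniq _ _ _ <| (hφ U a).map₂ (hφ U a) fun V h e _ => by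
        simpa [mres_smul] using Submodule.smul_mem _ (fres h g) e }
  have hφl : ∀ (U V : X.Opens) (h : V ≤ U) (s : Γ(A.alg.sheaf, U)),
      φl V (mres _ h s) = mres _ h (φl U s) := fun U V h s => uniq _ _ _ ((hφ U s).res h)
  let Φ := homOfLinear φl hφl
  have hΦ : IsIso Φ := by
    rw [Scheme.Modules.Hom.isIso_iff_isIso_app]
    intro U
    rw [ConcreteCategory.isIso_iff_bijective]
    refine ⟨fun a a' h => ?_, fun b => ?_⟩
    · have h : φ U a = φ U a' := h
      exact Corresp.unique hinj hB hA hF hl.symm (hφ U a).swap (h ▸ (hφ U a').swap)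
    · obtain ⟨a, ha⟩ := Corresp.exists hinj hB hA hF hl.symm b
      exact ⟨a, uniq _ _ _ ha.swap⟩
  refine ⟨asIso Φ, ?_, fun U a => ?_, fun U a a' => ?_⟩
  · ext U s
    exact uniq _ _ _ (.of_mem (ι_mem_pairSpan s))
  · refine tangent.eq_of_locally _ _ fun x hx => ?_
    obtain ⟨V, h, hxV, e⟩ := hφ U a x hx
    refine ⟨V, h, hxV, ?_⟩
    rw [← B.alg.anchor_res, ← A.alg.anchor_res]
    exact anchor_eq_of_mem_pairSpan e
  · refine uniq _ _ _ ((hφ U a).map₂ (hφ U a') fun V h e e' => ?_)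
    rw [A.alg.bracket_res, B.alg.bracket_res]
    exact bracket_mem_pairSpan e e'

end LieAlgd

end

noncomputable section

namespace LieAlgd

variable {X Y S : Scheme.{0}} {π : X ⟶ S} {F : Family π} {p : S ⟶ Y} {U V : X.Opens} {n : ℕ}

/-! ### Derivations on affine opens -/

theorem exists_basicOpen_le (hV : IsAffineOpen V) (h : U ≤ V) {x : X} (hx : x ∈ U) :
    ∃ f : Γ(X, V), X.basicOpen f ≤ U ∧ x ∈ X.basicOpen f := by
  obtain ⟨f, hf, hxf⟩ := hV.exists_basicOpen_le ⟨x, hx⟩ (h hx)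
  exact ⟨f, hf, hxf⟩

theorem isUnit_fres_basicOpen {f : Γ(X, V)} {U : X.Opens} (h : U ≤ X.basicOpen f) :
    IsUnit (fres (h.trans (X.basicOpen_le f)) f) := by
  have : IsUnit (fres (X.basicOpen_le f) f) := RingedSpace.isUnit_res_basicOpen _ f
  rw [← fres_fres (X.basicOpen_le f) h]
  exact this.map _

/-- Functions on basic opens of an affine open are fractions. -/
theorem exists_fres_mul_eq (hV : IsAffineOpen V) (f : Γ(X, V)) (g : Γ(X, X.basicOpen f)) :
    ∃ (k : ℕ) (a : Γ(X, V)), fres (X.basicOpen_le f) (f ^ k) * g = fres (X.basicOpen_le f) a := by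
  have := hV.isLocalization_basicOpen f
  obtain ⟨⟨a, ⟨_, k, rfl⟩⟩, h⟩ := IsLocalization.surj (Submonoid.powers f) g
  exact ⟨k, a, (mul_comm _ _).trans h⟩

theorem exists_pow_mul_eq_zero (hV : IsAffineOpen V) (f : Γ(X, V)) {b : Γ(X, V)}
    (hb : fres (X.basicOpen_le f) b = 0) : ∃ k : ℕ, f ^ k * b = 0 := by
  have := hV.isLocalization_basicOpen f
  obtain ⟨⟨_, k, rfl⟩, h⟩ := (IsLocalization.map_eq_zero_iff (Submonoid.powers f)
    Γ(X, X.basicOpen f) b).mp hb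
  exact ⟨k, h⟩

theorem fres_derivation_eq_zero (hV : IsAffineOpen V) (d : Derivation ℤ Γ(X, V) Γ(X, V))
    (h : U ≤ V) {b : Γ(X, V)} (hb : fres h b = 0) : fres h (d b) = 0 := by
  refine fres_eq_of_locally _ _ fun x hx => ?_
  obtain ⟨f, hf, hxf⟩ := exists_basicOpen_le hV h hx
  refine ⟨_, hf, hxf, ?_⟩
  obtain ⟨k, hk⟩ := exists_pow_mul_eq_zero hV f (b := b) (by
    rw [← fres_fres h hf, hb, map_zero])
  have hk' : f ^ (k + 1) * b = 0 := by rw [pow_succ', mul_assoc, hk, mul_zero]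
  have e : f ^ (k + 1) * d b = 0 := by
    have := congrArg d hk'
    rw [Derivation.leibniz, map_zero, Derivation.leibniz_pow] at this
    have e2 : b • ((k + 1) • f ^ (k + 1 - 1) • d f) = (k + 1) • ((f ^ k * b) * d f) := by
      simp only [smul_eq_mul, nsmul_eq_mul, Nat.add_sub_cancel]
      ring
    rw [e2, hk, zero_mul, smul_zero, add_zero] at this
    exact this
  rw [fres_fres, map_zero]
  have hu := (isUnit_fres_basicOpen (le_refl (X.basicOpen f))).pow (k + 1)
  refine hu.mul_right_eq_zero.mp ?_
  rw [← map_pow, ← map_mul, e, map_zero]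

/-- The function `h` is the value on `g = a / u` of the extension of a derivation `d` of `Γ(X, V)`
to functions on a smaller open. -/
def IsDerValue (d : Derivation ℤ Γ(X, V) Γ(X, V)) (hU : U ≤ V) (g k : Γ(X, U)) : Prop :=
  ∃ u a : Γ(X, V), IsUnit (fres hU u) ∧ fres hU u * g = fres hU a ∧
    fres hU u * k + fres hU (d u) * g = fres hU (d a)

namespace IsDerValue

variable {d : Derivation ℤ Γ(X, V) Γ(X, V)} {hU : U ≤ V} {g g' k k' : Γ(X, U)}

theorem unique (hV : IsAffineOpen V) (h : IsDerValue d hU g k) (h' : IsDerValue d hU g k') :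
    k = k' := by
  obtain ⟨u, a, hu, e1, e2⟩ := h
  obtain ⟨u', a', hu', e1', e2'⟩ := h'
  have key := fres_derivation_eq_zero hV d hU (b := u * a' - u' * a) (by
    rw [map_sub, map_mul, map_mul, ← e1, ← e1']; ring)
  rw [map_sub, Derivation.leibniz, Derivation.leibniz] at key
  simp only [smul_eq_mul, map_sub, map_add, map_mul] at key
  rw [← e1, ← e1', ← e2, ← e2'] at key
  have : (fres hU u * fres hU u') * (k' - k) = 0 := by linear_combination key
  exact (sub_eq_zero.mp ((hu.mul hu').mul_right_eq_zero.mp this)).symm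

theorem add (h : IsDerValue d hU g k) (h' : IsDerValue d hU g' k') :
    IsDerValue d hU (g + g') (k + k') := by
  obtain ⟨u, a, hu, e1, e2⟩ := h
  obtain ⟨u', a', hu', e1', e2'⟩ := h'
  refine ⟨u * u', u' * a + u * a', by simpa using hu.mul hu', ?_, ?_⟩
  · simp only [map_add, map_mul, ← e1, ← e1']
    ring
  · simp only [map_add, map_mul, Derivation.leibniz, smul_eq_mul, ← e1, ← e1', ← e2, ← e2']
    ring

theorem mul (h : IsDerValue d hU g k) (h' : IsDerValue d hU g' k') :
    IsDerValue d hU (g * g') (g * k' + g' * k) := by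
  obtain ⟨u, a, hu, e1, e2⟩ := h
  obtain ⟨u', a', hu', e1', e2'⟩ := h'
  refine ⟨u * u', a * a', by simpa using hu.mul hu', ?_, ?_⟩
  · simp only [map_mul, ← e1, ← e1']
    ring
  · simp only [map_add, map_mul, Derivation.leibniz, smul_eq_mul, ← e1, ← e1', ← e2, ← e2']
    ring

theorem fres_self (a : Γ(X, V)) : IsDerValue d hU (fres hU a) (fres hU (d a)) :=
  ⟨1, a, by simp, by simp, by simp⟩

theorem res (h : IsDerValue d hU g k) {W : X.Opens} (hW : W ≤ U) :
    IsDerValue d (hW.trans hU) (fres hW g) (fres hW k) := by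
  obtain ⟨u, a, hu, e1, e2⟩ := h
  refine ⟨u, a, ?_, ?_, ?_⟩ <;> simp only [← fres_fres hU hW]
  · exact hu.map _
  · rw [← map_mul, e1]
  · rw [← map_mul, ← map_mul, ← map_add, e2]

theorem exists_local (hV : IsAffineOpen V) (d : Derivation ℤ Γ(X, V) Γ(X, V)) (hU : U ≤ V)
    (g : Γ(X, U)) {x : X} (hx : x ∈ U) : ∃ (W : X.Opens) (h : W ≤ U), x ∈ W ∧
      ∃ k, IsDerValue d (h.trans hU) (fres h g) k := by
  obtain ⟨f, hf, hxf⟩ := exists_basicOpen_le hV hU hx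
  obtain ⟨m, a, e⟩ := exists_fres_mul_eq hV f (fres hf g)
  have hu : IsUnit (fres (X.basicOpen_le f) (f ^ m)) := by
    rw [map_pow]
    exact (isUnit_fres_basicOpen (le_refl (X.basicOpen f))).pow m
  refine ⟨_, hf, hxf, hu.unit⁻¹ * (fres (X.basicOpen_le f) (d a) -
    fres (X.basicOpen_le f) (d (f ^ m)) * fres hf g), f ^ m, a, hu, e, ?_⟩
  rw [← mul_assoc, IsUnit.mul_val_inv, one_mul, sub_add_cancel]

end IsDerValue

/-- A derivation of the functions on an affine open extends to the sheaf of functions. -/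
theorem tangent.exists_der_eq {f : X ⟶ Y} (hV : IsAffineOpen V)
    (d : Derivation ℤ Γ(X, V) Γ(X, V))
    (hd : ∀ (U : X.Opens) (h : U ≤ V) (W : Y.Opens) (e : U ≤ f ⁻¹ᵁ W) (c : Γ(Y, W)),
      IsDerValue d h (pull f e c) 0) :
    ∃ D : tangent f V, D.der le_rfl = d := by
  have key : ∀ (U : X.Opens) (hU : U ≤ V) (g : Γ(X, U)), ∃ k : Γ(X, U),
      ∀ (W : X.Opens) (hW : W ≤ U) (k' : Γ(X, W)),
        IsDerValue d (hW.trans hU) (fres hW g) k' → fres hW k = k' := by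
    intro U hU g
    obtain ⟨k, hk⟩ := exists_fglue U (fun W k' => ∃ hW : W ≤ U,
      IsDerValue d (hW.trans hU) (fres hW g) k') (fun x hx => by
        obtain ⟨W, hW, hxW, k, hk⟩ := IsDerValue.exists_local hV d hU g hx
        exact ⟨W, hW, hxW, k, hW, hk⟩) (by
        rintro W hW k k' ⟨_, hk⟩ ⟨_, hk'⟩
        exact hk.unique hV hk') (by
        rintro W W' h hW k ⟨_, hk⟩
        exact ⟨h.trans hW, by simpa only [fres_fres] using hk.res h⟩)
    exact ⟨k, fun W hW k' hk' => hk W hW k' ⟨hW, hk'⟩⟩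
  choose D hD using key
  have hDl : ∀ (U : X.Opens) (hU : U ≤ V) (g : Γ(X, U)), ∀ x ∈ U, ∃ (W : X.Opens) (h : W ≤ U),
      x ∈ W ∧ IsDerValue d (h.trans hU) (fres h g) (fres h (D U hU g)) := by
    intro U hU g x hx
    obtain ⟨W, hW, hxW, k, hk⟩ := IsDerValue.exists_local hV d hU g hx
    exact ⟨W, hW, hxW, by rwa [hD U hU g W hW k hk]⟩
  have eqD : ∀ (U : X.Opens) (hU : U ≤ V) (g k : Γ(X, U)),
      (∀ x ∈ U, ∃ (W : X.Opens) (h : W ≤ U),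
        x ∈ W ∧ IsDerValue d (h.trans hU) (fres h g) (fres h k)) → D U hU g = k := by
    intro U hU g k H
    refine fres_eq_of_locally _ _ fun x hx => ?_
    obtain ⟨W, h, hxW, hk⟩ := H x hx
    exact ⟨W, h, hxW, hD U hU g W h _ hk⟩
  have eqD' : ∀ (U : X.Opens) (hU : U ≤ V) (g k : Γ(X, U)), IsDerValue d hU g k → D U hU g = k :=
    fun U hU g k hk => eqD U hU g k fun x hx => ⟨U, le_rfl, hx, hk.res le_rfl⟩
  let Dd : ∀ U : {U : X.Opens // U ≤ V}, Derivation ℤ Γ(X, U.1) Γ(X, U.1) := fun U =>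
    Derivation.mk' (AddMonoidHom.toIntLinearMap
      { toFun := D U.1 U.2
        map_zero' := eqD' _ _ _ _ (by simpa using IsDerValue.fres_self (d := d) (hU := U.2) 0)
        map_add' := fun g g' => eqD _ _ _ _ fun x hx => by
          obtain ⟨W, h, hxW, hk⟩ := hDl U.1 U.2 g x hx
          obtain ⟨W', h', hxW', hk'⟩ := hDl U.1 U.2 g' x hx
          refine ⟨W ⊓ W', inf_le_left.trans h, ⟨hxW, hxW'⟩, ?_⟩
          have := (hk.res (W := W ⊓ W') inf_le_left).add (hk'.res (W := W ⊓ W') inf_le_right)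
          simpa only [fres_fres, map_add] using this }) fun g g' => eqD _ _ _ _ fun x hx => by
      obtain ⟨W, h, hxW, hk⟩ := hDl U.1 U.2 g x hx
      obtain ⟨W', h', hxW', hk'⟩ := hDl U.1 U.2 g' x hx
      refine ⟨W ⊓ W', inf_le_left.trans h, ⟨hxW, hxW'⟩, ?_⟩
      have := (hk.res (W := W ⊓ W') inf_le_left).mul (hk'.res (W := W ⊓ W') inf_le_right)
      simp only [fres_fres] at this
      change IsDerValue d _ _ (fres _ (g * D U.1 U.2 g' + g' * D U.1 U.2 g))
      simpa only [map_add, map_mul] using this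
  refine ⟨⟨Dd, fun U W h g => ?_, fun U W e c => eqD' _ _ _ _ (hd _ _ _ _ _)⟩, ?_⟩
  · refine (eqD W.1 W.2 (fres h g) _ fun x hx => ?_).symm
    obtain ⟨W', h', hxW', hk⟩ := hDl U.1 U.2 g x (h hx)
    refine ⟨W' ⊓ W.1, inf_le_right, ⟨hxW', hx⟩, ?_⟩
    have := hk.res (W := W' ⊓ W.1) inf_le_left
    simp only [fres_fres] at this ⊢
    exact this
  · refine Derivation.ext fun g => eqD' _ _ _ _ ?_
    have := IsDerValue.fres_self (d := d) (hU := le_refl V) g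
    simpa only [LieAlgd.fres_self] using this

/-- A derivation along `π`, compatible with restrictions, vanishes if it vanishes on the functions
on an affine open of the base. -/
theorem eq_zero_of_affine {W : S.Opens} (hW : IsAffineOpen W)
    (e : V ≤ π ⁻¹ᵁ W) (δ : ∀ (V' : X.Opens) (_ : V' ≤ V) (W' : S.Opens) (_ : W' ≤ W)
      (_ : V' ≤ π ⁻¹ᵁ W'), Γ(S, W') → Γ(X, V'))
    (hmul : ∀ V' hV' W' hW' e' b c, δ V' hV' W' hW' e' (b * c) =
      pull π e' b * δ V' hV' W' hW' e' c + pull π e' c * δ V' hV' W' hW' e' b)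
    (hresX : ∀ V' hV' W' hW' e' (V'' : X.Opens) (h : V'' ≤ V') c,
      fres h (δ V' hV' W' hW' e' c) = δ V'' (h.trans hV') W' hW' (h.trans e') c)
    (hresS : ∀ V' hV' W' hW' e' (W'' : S.Opens) (h : W'' ≤ W') (e'' : V' ≤ π ⁻¹ᵁ W'') c,
      δ V' hV' W'' (h.trans hW') e'' (fres h c) = δ V' hV' W' hW' e' c)
    (H : ∀ c, δ V le_rfl W le_rfl e c = 0) (V' : X.Opens) (hV' : V' ≤ V) (W' : S.Opens)
    (hW' : W' ≤ W) (e' : V' ≤ π ⁻¹ᵁ W') (c : Γ(S, W')) : δ V' hV' W' hW' e' c = 0 := by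
  refine fres_eq_of_locally _ _ fun x hx => ?_
  obtain ⟨f, hf, hxf⟩ := exists_basicOpen_le hW hW' (e' hx)
  let V'' : X.Opens := V' ⊓ π ⁻¹ᵁ S.basicOpen f
  have e'' : V'' ≤ π ⁻¹ᵁ S.basicOpen f := inf_le_right
  refine ⟨V'', inf_le_left, ⟨hx, hxf⟩, ?_⟩
  rw [hresX, map_zero, ← hresS V'' (inf_le_left.trans hV') W' hW' (inf_le_left.trans e') _ hf e'']
  obtain ⟨m, a, ha⟩ := exists_fres_mul_eq hW f (fres hf c)
  have h0 : ∀ b : Γ(S, W), δ V'' (inf_le_left.trans hV') (S.basicOpen f) (S.basicOpen_le f) e''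
      (fres (S.basicOpen_le f) b) = 0 := by
    intro b
    rw [hresS V'' (inf_le_left.trans hV') W le_rfl ((inf_le_left.trans hV').trans e) _
      (S.basicOpen_le f) e'' b, ← hresX V le_rfl W le_rfl e V'' (inf_le_left.trans hV') b, H,
      map_zero]
  have h1 := hmul V'' (inf_le_left.trans hV') (S.basicOpen f) (S.basicOpen_le f) e''
    (fres (S.basicOpen_le f) (f ^ m)) (fres hf c)
  rw [ha, h0, h0, mul_zero, add_zero] at h1
  refine IsUnit.mul_right_eq_zero (IsUnit.map (pull π e'') ?_) |>.mp h1.symm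
  rw [map_pow]
  exact (isUnit_fres_basicOpen (le_refl (S.basicOpen f))).pow m

/-- Relatedness of vector fields may be checked on the functions on an affine open of the base. -/
theorem related_of_affine {W : S.Opens} (hW : IsAffineOpen W) (e : V ≤ π ⁻¹ᵁ W)
    {D : tangent (π ≫ p) V} {v : tangent p W}
    (H : ∀ c, D.der le_rfl (pull π e c) = pull π e (v.der le_rfl c)) : Related π p D v := by
  intro V' hV' W' hW' e' c
  rw [← sub_eq_zero]
  refine eq_zero_of_affine hW e (fun V' hV' W' hW' e' c =>
    D.der hV' (pull π e' c) - pull π e' (v.der hW' c)) ?_ ?_ ?_ ?_ V' hV' W' hW' e' c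
  · intro V' hV' W' hW' e' b c
    simp only [map_mul, Derivation.leibniz, smul_eq_mul, map_add]
    ring
  · intro V' hV' W' hW' e' V'' h c
    rw [map_sub, tangent.fres_der, fres_pull, fres_pull]
  · intro V' hV' W' hW' e' W'' h e'' c
    rw [pull_fres, ← tangent.fres_der, pull_fres]
  · intro c
    rw [H, sub_self]

theorem pull_id {U : S.Opens} {W : S.Opens} (e : U ≤ (𝟙 S) ⁻¹ᵁ W) (c : Γ(S, W)) :
    pull (𝟙 S) e c = fres (show U ≤ W from e) c := by
  have : (𝟙 S : S ⟶ S).appLE W U e = S.presheaf.map (homOfLE (show U ≤ W from e)).op := by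
    rw [Scheme.Hom.appLE, Scheme.Hom.id_app]
    exact Category.id_comp _
  exact congr($(this).hom c)

/-- A vector field on an open subset of an affine open `W` vanishes if it kills the functions
on `W`. -/
theorem tangent.eq_zero_of_le_affine {f : X ⟶ Y} {W : X.Opens} (hW : IsAffineOpen W) (h : V ≤ W)
    {D : tangent f V} (H : ∀ c, D.der le_rfl (fres h c) = 0) : D = 0 := by
  refine tangent.ext fun U hU g => ?_
  have le_id : ∀ {V V' : X.Opens}, V ≤ V' → V ≤ 𝟙 X ⁻¹ᵁ V' := fun h => h
  have := LieAlgd.eq_zero_of_affine (π := 𝟙 X) hW (V := V) (le_id h)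
    (fun V' hV' W' hW' e' c => D.der hV' (pull (𝟙 X) e' c)) ?_ ?_ ?_ ?_ U hU U (hU.trans h)
    (le_id le_rfl) g
  · rw [pull_id, LieAlgd.fres_self] at this
    exact this
  · intro V' hV' W' hW' e' b c
    simp only [map_mul, Derivation.leibniz, smul_eq_mul]
  · intro V' hV' W' hW' e' V'' h c
    rw [tangent.fres_der, fres_pull]
  · intro V' hV' W' hW' e' W'' h e'' c
    rw [pull_fres]
  · intro c
    rw [pull_id]
    exact H _

end LieAlgd

end

noncomputable section
namespace LieAlgd

/-! ### Differentials of smooth algebras -/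

section Kaehler

open scoped TensorProduct

variable {k A B : Type*} [CommRing k] [CommRing A] [CommRing B] [Algebra k A] [Algebra k B]
  [Algebra B A] [IsScalarTower k B A]

/-- For `A` formally smooth over `B`, the module `A ⊗_B Ω_{B/k}` is a direct summand of
`Ω_{A/k}`. -/
theorem exists_retraction_mapBaseChange [Algebra.FormallySmooth B A] :
    ∃ r : Ω[A⁄k] →ₗ[A] A ⊗[B] Ω[B⁄k],
      r ∘ₗ KaehlerDifferential.mapBaseChange k B A = LinearMap.id := by
  have hinj : Function.Injective (KaehlerDifferential.mapBaseChange k B A) := by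
    rw [injective_iff_map_eq_zero]
    intro x hx
    obtain ⟨y, rfl⟩ := (Algebra.H1Cotangent.exact_δ_mapBaseChange k B A x).mp hx
    rw [Subsingleton.elim y 0, map_zero]
  refine ((Function.Exact.split_tfae (KaehlerDifferential.exact_mapBaseChange_map k B A) hinj
    (KaehlerDifferential.map_surjective k B A)).out 0 1).mp ?_
  exact Module.projective_lifting_property _ _ (KaehlerDifferential.map_surjective k B A)

/-- Derivations of `B` extend to formally smooth `B`-algebras. -/
theorem exists_derivation_algebraMap [Algebra.FormallySmooth B A] (δ : Derivation k B B) :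
    ∃ D : Derivation k A A, ∀ b, D (algebraMap B A b) = algebraMap B A (δ b) := by
  obtain ⟨r, hr⟩ := exists_retraction_mapBaseChange (k := k) (A := A) (B := B)
  let ℓ : A ⊗[B] Ω[B⁄k] →ₗ[A] A :=
    (TensorProduct.AlgebraTensorModule.rid B A A).toLinearMap ∘ₗ
      (δ.liftKaehlerDifferential).baseChange A
  refine ⟨(ℓ ∘ₗ r).compDer (KaehlerDifferential.D k A), fun b => ?_⟩
  have h1 : KaehlerDifferential.D k A (algebraMap B A b) =
      KaehlerDifferential.mapBaseChange k B A (1 ⊗ₜ KaehlerDifferential.D k B b) := by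
    simp
  have h2 := LinearMap.congr_fun hr (1 ⊗ₜ KaehlerDifferential.D k B b)
  simp only [LinearMap.comp_apply, LinearMap.id_apply] at h2
  change ℓ (r (KaehlerDifferential.D k A (algebraMap B A b))) = _
  rw [h1, h2]
  simp [ℓ, Algebra.algebraMap_eq_smul_one]

/-- Differentials of the base of a smooth, faithfully flat algebra which is itself smooth over `k`
form a flat module. -/
theorem flat_kaehlerDifferential [Algebra.FormallySmooth B A] [Algebra.FormallySmooth k A]
    [Module.FaithfullyFlat B A] : Module.Flat B Ω[B⁄k] := by
  obtain ⟨r, hr⟩ := exists_retraction_mapBaseChange (k := k) (A := A) (B := B)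
  have : Module.Flat A (A ⊗[B] Ω[B⁄k]) := Module.Flat.of_retract _ r hr
  exact Module.Flat.of_flat_tensorProduct B _ A

end Kaehler

section Basis

variable {k B : Type} [CommRing k] [CommRing B] [Algebra k B]

theorem exists_basis_kaehlerDifferential [IsNoetherianRing k] [Algebra.FiniteType k B] [IsDomain B]
    [Module.Flat B Ω[B⁄k]] (P : Ideal B) [P.IsPrime] :
    ∃ (n : ℕ) (t : Fin n → B) (f : B), f ∉ P ∧ ∀ (C : Type) [CommRing C] [Algebra k C]
      [Algebra B C] [IsScalarTower k B C] [IsLocalization.Away f C],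
      ∃ b : Module.Basis (Fin n) C Ω[C⁄k],
        ∀ i, b i = KaehlerDifferential.D k C (algebraMap B C (t i)) := by
  classical
  have : IsNoetherianRing B := Algebra.FiniteType.isNoetherianRing k B
  let Bp := Localization.AtPrime P
  let g := KaehlerDifferential.map k k B Bp
  have hg : IsLocalizedModule P.primeCompl g := KaehlerDifferential.isLocalizedModule_map ..
  have : Module.Flat Bp Ω[Bp⁄k] := Module.Flat.of_isLocalizedModule Bp P.primeCompl g
  have : Module.Finite Bp Ω[Bp⁄k] := Module.Finite.of_isLocalizedModule P.primeCompl g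
  have : IsNoetherianRing Bp := IsLocalization.isNoetherianRing P.primeCompl _ inferInstance
  have : Module.FinitePresentation Bp Ω[Bp⁄k] := Module.finitePresentation_of_finite _ _
  have hspan : Submodule.span Bp (Set.range fun b : B => g (KaehlerDifferential.D k B b)) = ⊤ := by
    have := span_eq_top_of_isLocalizedModule Bp P.primeCompl g
      (KaehlerDifferential.span_range_derivation k B)
    rwa [← Set.range_comp] at this
  obtain ⟨κ, a, b, hb⟩ := Module.exists_basis_of_span_of_flat _ hspan
  have : Finite κ := Module.Finite.finite_basis b
  obtain ⟨n, ⟨e⟩⟩ := Finite.exists_equiv_fin κ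
  let t : Fin n → B := fun i => a (e.symm i)
  let ω : Fin n → Ω[B⁄k] := fun i => KaehlerDifferential.D k B (t i)
  have hω : LinearIndependent B ω := by
    have h1 : LinearIndependent Bp (g ∘ ω) := by
      have e1 : g ∘ ω = b.reindex e := by
        ext i
        simp [ω, t, hb]
      rw [e1]
      exact (b.reindex e).linearIndependent
    have h2 : LinearIndependent B (g ∘ ω) := h1.restrict_scalars' B
    exact LinearIndependent.of_comp g h2
  have hs : ∃ s : B, s ∉ P ∧ ∀ η : Ω[B⁄k], s • η ∈ Submodule.span B (Set.range ω) := by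
    have h1 : ∀ η : Ω[B⁄k], ∃ s : B, s ∉ P ∧ s • η ∈ Submodule.span B (Set.range ω) := by
      intro η
      have h2 : g η ∈ Submodule.span Bp (g '' Set.range ω) := by
        have : Submodule.span Bp (g '' Set.range ω) = ⊤ := by
          rw [← (b.reindex e).span_eq, ← Set.range_comp]
          congr 2
          ext i
          simp [ω, t, hb]
        rw [this]
        trivial
      rw [← Submodule.localized'_span Bp P.primeCompl g] at h2
      obtain ⟨m, hm, s, hms⟩ := h2
      rw [IsLocalizedModule.mk'_eq_iff] at hms
      obtain ⟨c, hc⟩ := (IsLocalizedModule.eq_iff_exists P.primeCompl g).mp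
        (show g m = g (s.1 • η) by rw [hms, map_smul]; rfl)
      refine ⟨c.1 * s.1, P.primeCompl.mul_mem c.2 s.2, ?_⟩
      rw [mul_smul]
      have : c.1 • s.1 • η = c.1 • m := hc.symm
      rw [this]
      exact Submodule.smul_mem _ _ hm
    obtain ⟨T, hT⟩ := (inferInstance : Module.Finite B Ω[B⁄k]).fg_top
    choose s hsP hsT using h1
    refine ⟨∏ η ∈ T, s η, fun h => ?_, fun η => ?_⟩
    · obtain ⟨η, -, h⟩ := (Ideal.IsPrime.prod_mem_iff).mp h
      exact hsP η h
    · have : η ∈ Submodule.span B (T : Set Ω[B⁄k]) := hT ▸ trivial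
      induction this using Submodule.span_induction with
      | mem η h =>
        rw [← Finset.prod_erase_mul _ _ (Finset.mem_coe.mp h), mul_smul]
        exact Submodule.smul_mem _ _ (hsT η)
      | zero => simp
      | add x y _ _ hx hy => rw [smul_add]; exact Submodule.add_mem _ hx hy
      | smul c x _ hx => rw [smul_comm]; exact Submodule.smul_mem _ _ hx
  obtain ⟨s, hsP, hs⟩ := hs
  refine ⟨n, t, s, hsP, fun C _ _ _ _ _ => ?_⟩
  let gC := KaehlerDifferential.map k k B C
  have : IsLocalizedModule (Submonoid.powers s) gC := KaehlerDifferential.isLocalizedModule_map ..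
  have hli : LinearIndependent C (gC ∘ ω) := hω.of_isLocalizedModule C (Submonoid.powers s) gC
  have hu : IsUnit (algebraMap B C s) := IsLocalization.Away.algebraMap_isUnit s
  refine ⟨Module.Basis.mk hli ?_, fun i => ?_⟩
  · rw [← span_eq_top_of_isLocalizedModule C (Submonoid.powers s) gC
      (KaehlerDifferential.span_range_derivation k B), Submodule.span_le]
    rintro _ ⟨η, -, rfl⟩
    have h1 : ∀ ξ ∈ Submodule.span B (Set.range ω),
        gC ξ ∈ Submodule.span C (Set.range (gC ∘ ω)) := by
      intro ξ hξ
      induction hξ using Submodule.span_induction with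
      | mem x h =>
        obtain ⟨i, rfl⟩ := h
        exact Submodule.subset_span ⟨i, rfl⟩
      | zero => simp
      | add x y _ _ hx hy => rw [map_add]; exact Submodule.add_mem _ hx hy
      | smul c x _ hx =>
        rw [map_smul, ← algebraMap_smul C]
        exact Submodule.smul_mem _ _ hx
    have h2 := h1 _ (hs η)
    rw [map_smul, ← algebraMap_smul C] at h2
    exact (Submodule.smul_mem_iff_of_isUnit _ hu).mp h2
  · simp [gC, ω]

/-- A derivation along a homomorphism vanishes if it kills functions whose differentials form a
basis. -/
theorem eq_zero_of_basis_kaehlerDifferential {n : ℕ} {t : Fin n → B}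
    (b : Module.Basis (Fin n) B Ω[B⁄k]) (hb : ∀ i, b i = KaehlerDifferential.D k B (t i))
    {R : Type} [CommRing R] (φ : B →+* R) (δ : B →+ R)
    (hmul : ∀ x y, δ (x * y) = φ x * δ y + φ y * δ x) (hk : ∀ c, δ (algebraMap k B c) = 0)
    (ht : ∀ i, δ (t i) = 0) (x : B) : δ x = 0 := by
  let := φ.toAlgebra
  let := (φ.comp (algebraMap k B)).toAlgebra
  have : IsScalarTower k B R := .of_algebraMap_eq' rfl
  let D : Derivation k B R := Derivation.mk'
    { toFun := δ
      map_add' := δ.map_add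
      map_smul' := fun c y => by
        rw [Algebra.smul_def, hmul, hk, mul_zero, add_zero, RingHom.id_apply, Algebra.smul_def]
        rfl } fun x y => by
      rw [Algebra.smul_def, Algebra.smul_def]
      exact hmul x y
  have h0 : D.liftKaehlerDifferential = 0 := b.ext fun i => by
    rw [hb, Derivation.liftKaehlerDifferential_comp_D]
    exact ht i
  have := Derivation.liftKaehlerDifferential_comp_D D x
  rw [h0] at this
  exact this.symm

end Basis

/-! ### Vector fields on smooth schemes over the complex numbers -/

section Geometry

variable {X S : Scheme.{0}} {π : X ⟶ S} {U V : X.Opens}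

theorem le_preimage_top {Y : Scheme.{0}} (f : X ⟶ Y) (U : X.Opens) : U ≤ f ⁻¹ᵁ ⊤ :=
  fun _ _ => trivial

/-- The structure map from the complex numbers to functions on a scheme over `Spec ℂ`. -/
def constMap (f : X ⟶ Spec (CommRingCat.of ℂ)) (U : X.Opens) : ℂ →+* Γ(X, U) :=
  (pull f (le_preimage_top f U)).comp (Scheme.ΓSpecIso (CommRingCat.of ℂ)).inv.hom

theorem constMap_apply (f : X ⟶ Spec (CommRingCat.of ℂ)) (U : X.Opens) (c : ℂ) :
    constMap f U c = pull f (le_preimage_top f U)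
      ((Scheme.ΓSpecIso (CommRingCat.of ℂ)).inv.hom c) := rfl

theorem fres_constMap {f : X ⟶ Spec (CommRingCat.of ℂ)} (h : V ≤ U) (c : ℂ) :
    fres h (constMap f U c) = constMap f V c := by
  rw [constMap_apply, constMap_apply, fres_pull]

theorem pull_constMap {p : S ⟶ Spec (CommRingCat.of ℂ)} {W : S.Opens} (e : V ≤ π ⁻¹ᵁ W) (c : ℂ) :
    pull π e (constMap p W c) = constMap (π ≫ p) V c := by
  rw [constMap_apply, constMap_apply, pull_comp,
    ← fres_pull p (W := ⊤) (U := p ⁻¹ᵁ ⊤) le_rfl (le_preimage_top p W), pull_fres]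

theorem tangent.der_constMap {f : X ⟶ Spec (CommRingCat.of ℂ)} (D : tangent f U) (h : V ≤ U)
    (c : ℂ) : D.der h (constMap f V c) = 0 := by
  rw [constMap_apply, D.der_pull]

theorem eq_top_of_mem_spec {W : (Spec (CommRingCat.of ℂ)).Opens} {x : Spec (CommRingCat.of ℂ)}
    (hx : x ∈ W) : W = ⊤ := by
  have : Subsingleton (Spec (CommRingCat.of ℂ)) :=
    inferInstanceAs (Subsingleton (PrimeSpectrum ℂ))
  exact top_unique fun y _ => Subsingleton.elim x y ▸ hx

theorem tangent.exists_der_eq_of_constMap {f : X ⟶ Spec (CommRingCat.of ℂ)} (hV : IsAffineOpen V)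
    (d : Derivation ℤ Γ(X, V) Γ(X, V)) (hd : ∀ c, d (constMap f V c) = 0) :
    ∃ D : tangent f V, D.der le_rfl = d := by
  refine tangent.exists_der_eq hV d fun U h W e c => ?_
  by_cases hU : (U : Set X).Nonempty
  · obtain ⟨x, hx⟩ := hU
    obtain rfl := eq_top_of_mem_spec (e hx)
    obtain ⟨c, rfl⟩ : ∃ c', (Scheme.ΓSpecIso (CommRingCat.of ℂ)).inv.hom c' = c :=
      ⟨(Scheme.ΓSpecIso (CommRingCat.of ℂ)).hom.hom c,
        congr($((Scheme.ΓSpecIso (CommRingCat.of ℂ)).hom_inv_id).hom c)⟩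
    have := IsDerValue.fres_self (d := d) (hU := h) (constMap f V c)
    rw [hd, map_zero, fres_constMap] at this
    exact this
  · have : Subsingleton Γ(X, U) := by
      obtain rfl : U = ⊥ := by
        ext x
        exact iff_of_false (fun hx => hU ⟨x, hx⟩) id
      infer_instance
    exact ⟨1, 0, by simp, Subsingleton.elim _ _, Subsingleton.elim _ _⟩

theorem smooth_constMap {f : X ⟶ Spec (CommRingCat.of ℂ)} [Smooth f] (hU : IsAffineOpen U) :
    (constMap f U).Smooth :=
  RingHom.Smooth.respectsIso.2 (pull f (le_preimage_top f U))
    (Scheme.ΓSpecIso (CommRingCat.of ℂ)).symm.commRingCatIsoToRingEquiv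
    (f.smooth_appLE (isAffineOpen_top _) hU (le_preimage_top f U))

theorem finiteType_constMap {f : X ⟶ Spec (CommRingCat.of ℂ)} [LocallyOfFiniteType f]
    (hU : IsAffineOpen U) : (constMap f U).FiniteType :=
  RingHom.finiteType_respectsIso.2 (pull f (le_preimage_top f U))
    (Scheme.ΓSpecIso (CommRingCat.of ℂ)).symm.commRingCatIsoToRingEquiv
    (f.finiteType_appLE (isAffineOpen_top _) hU (le_preimage_top f U))

theorem exists_affine_nhd (W : S.Opens) {x : X} (hx : x ∈ π ⁻¹ᵁ W) :
    ∃ (W' : S.Opens) (V : X.Opens), W' ≤ W ∧ IsAffineOpen W' ∧ IsAffineOpen V ∧ V ≤ π ⁻¹ᵁ W' ∧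
      x ∈ V := by
  obtain ⟨_, ⟨W', hW', rfl⟩, hx', h⟩ := S.isBasis_affineOpens.exists_subset_of_mem_open hx W.2
  obtain ⟨_, ⟨V, hV, rfl⟩, hxV, h'⟩ := X.isBasis_affineOpens.exists_subset_of_mem_open
    (show x ∈ (π ⁻¹ᵁ W' : X.Opens) from hx') (π ⁻¹ᵁ W').2
  exact ⟨W', V, h, hW', hV, h', hxV⟩

theorem Related.of_res {Y : Scheme.{0}} {p : S ⟶ Y} {W W' : S.Opens} {D : tangent (π ≫ p) U}
    {v : tangent p W} (h : W' ≤ W) (e : U ≤ π ⁻¹ᵁ W') (H : Related π p D (tangent.res h v)) :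
    Related π p D v := by
  intro V hV W1 hW1 e1 c
  have e2 : V ≤ π ⁻¹ᵁ (W1 ⊓ W') := fun y hy => ⟨e1 hy, e (hV hy)⟩
  have := H V hV (W1 ⊓ W') inf_le_right e2 (fres inf_le_left c)
  rwa [pull_fres, tangent.res_der, ← tangent.fres_der v hW1, pull_fres] at this

/-- Vector fields on the base of a smooth morphism lift locally. -/
theorem hasLifts_of_smooth (π : X ⟶ S) (p : S ⟶ Spec (CommRingCat.of ℂ)) [Smooth π] :
    HasLifts π p := by
  intro W v x hx
  obtain ⟨W', V, hW, hW', hV, e, hxV⟩ := exists_affine_nhd W hx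
  let := (constMap p W').toAlgebra
  let := (constMap (π ≫ p) V).toAlgebra
  let := (pull π e).toAlgebra
  have : IsScalarTower ℂ Γ(S, W') Γ(X, V) :=
    .of_algebraMap_eq fun c => (pull_constMap e c).symm
  have : Algebra.Smooth Γ(S, W') Γ(X, V) := π.smooth_appLE hW' hV e
  let δ : Derivation ℂ Γ(S, W') Γ(S, W') := Derivation.mk'
    { toFun := v.der hW
      map_add' := map_add _
      map_smul' := fun c b => by
        rw [Algebra.smul_def, Derivation.leibniz, RingHom.id_apply, Algebra.smul_def]
        change _ + _ • v.der hW (constMap p W' c) = _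
        rw [tangent.der_constMap, smul_zero, add_zero]
        rfl } fun a b => (v.der hW).leibniz a b
  obtain ⟨D, hD⟩ := exists_derivation_algebraMap (A := Γ(X, V)) δ
  obtain ⟨E, hE⟩ := tangent.exists_der_eq_of_constMap (f := π ≫ p) hV
    (D.restrictScalars ℤ) (fun c => D.map_algebraMap c)
  refine ⟨V, e.trans (π.preimage_mono hW), E, hxV, ?_⟩
  exact Related.of_res hW e (related_of_affine hW' e fun c => by
    rw [hE]
    exact hD c)

/-- Affine opens mapping onto an affine open of the base under a flat morphism. -/
theorem faithfullyFlat_pull [Flat π] {W : S.Opens} (hW : IsAffineOpen W) (hV : IsAffineOpen V)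
    (e : V ≤ π ⁻¹ᵁ W) (hsurj : ∀ s ∈ W, ∃ x ∈ V, π x = s) :
    letI := (pull π e).toAlgebra
    Module.FaithfullyFlat Γ(S, W) Γ(X, V) := by
  let := (pull π e).toAlgebra
  have : Module.Flat Γ(S, W) Γ(X, V) := π.flat_appLE hW hV e
  refine Module.FaithfullyFlat.of_comap_surjective fun P => ?_
  obtain ⟨x, hx, hs⟩ := hsurj (hW.fromSpec P) (by
    have : hW.fromSpec P ∈ Set.range hW.fromSpec := ⟨P, rfl⟩
    rwa [hW.range_fromSpec] at this)
  obtain ⟨Q, rfl⟩ : x ∈ Set.range hV.fromSpec := by rwa [hV.range_fromSpec]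
  refine ⟨Q, hW.fromSpec.isOpenEmbedding.injective ?_⟩
  rw [← hs]
  have := IsAffineOpen.SpecMap_appLE_fromSpec π hW hV e
  exact congr($this Q)

theorem isAffineOpen_inf_preimage_basicOpen {W : S.Opens} (hV : IsAffineOpen V)
    (e : V ≤ π ⁻¹ᵁ W) (f : Γ(S, W)) : IsAffineOpen (V ⊓ π ⁻¹ᵁ S.basicOpen f) := by
  have h : X.basicOpen (pull π e f) = V ⊓ π ⁻¹ᵁ S.basicOpen f := Scheme.basicOpen_appLE ..
  exact h ▸ hV.basicOpen _

/-- Around every point of `X` there are an affine open `V` and coordinates on an affine open `W` of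
the base, which is integral, such that the differentials of the coordinates form a basis. -/
theorem exists_frame (π : X ⟶ S) (p : S ⟶ Spec (CommRingCat.of ℂ)) [Smooth π] [Smooth (π ≫ p)]
    [LocallyOfFiniteType p] [IsIntegral X] (x : X) : ∃ (n : ℕ) (V : X.Opens) (Fr : Frame π p n V),
      x ∈ V ∧ IsAffineOpen Fr.W ∧ IsDomain Γ(S, Fr.W) ∧
      letI := (constMap p Fr.W).toAlgebra
      Nonempty (Module.Basis (Fin n) Γ(S, Fr.W) Ω[Γ(S, Fr.W)⁄ℂ]) := by
  obtain ⟨W0, V0, -, hW0, hV0, e0, hxV0⟩ := exists_affine_nhd (π := π) ⊤ (x := x) trivial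
  -- Shrink the base so that `V → W` is surjective.
  obtain ⟨f0, hf0, hxf0⟩ := hW0.exists_basicOpen_le (V := ⟨π '' V0, π.isOpenMap _ V0.2⟩)
    ⟨π x, x, hxV0, rfl⟩ (e0 hxV0)
  have sub : ∀ (W : S.Opens), W ≤ S.basicOpen f0 → ∀ s ∈ W, ∃ y ∈ V0 ⊓ π ⁻¹ᵁ W, π y = s := by
    intro W hW s hs
    obtain ⟨y, hy, rfl⟩ := hf0 (hW hs)
    exact ⟨y, ⟨hy, hs⟩, rfl⟩
  set W := S.basicOpen f0 with hWdef
  set V := V0 ⊓ π ⁻¹ᵁ W with hVdef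
  have hW : IsAffineOpen W := hW0.basicOpen f0
  have hV : IsAffineOpen V := isAffineOpen_inf_preimage_basicOpen hV0 e0 f0
  have e : V ≤ π ⁻¹ᵁ W := inf_le_right
  have dom : ∀ (W' : S.Opens) (V' : X.Opens) (hW' : IsAffineOpen W') (hV' : IsAffineOpen V')
      (e' : V' ≤ π ⁻¹ᵁ W') (hx : x ∈ V') (hs : ∀ s ∈ W', ∃ y ∈ V', π y = s),
      IsDomain Γ(S, W') := by
    intro W' V' hW' hV' e' hx hs
    let := (pull π e').toAlgebra
    have := faithfullyFlat_pull hW' hV' e' hs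
    have : Nonempty V' := ⟨⟨x, hx⟩⟩
    exact (FaithfulSMul.algebraMap_injective Γ(S, W') Γ(X, V')).isDomain _
  have hxV : x ∈ V := ⟨hxV0, hxf0⟩
  let := (constMap p W).toAlgebra
  let := (constMap (π ≫ p) V).toAlgebra
  let := (pull π e).toAlgebra
  have : IsScalarTower ℂ Γ(S, W) Γ(X, V) :=
    .of_algebraMap_eq fun c => (pull_constMap e c).symm
  have : Algebra.Smooth Γ(S, W) Γ(X, V) := π.smooth_appLE hW hV e
  have : Algebra.Smooth ℂ Γ(X, V) := smooth_constMap hV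
  have : Algebra.FiniteType ℂ Γ(S, W) := finiteType_constMap hW
  have : Module.FaithfullyFlat Γ(S, W) Γ(X, V) := faithfullyFlat_pull hW hV e (sub W le_rfl)
  have : Module.Flat Γ(S, W) Ω[Γ(S, W)⁄ℂ] := flat_kaehlerDifferential (A := Γ(X, V))
  have : IsDomain Γ(S, W) := dom W V hW hV e hxV (sub W le_rfl)
  obtain ⟨n, t, f, hf, H⟩ := exists_basis_kaehlerDifferential (k := ℂ)
    (hW.primeIdealOf ⟨π x, hxf0⟩).asIdeal
  let W1 := S.basicOpen f
  have hxW1 : π x ∈ W1 := by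
    have h1 : hW.primeIdealOf ⟨π x, hxf0⟩ ∈ hW.fromSpec ⁻¹ᵁ S.basicOpen f := by
      rw [hW.fromSpec_preimage_basicOpen]
      exact hf
    have h2 : hW.fromSpec (hW.primeIdealOf ⟨π x, hxf0⟩) ∈ S.basicOpen f := h1
    rwa [hW.fromSpec_primeIdealOf] at h2
  have hW1 : IsAffineOpen W1 := hW.basicOpen f
  let V1 := V0 ⊓ π ⁻¹ᵁ W1
  have leW : W1 ≤ W := S.basicOpen_le f
  have hV1 : IsAffineOpen V1 := by
    have := isAffineOpen_inf_preimage_basicOpen hV e f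
    have e1 : V ⊓ π ⁻¹ᵁ S.basicOpen f = V1 :=
      le_antisymm (inf_le_inf_right _ inf_le_left) (le_inf (inf_le_inf_left _
        (π.preimage_mono leW)) inf_le_right)
    rwa [e1] at this
  let := (constMap p W1).toAlgebra
  let := (fres leW).toAlgebra
  have : IsScalarTower ℂ Γ(S, W) Γ(S, W1) :=
    .of_algebraMap_eq fun c => (fres_constMap leW c).symm
  have : IsLocalization.Away f Γ(S, W1) := hW.isLocalization_basicOpen f
  obtain ⟨b, hb⟩ := H Γ(S, W1)
  have e1 : V1 ≤ π ⁻¹ᵁ W1 := inf_le_right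
  have hv : ∀ i, ∃ v : tangent p W1, v.der le_rfl =
      ((b.coord i).compDer (KaehlerDifferential.D ℂ Γ(S, W1))).restrictScalars ℤ := fun i =>
    tangent.exists_der_eq_of_constMap hW1 _
      fun c => ((b.coord i).compDer (KaehlerDifferential.D ℂ Γ(S, W1))).map_algebraMap c
  choose v hv using hv
  refine ⟨n, V1,
    { W := W1
      le := e1
      t := fun i => fres leW (t i)
      v := v
      dual := ?_
      vertical := ?_
      eq_zero := ?_ }, ⟨hxV0, hxW1⟩, hW1, ?_, ⟨b⟩⟩
  · intro i j
    rw [hv]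
    change b.coord i (KaehlerDifferential.D ℂ Γ(S, W1) (algebraMap _ _ (t j))) = _
    rw [← hb, Module.Basis.coord_apply, Module.Basis.repr_self, Finsupp.single_apply]
    simp only [eq_comm]
  · intro U hU D hD
    have h0 : Related π p D (0 : tangent p W1) := related_of_affine hW1 (hU.trans e1) fun c => by
      rw [tangent.zero_der, Derivation.zero_apply, map_zero]
      refine eq_zero_of_basis_kaehlerDifferential b hb (pull π (hU.trans e1))
        ((D.der le_rfl).toLinearMap.toAddMonoidHom.comp (pull π (hU.trans e1)).toAddMonoidHom)
        ?_ ?_ hD c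
      · intro y z
        change D.der le_rfl (pull π _ (y * z)) = _
        rw [map_mul, Derivation.leibniz]
        rfl
      · intro c
        change D.der le_rfl (pull π _ (constMap p W1 c)) = 0
        rw [pull_constMap, tangent.der_constMap]
    obtain ⟨E, hE⟩ := h0.exists_incl_sub (fun V' hV' W' hW' e' c => by simp : Related π p 0 0)
      (hU.trans e1)
    exact ⟨E, by rw [hE, sub_zero]⟩
  · intro W' h w hw
    have key : ∀ c : Γ(S, W1), w.der le_rfl (fres h c) = 0 := fun c => by
      refine eq_zero_of_basis_kaehlerDifferential b hb (fres h)
        ((w.der le_rfl).toLinearMap.toAddMonoidHom.comp (fres h).toAddMonoidHom) ?_ ?_ hw c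
      · intro y z
        change w.der le_rfl (fres h (y * z)) = _
        rw [map_mul, Derivation.leibniz]
        rfl
      · intro c
        change w.der le_rfl (fres h (constMap p W1 c)) = 0
        rw [fres_constMap, tangent.der_constMap]
    refine tangent.eq_zero_of_le_affine hW1 h key
  · exact dom W1 V1 hW1 hV1 e1 ⟨hxV0, hxW1⟩ (sub W1 leW)

end Geometry

end LieAlgd

end

noncomputable section

namespace LieAlgd

/-! ### Dimension and differentials -/

section Dimension

theorem ringKrullDim_eq_of_isIntegral (R A : Type*) [CommRing R] [CommRing A] [Algebra R A]
    [Algebra.IsIntegral R A] (hinj : Function.Injective (algebraMap R A)) :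
    ringKrullDim A = ringKrullDim R := by
  refine le_antisymm (Order.krullDim_le_of_strictMono (PrimeSpectrum.comap (algebraMap R A))
    fun I J h => Ideal.IsIntegral.comap_lt_comap h) ?_
  refine iSup_le fun l => ?_
  have : FaithfulSMul R A := (faithfulSMul_iff_algebraMap_injective R A).mpr hinj
  obtain ⟨P, hP, hlo⟩ := (inferInstance : Nonempty (l.head.asIdeal.primesOver A))
  obtain ⟨L, hL, -⟩ := Ideal.exists_ltSeries_of_hasGoingUp l P
  rw [← hL]
  exact Order.LTSeries.length_le_krullDim L

variable {k R K : Type} [Field k] [CommRing R] [Algebra k R]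
  [Field K] [Algebra R K] [Algebra k K] [IsScalarTower k R K] [IsFractionRing R K]

include R in
theorem finrank_kaehlerDifferential_of_basis [Nontrivial R] {n : ℕ}
    (b : Module.Basis (Fin n) R Ω[R⁄k]) : Module.finrank K Ω[K⁄k] = n := by
  have : Algebra.FormallyEtale R K := Algebra.FormallyEtale.of_isLocalization (nonZeroDivisors R)
  have e := KaehlerDifferential.tensorKaehlerEquivOfFormallyEtale k R K
  rw [← e.finrank_eq, Module.finrank_eq_card_basis (b.baseChange K), Fintype.card_fin]

/-- The dimension of a domain of finite type over a field of characteristic zero is the dimension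
of the space of differentials of its field of fractions: by Noether normalization this reduces to
polynomial rings. -/
theorem ringKrullDim_eq_finrank [CharZero k] [IsDomain R] [Algebra.FiniteType k R] :
    ringKrullDim R = (Module.finrank K Ω[K⁄k] : ℕ) := by
  obtain ⟨s, g, hg, hint⟩ := exists_integral_inj_algHom_of_fg k R
  let M := MvPolynomial (Fin s) k
  let L := FractionRing M
  let : Algebra M R := g.toRingHom.toAlgebra
  have : Algebra.IsIntegral M R := ⟨hint⟩
  have : IsScalarTower k M R := .of_algebraMap_eq fun c => (g.commutes c).symm
  rw [ringKrullDim_eq_of_isIntegral M R hg, MvPolynomial.ringKrullDim_of_isNoetherianRing,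
    ringKrullDim_eq_zero_of_field, zero_add, Nat.card_fin]
  let : Algebra M K := ((algebraMap R K).comp (algebraMap M R)).toAlgebra
  have : IsScalarTower M R K := .of_algebraMap_eq fun _ => rfl
  have : IsScalarTower k M K := .of_algebraMap_eq fun c => by
    rw [IsScalarTower.algebraMap_apply M R K, ← IsScalarTower.algebraMap_apply k M R,
      ← IsScalarTower.algebraMap_apply k R K]
  have hMK : Function.Injective (algebraMap M K) := (IsFractionRing.injective R K).comp hg
  have : FaithfulSMul M K := (faithfulSMul_iff_algebraMap_injective M K).mpr hMK
  let : Algebra L K := FractionRing.liftAlgebra M K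
  have : IsScalarTower M L K := FractionRing.isScalarTower_liftAlgebra M K
  have : Algebra.IsAlgebraic M R := Algebra.IsIntegral.isAlgebraic
  have : Algebra.IsAlgebraic M K := (IsFractionRing.isAlgebraic_iff' M R K).mp inferInstance
  have : Algebra.IsAlgebraic L K := (IsFractionRing.comap_isAlgebraic_iff (A := M)).mp inferInstance
  have : CharZero L := charZero_of_injective_algebraMap (algebraMap k L).injective
  have : Algebra.FormallyEtale L K := Algebra.FormallyEtale.of_isSeparable L K
  have : Algebra.FormallyEtale M L :=
    Algebra.FormallyEtale.of_isLocalization (nonZeroDivisors M)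
  have : Algebra.FormallyEtale M K := Algebra.FormallyEtale.comp M L K
  have e := KaehlerDifferential.tensorKaehlerEquivOfFormallyEtale k M K
  rw [← e.finrank_eq, Module.finrank_eq_card_basis
    ((KaehlerDifferential.mvPolynomialBasis k (Fin s)).baseChange K), Fintype.card_fin]

/-- The same formula for a ring `R` with a unique minimal prime `P`, whose local ring `K` at `P` is a
field. -/
theorem ringKrullDim_eq_finrank_of_isLocalization {k R K : Type} [Field k] [CharZero k] [CommRing R]
    [Algebra k R] [Algebra.FiniteType k R] [Field K] [Algebra R K] [Algebra k K]
    [IsScalarTower k R K] (P : Ideal R) [P.IsPrime] [IsLocalization.AtPrime K P]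
    (hP : ∀ Q : PrimeSpectrum R, P ≤ Q.asIdeal) :
    ringKrullDim R = (Module.finrank K Ω[K⁄k] : ℕ) := by
  have h0 : ∀ a : R, algebraMap R K a = 0 ↔ a ∈ P := by
    intro a
    have := IsLocalization.AtPrime.isUnit_to_map_iff K P a
    rw [isUnit_iff_ne_zero] at this
    exact (not_iff_not.mp (this.trans Iff.rfl))
  let φ : R ⧸ P →ₐ[k] K := Ideal.Quotient.liftₐ P (IsScalarTower.toAlgHom k R K)
    fun a ha => (h0 a).mpr ha
  let := φ.toRingHom.toAlgebra
  have : IsScalarTower k (R ⧸ P) K := .of_algebraMap_eq fun c => (φ.commutes c).symm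
  have hinj : Function.Injective (algebraMap (R ⧸ P) K) := by
    rw [injective_iff_map_eq_zero]
    intro a ha
    obtain ⟨a, rfl⟩ := Ideal.Quotient.mk_surjective a
    exact Ideal.Quotient.eq_zero_iff_mem.mpr ((h0 a).mp ha)
  have : FaithfulSMul (R ⧸ P) K := (faithfulSMul_iff_algebraMap_injective _ _).mpr hinj
  have : IsFractionRing (R ⧸ P) K := IsFractionRing.of_field _ _ fun z => by
    obtain ⟨⟨a, b⟩, h⟩ := IsLocalization.surj P.primeCompl z
    refine ⟨Ideal.Quotient.mk P a, Ideal.Quotient.mk P b.1, ?_⟩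
    have hb : algebraMap R K b.1 ≠ 0 := fun h => b.2 ((h0 b.1).mp h)
    exact (eq_div_iff hb).mpr h
  rw [← ringKrullDim_eq_finrank (R := R ⧸ P), ringKrullDim_quotient]
  have : PrimeSpectrum.zeroLocus (P : Set R) = Set.univ :=
    Set.eq_univ_of_forall fun Q => hP Q
  rw [this]
  exact (Order.krullDim_eq_of_orderIso OrderIso.Set.univ).symm

end Dimension

section

variable {S : Scheme.{0}} {W : S.Opens}

/-- The germ of functions at a point. -/
def germ {x : S} (hx : x ∈ W) : Γ(S, W) →+* S.presheaf.stalk x := (S.presheaf.germ W x hx).hom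

theorem germ_fres {W' : S.Opens} (h : W' ≤ W) {x : S} (hx : x ∈ W') (g : Γ(S, W)) :
    germ hx (fres h g) = germ (h hx) g :=
  congr($(S.presheaf.germ_res (homOfLE h) x hx).hom g)

theorem topologicalKrullDim_affine (hW : IsAffineOpen W) :
    topologicalKrullDim W = ringKrullDim Γ(S, W) := by
  rw [← PrimeSpectrum.topologicalKrullDim_eq_ringKrullDim]
  exact IsHomeomorph.topologicalKrullDim_eq _ hW.isoSpec.hom.homeomorph.isHomeomorph

theorem topologicalKrullDim_le_of_affine {d : WithBot ℕ∞}
    (H : ∀ W : S.Opens, IsAffineOpen W → (W : Set S).Nonempty → ringKrullDim Γ(S, W) ≤ d) :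
    topologicalKrullDim S ≤ d := by
  rw [topologicalKrullDim, Order.krullDim_eq_of_orderIso irreducibleSetEquivPoints,
    Order.krullDim_eq_iSup_coheight]
  refine iSup_le fun x => ?_
  obtain ⟨_, ⟨W, hW, rfl⟩, hx, -⟩ := S.isBasis_affineOpens.exists_subset_of_mem_open
    (Set.mem_univ x) isOpen_univ
  refine le_trans ?_ (H W hW ⟨x, hx⟩)
  have := hW.isLocalization_stalk ⟨x, hx⟩
  let := S.presheaf.algebra_section_stalk (⟨x, hx⟩ : W)
  have h1 := IsLocalization.AtPrime.ringKrullDim_eq_height (hW.primeIdealOf ⟨x, hx⟩).asIdeal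
    (S.presheaf.stalk x)
  have h2 := ringKrullDim_stalk_eq_coheight x
  rw [h1] at h2
  rw [← show _ = ((Order.coheight x : ℕ∞) : WithBot ℕ∞) from h2]
  exact Ideal.height_le_ringKrullDim_of_ne_top Ideal.IsPrime.ne_top'

variable [IrreducibleSpace S]

theorem primeIdealOf_genericPoint_le (hW : IsAffineOpen W) (h : genericPoint S ∈ W)
    (Q : PrimeSpectrum Γ(S, W)) : hW.primeIdealOf ⟨genericPoint S, h⟩ ≤ Q := by
  have h1 : hW.fromSpec (hW.primeIdealOf ⟨genericPoint S, h⟩) ⤳ hW.fromSpec Q := by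
    rw [hW.fromSpec_primeIdealOf]
    exact genericPoint_specializes _
  exact (PrimeSpectrum.le_iff_specializes _ _).mpr
    (hW.fromSpec.isOpenEmbedding.isInducing.specializes_iff.mp h1)

/-- All affine opens of an irreducible scheme of finite type over `ℂ` have, up to nilpotents, the
same field of fractions, the local ring at the generic point if that is a field. -/
theorem topologicalKrullDim_eq_of_basis {p : S ⟶ Spec (CommRingCat.of ℂ)} [LocallyOfFiniteType p]
    (hW : IsAffineOpen W) [IsDomain Γ(S, W)] {n : ℕ}
    (b : letI := (constMap p W).toAlgebra
      Module.Basis (Fin n) Γ(S, W) Ω[Γ(S, W)⁄ℂ]) :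
    topologicalKrullDim S = n := by
  let η := genericPoint S
  have hη : ∀ W : S.Opens, (W : Set S).Nonempty → η ∈ W := fun W hne =>
    (genericPoint_spec S).mem_open_set_iff W.2 |>.mpr (by simpa using hne)
  let K := S.presheaf.stalk η
  have hne : (W : Set S).Nonempty := by
    by_contra h
    obtain rfl : W = ⊥ := by
      ext x
      exact iff_of_false (fun hx => h ⟨x, hx⟩) id
    exact not_subsingleton Γ(S, (⊥ : S.Opens)) inferInstance
  let PW := hW.primeIdealOf ⟨η, hη W hne⟩
  have hPW : PW.asIdeal = ⊥ :=
    le_bot_iff.mp (primeIdealOf_genericPoint_le hW (hη W hne) ⟨⊥, Ideal.isPrime_bot⟩)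
  have alg : ∀ (W : S.Opens) (h : η ∈ W) (hW : IsAffineOpen W), letI := (germ h).toAlgebra
      IsLocalization.AtPrime K (hW.primeIdealOf ⟨η, h⟩).asIdeal :=
    fun W h hW => hW.isLocalization_stalk ⟨η, h⟩
  let := (constMap p W).toAlgebra
  let := (germ (hη W hne)).toAlgebra
  have hfrac : IsFractionRing Γ(S, W) K := by
    have h1 : PW.asIdeal.primeCompl = nonZeroDivisors Γ(S, W) := by
      ext a
      rw [mem_nonZeroDivisors_iff_ne_zero]
      change a ∉ PW.asIdeal ↔ _
      rw [hPW, Ideal.mem_bot]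
    have h2 : IsLocalization PW.asIdeal.primeCompl K := alg W (hη W hne) hW
    rw [h1] at h2
    exact h2
  let : Field K := IsFractionRing.toField Γ(S, W)
  let : Algebra ℂ K := ((germ (W := ⊤) (x := η) trivial).comp (constMap p ⊤)).toAlgebra
  have tower : ∀ (W : S.Opens) (h : η ∈ W), letI := (constMap p W).toAlgebra
      letI := (germ h).toAlgebra
      IsScalarTower ℂ Γ(S, W) K := by
    intro W h
    refine @IsScalarTower.of_algebraMap_eq ℂ Γ(S, W) K _ _ _ (_) (_) (_) fun c => ?_
    change germ _ (constMap p ⊤ c) = germ h (constMap p W c)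
    rw [← fres_constMap (le_top : W ≤ ⊤), germ_fres]
  have hdim : ∀ W' : S.Opens, IsAffineOpen W' → (W' : Set S).Nonempty →
      ringKrullDim Γ(S, W') = (Module.finrank K Ω[K⁄ℂ] : ℕ) := by
    intro W' hW' hne'
    let := (constMap p W').toAlgebra
    let := (germ (hη W' hne')).toAlgebra
    have := tower W' (hη W' hne')
    have : Algebra.FiniteType ℂ Γ(S, W') := finiteType_constMap hW'
    have := alg W' (hη W' hne') hW'
    exact ringKrullDim_eq_finrank_of_isLocalization (hW'.primeIdealOf ⟨η, hη W' hne'⟩).asIdeal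
      fun Q => primeIdealOf_genericPoint_le hW' (hη W' hne') Q
  have := tower W (hη W hne)
  rw [finrank_kaehlerDifferential_of_basis (K := K) b] at hdim
  refine le_antisymm (topologicalKrullDim_le_of_affine fun W' hW' hne' => (hdim W' hW' hne').le) ?_
  rw [← hdim W hW hne, ← topologicalKrullDim_affine hW]
  exact topologicalKrullDim_subspace_le S W

/-- The points of `X` have neighbourhoods with `dim S` coordinates on the base. -/
theorem exists_hasFrames {X S : Scheme.{0}} (π : X ⟶ S) (p : S ⟶ Spec (CommRingCat.of ℂ))
    [Smooth π] [Smooth (π ≫ p)] [LocallyOfFiniteType p] [IsIntegral X] [IrreducibleSpace S] :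
    ∃ n : ℕ, HasFrames π p n ∧ topologicalKrullDim S = n := by
  have key : ∀ x : X, ∃ (n : ℕ) (V : X.Opens) (_ : Frame π p n V),
      x ∈ V ∧ topologicalKrullDim S = n := by
    intro x
    obtain ⟨n, V, Fr, hxV, hW, hd, ⟨b⟩⟩ := exists_frame π p x
    exact ⟨n, V, Fr, hxV, topologicalKrullDim_eq_of_basis hW b⟩
  obtain ⟨x0⟩ := (inferInstance : Nonempty X)
  obtain ⟨n, -, -, -, hn⟩ := key x0
  refine ⟨n, fun x => ?_, hn⟩
  obtain ⟨m, V, Fr, hxV, hm⟩ := key x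
  obtain rfl : n = m := by exact_mod_cast hn.symm.trans hm
  exact ⟨V, hxV, ⟨Fr⟩⟩

end

end LieAlgd

end

noncomputable section

namespace LieAlgd

variable {X : Scheme.{0}} {M : X.Modules} {U V : X.Opens}

/-! ### Quasi-coherent modules on affine opens -/

/-- The restriction of `M` to `U` behaves, on distinguished opens `D(f)`, like localization at
`f`. -/
def LocalizesOn (M : X.Modules) (U : X.Opens) : Prop :=
  ∀ f : Γ(X, U),
    (∀ s : Γ(M, U), mres M (X.basicOpen_le f) s = 0 → ∃ n : ℕ, f ^ n • s = 0) ∧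
    (∀ t : Γ(M, X.basicOpen f), ∃ (n : ℕ) (s : Γ(M, U)),
      mres M (X.basicOpen_le f) s = fres (X.basicOpen_le f) f ^ n • t)

theorem smul_restrict_fromSpec (hU : IsAffineOpen U) (V : (Spec Γ(X, U)).Opens)
    (h : hU.fromSpec ''ᵁ V ≤ U) (r : Γ(X, U)) (x : Γ(M.restrict hU.fromSpec, V)) :
    (M.restrictAppIso hU.fromSpec V).hom (r • x) =
      fres h r • (M.restrictAppIso hU.fromSpec V).hom x := by
  rw [Scheme.Modules.smul_Spec_def]
  refine (Scheme.Modules.smul_restrictAppIso_hom_apply _ _ _ _ _).trans ?_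
  congr 1
  have key : (Scheme.ΓSpecIso Γ(X, U)).inv ≫ (Spec Γ(X, U)).presheaf.map V.leTop.op =
      X.presheaf.map (homOfLE h).op ≫ (hU.fromSpec.appIso V).hom := by
    rw [Scheme.Hom.appIso_hom', Scheme.Hom.map_appLE, Scheme.Hom.appLE, hU.fromSpec_app_self,
      Category.assoc, ← Functor.map_comp]
    rfl
  have := congr($(key) ≫ (hU.fromSpec.appIso V).inv)
  rw [Category.assoc, Category.assoc, Iso.hom_inv_id, Category.comp_id] at this
  exact congr($(this).hom r)

/-- `LocalizesOn` may be stated with open subsets equal to `U` and `D(f)`. -/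
theorem localizesOn_iff_of_eq {A B : X.Opens} (f : Γ(X, U)) (hA : A = U) (hB : B = X.basicOpen f)
    (hAU : A ≤ U) (hBU : B ≤ U) (hBA : B ≤ A) :
    ((∀ s : Γ(M, A), mres M hBA s = 0 → ∃ n : ℕ, fres hAU (f ^ n) • s = 0) ∧
      (∀ t : Γ(M, B), ∃ (n : ℕ) (s : Γ(M, A)), mres M hBA s = fres hBU (f ^ n) • t)) ↔
    ((∀ s : Γ(M, U), mres M (X.basicOpen_le f) s = 0 → ∃ n : ℕ, f ^ n • s = 0) ∧
      (∀ t : Γ(M, X.basicOpen f), ∃ (n : ℕ) (s : Γ(M, U)),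
        mres M (X.basicOpen_le f) s = fres (X.basicOpen_le f) f ^ n • t)) := by
  subst hA hB
  simp only [fres_self, map_pow]

/-- `LocalizesOn` is Mathlib's condition `IsLocalizing` for the corresponding sheaf on the spectrum
of `Γ(X, U)`. -/
theorem isLocalizing_restrict_fromSpec_iff (hU : IsAffineOpen U) :
    IsLocalizing (modulesSpecToSheaf.obj (M.restrict hU.fromSpec)) ↔ LocalizesOn M U := by
  have hle : ∀ V, hU.fromSpec ''ᵁ V ≤ U := fun V => by
    conv_rhs => rw [← hU.opensRange_fromSpec]
    exact Scheme.Hom.image_le_opensRange _ _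
  refine forall_congr' fun f => ?_
  rw [← localizesOn_iff_of_eq (A := hU.fromSpec ''ᵁ ⊤) (B := hU.fromSpec ''ᵁ PrimeSpectrum.basicOpen f) f
    (by rw [Scheme.Hom.image_top_eq_opensRange, hU.opensRange_fromSpec])
    (hU.fromSpec_image_basicOpen f) (hle _) (hle _)
    ((hU.fromSpec.opensFunctor.map (homOfLE le_top)).le)]
  constructor
  · intro h
    constructor
    · intro s hs
      have h' : IsLocalizedModule.Away f _ := h
      obtain ⟨⟨_, n, rfl⟩, hn⟩ := (@IsLocalizedModule.eq_zero_iff _ _ (.powers f) _ _ _ _ _ _ _ h' s).mp hs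
      exact ⟨n, (smul_restrict_fromSpec hU ⊤ (hle _) (f ^ n) s).symm.trans hn⟩
    · intro t
      have h' : IsLocalizedModule.Away f _ := h
      obtain ⟨n, s, hn⟩ := h'.surj _ _ t
      exact ⟨n, s, hn.symm.trans (smul_restrict_fromSpec hU _ (hle _) (f ^ n) t)⟩
  · rintro ⟨h1, h2⟩
    refine IsLocalizedModule.Away.mk_of_addCommGroup ?_ ?_ ?_
    · exact Scheme.Modules.isUnit_algebraMap_end_of_le_basicOpen f le_rfl
    · intro t
      obtain ⟨n, s, hs⟩ := h2 t
      exact ⟨n, s, (smul_restrict_fromSpec hU _ (hle _) (f ^ n) t).trans hs.symm⟩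
    · intro s hs
      obtain ⟨n, hn⟩ := h1 s hs
      exact ⟨n, (smul_restrict_fromSpec hU ⊤ (hle _) (f ^ n) s).trans hn⟩

theorem localizesOn_of_isQuasicoherent (hM : SheafOfModules.IsQuasicoherent M)
    (hU : IsAffineOpen U) : LocalizesOn M U := by
  rw [← isLocalizing_restrict_fromSpec_iff hU, ← isIso_fromTildeΓ_iff_isLocalizing]
  have : M.IsQuasicoherent := hM
  infer_instance

/-- Transport of a presentation along an isomorphism. -/
def presentationOfIso {M N : X.Modules} (e : M ≅ N) (P : SheafOfModules.Presentation M) :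
    SheafOfModules.Presentation N :=
  @SheafOfModules.Presentation.ofIsIso _ _ _ _ _ _ M N e.hom
    ⟨e.inv, e.hom_inv_id, e.inv_hom_id⟩ P

/-- A module which is localizing on an affine open `U` has a presentation over `U`. -/
theorem nonempty_presentation_over (hU : IsAffineOpen U) (h : LocalizesOn M U) :
    Nonempty (SheafOfModules.Presentation (SheafOfModules.over M U)) := by
  rw [← isLocalizing_restrict_fromSpec_iff hU, ← isIso_fromTildeΓ_iff_isLocalizing] at h
  let N := M.restrict hU.fromSpec
  have hN : IsIso N.fromTildeΓ := h
  let pres : SheafOfModules.Presentation N := presentationOfIso (asIso N.fromTildeΓ)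
    (presentationTilde _ .univ (by simp) _ (Submodule.span_eq _))
  let e : N.restrict hU.isoSpec.hom ≅ M.restrict U.ι :=
    (Scheme.Modules.restrictFunctorComp hU.isoSpec.hom hU.fromSpec).symm.app M ≪≫
      (Scheme.Modules.restrictFunctorCongr hU.isoSpec_hom_fromSpec).app M
  let e' := (Scheme.Modules.overFunctorEquiv U).app M
  let pres' := presentationOfIso (e ≪≫ e'.symm)
    (Scheme.Modules.presentationRestrict hU.isoSpec.hom pres)
  let η : SheafOfModules.unit (X.ringCatSheaf.over U) ≅
      (SheafOfModules.overFunctor X.ringCatSheaf U).obj (SheafOfModules.unit _) := Iso.refl _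
  let unitIso := (Scheme.Modules.overEquiv U).unitIso.app _ ≪≫
    (Scheme.Modules.overEquiv U).inverse.mapIso
      ((Scheme.Modules.overEquiv U).functor.mapIso η ≪≫
        (Scheme.Modules.overFunctorEquiv U).app _ ≪≫ Scheme.Modules.restrictUnitIso U.ι)
  have h1 : Limits.PreservesColimitsOfSize.{0, 0} (Scheme.Modules.overEquiv U).inverse :=
    inferInstance
  let G : SheafOfModules.{0} (U : Scheme.{0}).ringCatSheaf ⥤
    SheafOfModules.{0} (X.ringCatSheaf.over U) := (Scheme.Modules.overEquiv U).inverse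
  have h2 : Limits.PreservesColimitsOfSize.{0, 0} G := h1
  let pres'' := SheafOfModules.Presentation.map (M := (Scheme.Modules.overEquiv U).functor.obj
    (SheafOfModules.over M U)) pres' G unitIso
  have h3 : IsIso ((Scheme.Modules.overEquiv U).unitIso.inv.app (SheafOfModules.over M U)) :=
    inferInstance
  exact ⟨SheafOfModules.Presentation.ofIsIso.{0, 0, 0}
    ((Scheme.Modules.overEquiv U).unitIso.inv.app (SheafOfModules.over M U)) pres''⟩

/-- Quasi-coherence can be checked on affine opens around each point. -/
theorem isQuasicoherent_of_localizesOn
    (h : ∀ x : X, ∃ U : X.Opens, x ∈ U ∧ IsAffineOpen U ∧ LocalizesOn M U) :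
    SheafOfModules.IsQuasicoherent M := by
  choose U hxU hU hM using h
  refine ⟨⟨{
    I := X
    X := U
    coversTop := (Opens.coversTop_iff _ _).mpr ?_
    presentation := fun x => (nonempty_presentation_over (hU x) (hM x)).some }⟩⟩
  exact top_le_iff.mp fun x _ => Opens.mem_iSup.mpr ⟨x, hxU x⟩

section TorsionFree

variable {Y : Scheme.{0}} {f : X ⟶ Y}

/-- On an integral scheme, sections of a reflexive sheaf are determined by their restriction to
any non-empty open subset. -/
theorem LieAlgebroid.mres_injective [IsIntegral X] (A : LieAlgebroid f) (h : V ≤ U)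
    (hV : (V : Set X).Nonempty) : Function.Injective (mres A.sheaf h) := by
  rw [injective_iff_map_eq_zero]
  intro s hs
  refine mres_eq_of_locally _ _ _ fun x hx => ?_
  obtain ⟨_, ⟨W, hW, rfl⟩, hxW, hWU⟩ :=
    X.isBasis_affineOpens.exists_subset_of_mem_open hx U.2
  replace hWU : W ≤ U := hWU
  have hne : ((V ⊓ W : X.Opens) : Set X).Nonempty :=
    nonempty_preirreducible_inter V.2 W.2 hV ⟨x, hxW⟩
  obtain ⟨y, hy⟩ := hne
  obtain ⟨g, hg, hyg⟩ := exists_basicOpen_le hW (inf_le_right : V ⊓ W ≤ W) hy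
  have : Nonempty W := ⟨⟨x, hxW⟩⟩
  refine ⟨W, hWU, hxW, ?_⟩
  rw [map_zero]
  have h0 : mres A.sheaf (X.basicOpen_le g) (mres A.sheaf hWU s) = 0 := by
    have := congrArg (mres A.sheaf (hg.trans inf_le_left)) hs
    rw [mres_mres, map_zero] at this
    rw [mres_mres]
    exact this
  obtain ⟨n, hn⟩ := (localizesOn_of_isQuasicoherent A.quasicoherent hW g).1 _ h0
  have hg0 : g ≠ 0 := by
    rintro rfl
    rw [Scheme.basicOpen_zero] at hyg
    exact hyg
  have := A.reflexive W hW
  have : Module.IsTorsionFree Γ(X, W) Γ(A.sheaf, W) := inferInstance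
  exact (smul_eq_zero.mp hn).resolve_left (pow_ne_zero n hg0)

end TorsionFree

end LieAlgd

end

noncomputable section

namespace LieAlgd

variable {X Y S : Scheme.{0}} {π : X ⟶ S} {F : Family π} {p : S ⟶ Y} {U V : X.Opens} {n : ℕ}

/-! ### Lifts along a flat section -/

theorem LieAlgebroid.eq_zero_of_smul_eq_zero [IsIntegral X] {f : X ⟶ Y} (A : LieAlgebroid f)
    {g : Γ(X, U)} {s : Γ(A.sheaf, U)} (h : g • s = 0) : g = 0 ∨ s = 0 := by
  by_cases hU : (U : Set X).Nonempty
  · obtain ⟨x, hx⟩ := hU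
    obtain ⟨W, hW, hxW, hWU⟩ := Opens.isBasis_iff_nbhd.mp X.isBasis_affineOpens hx
    have : Nonempty W := ⟨⟨x, hxW⟩⟩
    have := A.reflexive W hW
    have h0 := congrArg (mres A.sheaf hWU) h
    rw [mres_smul, map_zero] at h0
    refine (smul_eq_zero.mp h0).imp (fun h => ?_) fun h => ?_
    · exact (map_eq_zero_iff _ (fres_injective hWU ⟨x, hxW⟩)).mp h
    · exact (map_eq_zero_iff _ (A.mres_injective hWU ⟨x, hxW⟩)).mp h
  · exact .inl (fres_eq_of_locally _ _ fun x hx => (hU ⟨x, hx⟩).elim)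

/-- Operators which are derivations of the bracket are compatible with the anchor:
`[σ(P), a(s)] = a(P s)`. -/
theorem BasicOp.symbol_lie_anchor [IsIntegral X] (P : BasicOp F p U) (s : Γ(F.sheaf, U)) :
    ⁅P.symbol, tangent.incl π p U (F.anchor U s)⁆ =
      tangent.incl π p U (F.anchor U (P.act le_rfl s)) := by
  refine tangent.ext fun V hV g => ?_
  have key : (⁅P.symbol, tangent.incl π p U (F.anchor U s)⁆.der hV g -
      (tangent.incl π p U (F.anchor U (P.act le_rfl s))).der hV g) • mres F.sheaf hV s = 0 := by
    have h := P.act_bracket hV (mres F.sheaf hV s) (g • mres F.sheaf hV s)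
    have h' := P.act_bracket hV (mres F.sheaf hV s) (mres F.sheaf hV s)
    simp only [act_smul, LieAlgebroid.bracket_smul_right, map_add, h'] at h
    rw [← P.mres_act le_rfl, F.anchor_res, F.anchor_res] at h
    simp only [tangent.res_der] at h
    rw [tangent.lie_der, Derivation.commutator_apply, sub_smul, sub_smul]
    rw [smul_add, ← sub_eq_zero] at h
    rw [← h]
    simp only [tangent.incl_der]
    abel
  rcases F.eq_zero_of_smul_eq_zero key with h | h
  · exact sub_eq_zero.mp h
  · have e1 : tangent.res hV (F.anchor U s) = 0 := by rw [← F.anchor_res, h, map_zero]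
    have e2 : tangent.res hV (F.anchor U (P.act le_rfl s)) = 0 := by
      rw [← F.anchor_res, P.mres_act, h, map_zero, map_zero]
    rw [tangent.lie_der, Derivation.commutator_apply]
    have e3 : ∀ g, (F.anchor U s).der hV g = 0 := fun g => congr($(e1).der le_rfl g)
    have e4 : ∀ g, (F.anchor U (P.act le_rfl s)).der hV g = 0 := fun g => congr($(e2).der le_rfl g)
    simp [e3, e4]

theorem BasicOp.symbol_sum (Q : Fin n → BasicOp F p U) :
    (∑ i, Q i).symbol = ∑ i, (Q i).symbol :=
  map_sum (AddMonoidHom.mk' (symbol (F := F) (p := p) (U := U)) symbol_add) Q Finset.univ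

theorem BasicOp.act_sum (Q : Fin n → BasicOp F p U) (h : V ≤ U) (s : Γ(F.sheaf, V)) :
    (∑ i, Q i).act h s = ∑ i, (Q i).act h s :=
  map_sum (AddMonoidHom.mk' (fun P : BasicOp F p U => P.act h s) fun P Q => act_add P Q h s) Q
    Finset.univ

/-- Operators over `U` whose class is the value of `υ` at some vector field of `S`. -/
def FlatSection.IsLift (υ : FlatSection F p) (P : BasicOp F p U) : Prop :=
  ∃ (W : S.Opens) (e : U ≤ π ⁻¹ᵁ W) (v : tangent p W), υ.val e v = uClass P

namespace FlatSection

variable {υ : FlatSection F p} {P Q : BasicOp F p U}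

theorem val_zero (υ : FlatSection F p) {W : S.Opens} (e : U ≤ π ⁻¹ᵁ W) :
    υ.val e (0 : tangent p W) = 0 := by
  have := υ.val_add e 0 0
  rw [add_zero] at this
  exact left_eq_add.mp this

theorem uClass_zero : uClass (0 : BasicOp F p U) = 0 := by
  have := uClass_add (0 : BasicOp F p U) 0
  rw [add_zero] at this
  exact left_eq_add.mp this

theorem val_sum {W : S.Opens} (e : U ≤ π ⁻¹ᵁ W) {w : Fin n → tangent p W}
    {Q : Fin n → BasicOp F p U} (h : ∀ i, υ.val e (w i) = uClass (Q i)) :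
    υ.val e (∑ i, w i) = uClass (∑ i, Q i) := by
  have h1 := map_sum (AddMonoidHom.mk' (υ.val e) (υ.val_add e)) w Finset.univ
  have h2 := map_sum (AddMonoidHom.mk' (uClass (F := F) (p := p) (U := U)) uClass_add) Q
    Finset.univ
  exact h1.trans ((Finset.sum_congr rfl fun i _ => h i).trans h2.symm)

/-- Two lifts are lifts of vector fields on a common open subset of the base. -/
theorem IsLift.exists_common (hP : υ.IsLift P) (hQ : υ.IsLift Q) :
    ∃ (W : S.Opens) (e : U ≤ π ⁻¹ᵁ W) (v w : tangent p W), υ.val e v = uClass P ∧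
      υ.val e w = uClass Q := by
  obtain ⟨W, e, v, hv⟩ := hP
  obtain ⟨W', e', w, hw⟩ := hQ
  have e'' : U ≤ π ⁻¹ᵁ (W ⊓ W') := fun x hx => ⟨e hx, e' hx⟩
  refine ⟨W ⊓ W', e'', tangent.res inf_le_left v,
    tangent.res inf_le_right w, ?_, ?_⟩
  · rw [υ.val_res, hv]
  · rw [υ.val_res, hw]

theorem IsLift.res (hP : υ.IsLift P) (h : V ≤ U) : υ.IsLift (BasicOp.res h P) := by
  obtain ⟨W, e, v, hv⟩ := hP
  exact ⟨W, h.trans e, v, by rw [← ures_uClass, ← hv, ures_val]⟩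

theorem IsLift.lie (hP : υ.IsLift P) (hQ : υ.IsLift Q) : υ.IsLift ⁅P, Q⁆ := by
  obtain ⟨W, e, v, w, hv, hw⟩ := hP.exists_common hQ
  exact ⟨W, e, ⁅v, w⁆, υ.lie e v w P Q hv hw⟩

theorem isLift_ad (υ : FlatSection F p) (s : Γ(F.sheaf, U)) : υ.IsLift (BasicOp.ad F p U s) := by
  have e : U ≤ π ⁻¹ᵁ ⊤ := fun _ _ => trivial
  refine ⟨⊤, e, 0, ?_⟩
  rw [val_zero, ← zero_add (BasicOp.ad F p U s), uClass_ad, uClass_zero]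

end FlatSection

/-- Coordinates on the base together with lifts of the coordinate vector fields along a flat
section. The lifts commute up to inner operators. -/
structure LiftedFrame (υ : FlatSection F p) (n : ℕ) (V : X.Opens) extends Frame π p n V where
  /-- the lifts of the coordinate vector fields -/
  P : Fin n → BasicOp F p V
  val_v : ∀ i, υ.val le (v i) = uClass (P i)
  /-- the curvature: the sections representing the commutators of the lifts -/
  r : Fin n → Fin n → Γ(F.sheaf, V)
  lie_P : ∀ i j, ⁅P i, P j⁆ = BasicOp.ad F p V (r i j)

theorem Frame.lie_v (Fr : Frame π p n V) (i j : Fin n) : ⁅Fr.v i, Fr.v j⁆ = 0 := by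
  refine Fr.eq_zero Fr.W le_rfl _ fun k => ?_
  rw [fres_self, tangent.lie_der, Derivation.commutator_apply, Fr.dual, Fr.dual]
  split_ifs <;> simp

/-- Around every point there is a frame with lifts. The commutator of two lifts represents
`υ [v_i, v_j] = 0`, so it is inner. -/
theorem FlatSection.exists_liftedFrame (υ : FlatSection F p)
    (hinj : ∀ U : X.Opens, Function.Injective (BasicOp.ad F p U)) (hF : HasFrames π p n) (x : X) :
    ∃ V : X.Opens, x ∈ V ∧ Nonempty (LiftedFrame υ n V) := by
  obtain ⟨V, hxV, ⟨Fr⟩⟩ := hF x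
  obtain ⟨V', hxV', h⟩ := exists_common_nhd (x := x) (fun (i : Fin n) V' =>
    ∃ (h : V' ≤ V) (P : BasicOp F p V'), υ.val (h.trans Fr.le) (Fr.v i) = uClass P) (by
    rintro i V1 V2 h ⟨h1, P, hP⟩
    exact ⟨h.trans h1, BasicOp.res h P, by rw [← ures_uClass, ← hP, ures_val]⟩) (fun i => by
    obtain ⟨V1, hV1, P, hxV1, hP⟩ := exists_local_uClass (υ.val Fr.le (Fr.v i)) x hxV
    exact ⟨V1, hxV1, hV1, P, by rw [← hP, ures_val]⟩)
  choose h P hP using h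
  have hle : V ⊓ V' ≤ V := inf_le_left
  have hP' : ∀ i, υ.val (hle.trans Fr.le) (Fr.v i) =
      uClass (BasicOp.res (inf_le_right : V ⊓ V' ≤ V') (P i)) := fun i => by
    rw [← ures_uClass, ← hP, ures_val]
  have hr : ∀ i j, ∃ s, ⁅BasicOp.res (inf_le_right : V ⊓ V' ≤ V') (P i),
      BasicOp.res (inf_le_right : V ⊓ V' ≤ V') (P j)⁆ = 0 + BasicOp.ad F p (V ⊓ V') s := by
    intro i j
    refine exists_eq_add_ad hinj ?_
    have := υ.lie (hle.trans Fr.le) (Fr.v i) (Fr.v j) _ _ (hP' i) (hP' j)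
    rw [Fr.lie_v] at this
    rw [FlatSection.uClass_zero, ← this]
    exact υ.val_zero _
  choose r hr using hr
  exact ⟨V ⊓ V', ⟨hxV, hxV'⟩, ⟨{ Fr.res hle with
    P := fun i => BasicOp.res inf_le_right (P i)
    val_v := hP'
    r := r
    lie_P := fun i j => (hr i j).trans (zero_add _) }⟩⟩

namespace LiftedFrame

variable {υ : FlatSection F p} (C : LiftedFrame υ n V)

/-- Restriction to a smaller open subset. -/
def res {V' : X.Opens} (h : V' ≤ V) : LiftedFrame υ n V' :=
  { C.toFrame.res h with
    P := fun i => BasicOp.res h (C.P i)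
    val_v := fun i => by
      rw [← ures_uClass, ← C.val_v, υ.ures_val]
      rfl
    r := fun i j => mres F.sheaf h (C.r i j)
    lie_P := fun i j => by rw [← BasicOp.res_lie, C.lie_P, BasicOp.res_ad] }

theorem related (i : Fin n) : Related π p (C.P i).symbol (C.v i) :=
  υ.symbol C.le (C.v i) _ (C.val_v i)

theorem related_res (h : U ≤ V) (i : Fin n) :
    Related π p (BasicOp.res h (C.P i)).symbol (C.v i) := (C.related i).res_left h

/-- The operator `P` is `{s, -} + ∑ c_i P_i`, where `c_i` are the coefficients of the symbol
of `P`. -/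
def Coord (h : U ≤ V) (P : BasicOp F p U) (s : Γ(F.sheaf, U)) : Prop :=
  IsCoord F p P (fun i => BasicOp.res h (C.P i)) (C.coef h P.symbol) s

variable {C}

theorem Coord.unique (hinj : ∀ U : X.Opens, Function.Injective (BasicOp.ad F p U)) {h : U ≤ V}
    {P : BasicOp F p U} {s s' : Γ(F.sheaf, U)} (H : C.Coord h P s) (H' : C.Coord h P s') :
    s = s' := IsCoord.unique hinj H H'

theorem Coord.res {h : U ≤ V} {P : BasicOp F p U} {s : Γ(F.sheaf, U)} (H : C.Coord h P s)
    {U' : X.Opens} (h' : U' ≤ U) :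
    C.Coord (h'.trans h) (BasicOp.res h' P) (mres F.sheaf h' s) := by
  constructor
  · rw [BasicOp.symbol_res, H.1, ← H.1]
    conv_lhs => rw [H.1]
    rw [map_add, map_sum, tangent.incl_res, F.anchor_res]
    congr 1
    refine Finset.sum_congr rfl fun i _ => ?_
    rw [tangent.res_smul, C.fres_coef, H.1]
    rfl
  · intro V1 h1 r
    refine (H.2 V1 (h1.trans h') r).trans ?_
    rw [mres_mres]
    congr 1
    refine Finset.sum_congr rfl fun i _ => ?_
    congr 1
    rw [BasicOp.symbol_res, ← C.fres_coef, fres_fres]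

theorem Coord.add {h : U ≤ V} {P Q : BasicOp F p U} {s t : Γ(F.sheaf, U)} (H : C.Coord h P s)
    (K : C.Coord h Q t) : C.Coord h (P + Q) (s + t) := by
  constructor
  · rw [BasicOp.symbol_add, H.1, K.1, ← H.1, ← K.1]
    conv_lhs => rw [H.1, K.1]
    simp only [map_add, C.coef_add, add_smul, Finset.sum_add_distrib]
    abel
  · intro V1 h1 r
    rw [BasicOp.act_add, H.2, K.2]
    simp only [BasicOp.symbol_add, map_add, C.coef_add, add_smul, Finset.sum_add_distrib,
      AddMonoidHom.add_apply]
    abel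

theorem coord_ad (h : U ≤ V) (s : Γ(F.sheaf, U)) : C.Coord h (BasicOp.ad F p U s) s := by
  constructor
  · simp [BasicOp.symbol_ad, C.coef_incl]
  · intro V1 h1 r
    simp [BasicOp.symbol_ad, C.coef_incl, BasicOp.act_ad]

theorem coord_zero (h : U ≤ V) : C.Coord h (0 : BasicOp F p U) 0 := by
  simpa using C.coord_ad h (0 : Γ(F.sheaf, U))

/-- Lifts have coordinates. -/
theorem exists_coord (hinj : ∀ U : X.Opens, Function.Injective (BasicOp.ad F p U)) (h : U ≤ V)
    {P : BasicOp F p U} (hP : υ.IsLift P) : ∃ s, C.Coord h P s := by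
  obtain ⟨W, e, v, hv⟩ := hP
  have e' : U ≤ π ⁻¹ᵁ (W ⊓ C.W) := fun x hx => ⟨e hx, C.le (h hx)⟩
  let v' : tangent p (W ⊓ C.W) := tangent.res inf_le_left v
  let b : Fin n → Γ(S, W ⊓ C.W) := fun i => v'.der le_rfl (fres inf_le_right (C.t i))
  let Q : BasicOp F p U := ∑ i, BasicOp.smulBase e' (b i) (BasicOp.res h (C.P i))
  have hQ : υ.val e' v' = uClass Q := by
    rw [C.eq_sum_smul inf_le_right v']
    refine FlatSection.val_sum e' fun i => ?_
    refine υ.smul e' (b i) _ _ ?_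
    change υ.val e' _ = _
    rw [υ.val_res, ← ures_uClass, ← C.val_v, υ.ures_val]
  obtain ⟨s, hs⟩ := exists_eq_add_ad hinj (P := P) (Q := Q) (by
    rw [← hQ, ← hv, υ.val_res])
  have hσ : P.symbol = (∑ i, pull π e' (b i) • (BasicOp.res h (C.P i)).symbol) +
      tangent.incl π p U (F.anchor U s) := by
    rw [hs, BasicOp.symbol_add, BasicOp.symbol_sum, BasicOp.symbol_ad]
    rfl
  have hc : C.coef h P.symbol = fun i => pull π e' (b i) := by
    funext i
    rw [hσ, C.coef_add, C.coef_incl, add_zero, C.coef_sum_smul h (C.related_res h)]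
  refine ⟨s, ?_, fun V1 h1 r => ?_⟩
  · rw [hc, hσ, add_comm]
  · rw [hc, hs, BasicOp.act_add, BasicOp.act_sum, BasicOp.act_ad, add_comm]
    congr 1
    refine Finset.sum_congr rfl fun i _ => ?_
    rw [BasicOp.act_smulBase, fres_pull]

end LiftedFrame

end LieAlgd

end

noncomputable section

namespace LieAlgd

variable {X Y S : Scheme.{0}} {π : X ⟶ S} {F : Family π} {p : S ⟶ Y} {U V : X.Opens} {n : ℕ}

/-! ### The bracket in coordinates -/

/-- The commutator of operators `P = {m, -} + ∑ c_i A_i` and `Q = {m', -} + ∑ c'_i A_i`, where the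
operators act compatibly on a Lie algebra `E` and on a representation `N` of it, and the commutators
`[A_i, A_j]` are inner. -/
theorem commutator_eq {R E N : Type*} [CommRing R] [AddCommGroup E] [Module R E] [AddCommGroup N]
    [Module R N] (ρ : E →+ N →+ N) (A : Fin n → N →+ N) (A' : Fin n → E → E) (P Q : N →+ N)
    (P' : E → E) (δ : R → R) (d : Fin n → R → R) (c c' : Fin n → R) (m m' : E)
    (r : Fin n → Fin n → E)
    (hP : ∀ x, P x = ρ m x + ∑ i, c i • A i x) (hQ : ∀ x, Q x = ρ m' x + ∑ i, c' i • A i x)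
    (hPρ : ∀ e x, P (ρ e x) = ρ (P' e) x + ρ e (P x))
    (hAρ : ∀ i e x, A i (ρ e x) = ρ (A' i e) x + ρ e (A i x))
    (hPs : ∀ g x, P (g • x) = g • P x + δ g • x)
    (hAs : ∀ i g x, A i (g • x) = g • A i x + d i g • x)
    (hr : ∀ i j x, A i (A j x) - A j (A i x) = ρ (r i j) x)
    (hc : ∀ i e x, ρ (c i • e) x = c i • ρ e x) (hc' : ∀ i e x, ρ (c' i • e) x = c' i • ρ e x) (x : N) :
    P (Q x) - Q (P x) = ρ (P' m' - ∑ j, c' j • A' j m + ∑ i, ∑ j, (c i * c' j) • r i j) x +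
      ∑ k, (δ (c' k) - ∑ j, c' j * d j (c k)) • A k x := by
  have e1 : P (Q x) = ρ (P' m') x + ρ m' (P x) + (∑ j, c' j • ρ m (A j x) +
      ∑ j, ∑ i, (c i * c' j) • A i (A j x)) + ∑ j, δ (c' j) • A j x := by
    rw [hQ, map_add, hPρ, map_sum]
    simp only [hPs, Finset.sum_add_distrib, hP (A _ x), smul_add, Finset.smul_sum, smul_smul]
    simp only [mul_comm, add_assoc]
  have e2 : Q (P x) = ρ m' (P x) + (∑ j, c' j • ρ (A' j m) x + ∑ j, c' j • ρ m (A j x) +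
      (∑ j, ∑ i, (c i * c' j) • A j (A i x) + ∑ j, ∑ i, (c' j * d j (c i)) • A i x)) := by
    have h : ∀ j, A j (P x) = ρ (A' j m) x + ρ m (A j x) +
        (∑ i, c i • A j (A i x) + ∑ i, d j (c i) • A i x) := fun j => by
      rw [hP, map_add, hAρ, map_sum]
      simp only [hAs, Finset.sum_add_distrib]
    rw [hQ]
    simp only [h, smul_add, Finset.sum_add_distrib, Finset.smul_sum, smul_smul]
    simp only [mul_comm]
  have e3 : ρ (∑ j, c' j • A' j m) x = ∑ j, c' j • ρ (A' j m) x := by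
    rw [map_sum, AddMonoidHom.finsetSum_apply]
    simp only [hc']
  have e4 : ρ (∑ i, ∑ j, (c i * c' j) • r i j) x = ∑ j, ∑ i, (c i * c' j) • A i (A j x) -
      ∑ j, ∑ i, (c i * c' j) • A j (A i x) := by
    rw [Finset.sum_comm]
    simp only [map_sum, AddMonoidHom.finsetSum_apply, mul_smul, hc, hc', ← hr, smul_sub,
      Finset.sum_sub_distrib]
  have e5 : ∑ k, (∑ j, c' j * d j (c k)) • A k x = ∑ j, ∑ i, (c' j * d j (c i)) • A i x := by
    rw [Finset.sum_comm]
    simp only [Finset.sum_smul]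
  simp only [sub_smul, Finset.sum_sub_distrib]
  rw [map_add, map_sub, AddMonoidHom.add_apply, AddMonoidHom.sub_apply, e1, e2, e3, e4, e5]
  abel

theorem Frame.coef_lie (Fr : Frame π p n V) (h : U ≤ V) (D E : tangent (π ≫ p) U) (k : Fin n) :
    Fr.coef h ⁅D, E⁆ k = D.der le_rfl (Fr.coef h E k) - E.der le_rfl (Fr.coef h D k) := rfl

namespace LiftedFrame

variable {υ : FlatSection F p} (C : LiftedFrame υ n V)

/-- The `𝒜_S`-component of the bracket of `s + ∑ c_i P_i` and `t + ∑ c'_i P_i`. -/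
def sbr (h : U ≤ V) (c c' : Fin n → Γ(X, U)) (s t : Γ(F.sheaf, U)) : Γ(F.sheaf, U) :=
  F.bracket U s t + ∑ i, c i • (C.P i).act h t - ∑ i, c' i • (C.P i).act h s +
    ∑ i, ∑ j, (c i * c' j) • mres F.sheaf h (C.r i j)

theorem mres_sbr (h : U ≤ V) (c c' : Fin n → Γ(X, U)) (s t : Γ(F.sheaf, U)) {U' : X.Opens}
    (h' : U' ≤ U) : mres F.sheaf h' (C.sbr h c c' s t) =
      C.sbr (h'.trans h) (fun i => fres h' (c i)) (fun i => fres h' (c' i)) (mres F.sheaf h' s)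
        (mres F.sheaf h' t) := by
  simp only [sbr, map_add, map_sub, map_sum, mres_smul, F.bracket_res, BasicOp.mres_act, mres_mres,
    map_mul]

theorem sbr_add_left (h : U ≤ V) (c d c' : Fin n → Γ(X, U)) (s r t : Γ(F.sheaf, U)) :
    C.sbr h (c + d) c' (s + r) t = C.sbr h c c' s t + C.sbr h d c' r t := by
  simp only [sbr, map_add, AddMonoidHom.add_apply, Pi.add_apply, add_smul, add_mul, smul_add,
    Finset.sum_add_distrib]
  abel

/-- The curvature is antisymmetric. -/
theorem r_skew (hinj : ∀ U : X.Opens, Function.Injective (BasicOp.ad F p U)) (i j : Fin n) :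
    C.r i j = -C.r j i := by
  refine hinj V ?_
  rw [map_neg, ← C.lie_P, ← C.lie_P]
  refine BasicOp.ext ?_ fun V' hV' s => ?_
  · change ⁅(C.P i).symbol, (C.P j).symbol⁆ = -⁅(C.P j).symbol, (C.P i).symbol⁆
    exact tangent.ext fun V' h g => by simp [Derivation.commutator_apply]
  · change _ = -(⁅C.P j, C.P i⁆.act hV' s)
    rw [BasicOp.act_lie, BasicOp.act_lie, neg_sub]

theorem sbr_skew (hinj : ∀ U : X.Opens, Function.Injective (BasicOp.ad F p U)) (h : U ≤ V)
    (c c' : Fin n → Γ(X, U)) (s t : Γ(F.sheaf, U)) :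
    C.sbr h c c' s t = -C.sbr h c' c t s := by
  have e : ∑ i, ∑ j, (c i * c' j) • mres F.sheaf h (C.r i j) =
      -∑ i, ∑ j, (c' i * c j) • mres F.sheaf h (C.r i j) := by
    rw [Finset.sum_comm, ← Finset.sum_neg_distrib]
    refine Finset.sum_congr rfl fun i _ => ?_
    rw [← Finset.sum_neg_distrib]
    refine Finset.sum_congr rfl fun j _ => ?_
    rw [C.r_skew hinj, map_neg, smul_neg, mul_comm]
  rw [sbr, sbr, e, F.skew s t]
  abel

theorem sbr_smul_left (h : U ≤ V) (g : Γ(X, U)) (c c' : Fin n → Γ(X, U)) (s t : Γ(F.sheaf, U)) :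
    C.sbr h (g • c) c' (g • s) t = g • C.sbr h c c' s t -
      (tangent.incl π p U (F.anchor U t) +
        ∑ i, c' i • (BasicOp.res h (C.P i)).symbol).der le_rfl g • s := by
  have e : (∑ i, c' i • (BasicOp.res h (C.P i)).symbol).der le_rfl g =
      ∑ i, c' i * (C.P i).symbol.der h g := by
    rw [tangent.sum_der]
    refine Finset.sum_congr rfl fun i _ => ?_
    rw [tangent.smul_der, fres_self]
    rfl
  rw [tangent.add_der, Derivation.add_apply, e, tangent.incl_der]
  simp only [sbr, F.leibniz, BasicOp.act_smul, Pi.smul_apply, smul_eq_mul, smul_add, smul_sub,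
    Finset.smul_sum, Finset.sum_add_distrib, add_smul, Finset.sum_smul, mul_smul]
  simp only [smul_comm g]
  abel

variable {C}

/-- The coordinates of a commutator. -/
theorem Coord.lie [IsIntegral X] {h : U ≤ V} {P Q : BasicOp F p U} {s t : Γ(F.sheaf, U)}
    (H : C.Coord h P s) (K : C.Coord h Q t) :
    C.Coord h ⁅P, Q⁆ (C.sbr h (C.coef h P.symbol) (C.coef h Q.symbol) s t) := by
  have hPs : P.act le_rfl t = F.bracket U s t + ∑ i, C.coef h P.symbol i • (C.P i).act h t := by
    rw [H.2 U le_rfl t, mres_self]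
    simp only [fres_self]
    rfl
  have hsbr : C.sbr h (C.coef h P.symbol) (C.coef h Q.symbol) s t = P.act le_rfl t -
      ∑ j, C.coef h Q.symbol j • (C.P j).act h s + ∑ i, ∑ j,
        (C.coef h P.symbol i * C.coef h Q.symbol j) • mres F.sheaf h (C.r i j) := by
    rw [hPs]
    rfl
  have hcP : ∀ (V1 : X.Opens) (h1 : V1 ≤ U) (e : Γ(F.sheaf, V1)) i,
      (F.anchor V1 e).der le_rfl (fres h1 (C.coef h P.symbol i)) = 0 := fun V1 h1 e i => by
    rw [C.fres_coef]
    exact C.der_coef (h1.trans h) (P.symbol_basic.res h1) _ i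
  have hcoef : ∀ k, C.coef h ⁅P.symbol, Q.symbol⁆ k = P.symbol.der le_rfl (C.coef h Q.symbol k) -
      ∑ j, C.coef h Q.symbol j * (C.P j).symbol.der h (C.coef h P.symbol k) := by
    intro k
    rw [C.coef_lie]
    congr 1
    have h0 := hcP U le_rfl t k
    rw [fres_self] at h0
    conv_lhs => rw [K.1]
    rw [tangent.add_der, Derivation.add_apply, tangent.incl_der, h0, zero_add, tangent.sum_der]
    refine Finset.sum_congr rfl fun i _ => ?_
    rw [tangent.smul_der, fres_self]
    rfl
  have hfc : ∀ (V1 : X.Opens) (h1 : V1 ≤ U) k, fres h1 (C.coef h ⁅P, Q⁆.symbol k) =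
      P.symbol.der h1 (fres h1 (C.coef h Q.symbol k)) - ∑ j, fres h1 (C.coef h Q.symbol j) *
        (C.P j).symbol.der (h1.trans h) (fres h1 (C.coef h P.symbol k)) := by
    intro V1 h1 k
    rw [BasicOp.symbol_lie, hcoef, map_sub, map_sum, tangent.fres_der]
    simp only [map_mul, tangent.fres_der]
  have hfs : ∀ (V1 : X.Opens) (h1 : V1 ≤ U), mres F.sheaf h1
      (C.sbr h (C.coef h P.symbol) (C.coef h Q.symbol) s t) = P.act h1 (mres F.sheaf h1 t) -
        ∑ j, fres h1 (C.coef h Q.symbol j) • (C.P j).act (h1.trans h) (mres F.sheaf h1 s) +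
        ∑ i, ∑ j, (fres h1 (C.coef h P.symbol i) * fres h1 (C.coef h Q.symbol j)) •
          mres F.sheaf (h1.trans h) (C.r i j) := by
    intro V1 h1
    rw [hsbr]
    simp only [map_add, map_sub, map_sum, mres_smul, BasicOp.mres_act, mres_mres, map_mul]
  have hσ : ∀ (V1 : X.Opens) (h1 : V1 ≤ U) (m : Γ(F.sheaf, U)) (R : BasicOp F p U)
      (_ : C.Coord h R m) (g : Γ(X, V1)), R.symbol.der h1 g =
        (F.anchor V1 (mres F.sheaf h1 m)).der le_rfl g +
          ∑ i, fres h1 (C.coef h R.symbol i) * (C.P i).symbol.der (h1.trans h) g := by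
    intro V1 h1 m R hR g
    conv_lhs => rw [hR.1]
    rw [tangent.add_der, Derivation.add_apply, tangent.sum_der, F.anchor_res]
    rfl
  constructor
  · refine tangent.ext fun V1 h1 g => ?_
    rw [tangent.add_der, Derivation.add_apply, tangent.sum_der]
    let ρ : Γ(F.sheaf, V1) →+ Γ(X, V1) →+ Γ(X, V1) :=
      AddMonoidHom.mk' (fun e => ((F.anchor V1 e).der le_rfl).toLinearMap.toAddMonoidHom)
        fun e e' => by rw [map_add]; rfl
    have := commutator_eq ρ
      (fun i => ((C.P i).symbol.der (h1.trans h)).toLinearMap.toAddMonoidHom)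
      (fun i => (C.P i).act (h1.trans h)) (P.symbol.der h1).toLinearMap.toAddMonoidHom
      (Q.symbol.der h1).toLinearMap.toAddMonoidHom (P.act h1) (P.symbol.der h1)
      (fun i => (C.P i).symbol.der (h1.trans h))
      (fun i => fres h1 (C.coef h P.symbol i)) (fun i => fres h1 (C.coef h Q.symbol i))
      (mres F.sheaf h1 s) (mres F.sheaf h1 t) (fun i j => mres F.sheaf (h1.trans h) (C.r i j))
      (hσ V1 h1 s P H) (hσ V1 h1 t Q K)
      (fun e x => ?_) (fun i e x => ?_) (fun g x => ?_) (fun i g x => ?_) (fun i j x => ?_)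
      (fun i e x => ?_) (fun i e x => ?_) g
    · refine this.trans ?_
      rw [← hfs]
      congr 1
      · change (F.anchor V1 _).der le_rfl g = _
        rw [F.anchor_res]
        rfl
      · refine Finset.sum_congr rfl fun k _ => ?_
        rw [← hfc]
        rfl
    · have := congr(($((BasicOp.res h1 P).symbol_lie_anchor e)).der le_rfl x)
      rw [tangent.lie_der, Derivation.commutator_apply] at this
      exact sub_eq_iff_eq_add.mp this
    · have := congr(($((BasicOp.res (h1.trans h) (C.P i)).symbol_lie_anchor e)).der le_rfl x)
      rw [tangent.lie_der, Derivation.commutator_apply] at this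
      exact sub_eq_iff_eq_add.mp this
    · exact ((P.symbol.der h1).leibniz g x).trans (by simp [mul_comm])
    · exact (((C.P i).symbol.der (h1.trans h)).leibniz g x).trans (by simp [mul_comm])
    · have := congr(($(C.lie_P i j)).symbol.der (h1.trans h) x)
      rw [BasicOp.symbol_lie, tangent.lie_der, Derivation.commutator_apply] at this
      refine this.trans ?_
      change _ = (F.anchor V1 _).der le_rfl x
      rw [F.anchor_res]
      rfl
    · change (F.anchor V1 _).der le_rfl x = _ • (F.anchor V1 e).der le_rfl x
      rw [map_smul, tangent.smul_der, fres_self]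
      rfl
    · change (F.anchor V1 _).der le_rfl x = _ • (F.anchor V1 e).der le_rfl x
      rw [map_smul, tangent.smul_der, fres_self]
      rfl
  · intro V1 h1 x
    have := commutator_eq (F.bracket V1) (fun i => (C.P i).act (h1.trans h))
      (fun i => (C.P i).act (h1.trans h)) (P.act h1) (Q.act h1) (P.act h1) (P.symbol.der h1)
      (fun i => (C.P i).symbol.der (h1.trans h))
      (fun i => fres h1 (C.coef h P.symbol i)) (fun i => fres h1 (C.coef h Q.symbol i))
      (mres F.sheaf h1 s) (mres F.sheaf h1 t) (fun i j => mres F.sheaf (h1.trans h) (C.r i j))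
      (H.2 V1 h1) (K.2 V1 h1)
      (P.act_bracket h1) (fun i => (C.P i).act_bracket (h1.trans h)) (P.act_smul h1)
      (fun i => (C.P i).act_smul (h1.trans h)) (fun i j x => ?_)
      (fun i e x => ?_) (fun i e x => ?_) x
    · rw [BasicOp.act_lie, this, ← hfs]
      congr 1
      refine Finset.sum_congr rfl fun k _ => ?_
      rw [← hfc]
      rfl
    · rw [← BasicOp.act_lie, C.lie_P, BasicOp.act_ad]
    · rw [F.leibniz, hcP, zero_smul, sub_zero]
    · have : (F.anchor V1 x).der le_rfl (fres h1 (C.coef h Q.symbol i)) = 0 := by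
        rw [C.fres_coef]
        exact C.der_coef (h1.trans h) (Q.symbol_basic.res h1) _ i
      rw [F.leibniz, this, zero_smul, sub_zero]

end LiftedFrame

end LieAlgd

end

noncomputable section

namespace LieAlgd

variable {X Y S : Scheme.{0}} {π : X ⟶ S} {F : Family π} {p : S ⟶ Y} {U V : X.Opens} {n : ℕ}

namespace LiftedFrame

variable {V₀ : X.Opens} {υ : FlatSection F p} (C : LiftedFrame υ n V₀)

/-! ### The sheaf generated by the lifts -/

/-- Pairs of a vector field on `U` and a section of `𝒜_S` over the part of `U` where `C` is
defined. The pair `(D, s)` stands for the section `s + ∑ D(t_i) P_i` of the unfolding. -/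
@[ext]
structure Amb (C : LiftedFrame υ n V₀) (U : X.Opens) : Type where
  /-- the vector field -/
  D : tangent (π ≫ p) U
  /-- the component in `𝒜_S` -/
  s : Γ(F.sheaf, U ⊓ V₀)

namespace Amb

/-- Pairs as elements of a product. -/
def equiv (C : LiftedFrame υ n V₀) (U : X.Opens) :
    C.Amb U ≃ tangent (π ≫ p) U × Γ(F.sheaf, U ⊓ V₀) where
  toFun z := (z.D, z.s)
  invFun z := ⟨z.1, z.2⟩

instance : AddCommGroup (C.Amb U) := (equiv C U).addCommGroup

instance : SMul Γ(X, U) (C.Amb U) where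
  smul g z := ⟨g • z.D, fres (inf_le_left : U ⊓ V₀ ≤ U) g • z.s⟩

variable {C}

@[simp] theorem add_D (z w : C.Amb U) : (z + w).D = z.D + w.D := rfl
@[simp] theorem add_s (z w : C.Amb U) : (z + w).s = z.s + w.s := rfl
@[simp] theorem zero_D : (0 : C.Amb U).D = 0 := rfl
@[simp] theorem zero_s : (0 : C.Amb U).s = 0 := rfl
@[simp] theorem neg_D (z : C.Amb U) : (-z).D = -z.D := rfl
@[simp] theorem neg_s (z : C.Amb U) : (-z).s = -z.s := rfl
@[simp] theorem sub_D (z w : C.Amb U) : (z - w).D = z.D - w.D := rfl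
@[simp] theorem sub_s (z w : C.Amb U) : (z - w).s = z.s - w.s := rfl
@[simp] theorem smul_D (g : Γ(X, U)) (z : C.Amb U) : (g • z).D = g • z.D := rfl
@[simp] theorem smul_s (g : Γ(X, U)) (z : C.Amb U) :
    (g • z).s = fres (inf_le_left : U ⊓ V₀ ≤ U) g • z.s := rfl

instance : Module Γ(X, U) (C.Amb U) where
  one_smul z := Amb.ext (by simp) (by simp)
  mul_smul a b z := Amb.ext (by simp [mul_smul]) (by simp [mul_smul])
  smul_zero a := Amb.ext (by simp) (by simp)
  smul_add a z w := Amb.ext (by simp) (by simp)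
  add_smul a b z := Amb.ext (by simp [add_smul]) (by simp [add_smul])
  zero_smul z := Amb.ext (by simp) (by simp)

/-- Restriction to a smaller open subset. -/
def res (h : V ≤ U) : C.Amb U →+ C.Amb V where
  toFun z := ⟨tangent.res h z.D, mres F.sheaf (inf_le_inf_right V₀ h) z.s⟩
  map_zero' := Amb.ext (by simp) (by simp)
  map_add' z w := Amb.ext (map_add (tangent.res h) z.D w.D) (map_add (mres F.sheaf _) z.s w.s)

theorem res_D (h : V ≤ U) (z : C.Amb U) : (res h z).D = tangent.res h z.D := rfl
theorem res_s (h : V ≤ U) (z : C.Amb U) :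
    (res h z).s = mres F.sheaf (inf_le_inf_right V₀ h) z.s := rfl

theorem res_res {W : X.Opens} (h : V ≤ U) (h' : W ≤ V) (z : C.Amb U) :
    res h' (res h z) = res (h'.trans h) z :=
  Amb.ext rfl (mres_mres _ _ _ _)

theorem res_self (h : U ≤ U) (z : C.Amb U) : res h z = z := Amb.ext rfl (mres_self _ _ _)

theorem res_smul (h : V ≤ U) (g : Γ(X, U)) (z : C.Amb U) :
    res h (g • z) = fres h g • res h z := by
  refine Amb.ext (tangent.res_smul h g z.D) ?_
  rw [res_s, smul_s, smul_s, mres_smul, fres_fres, fres_fres]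
  rfl

/-- The coefficients of the vector field. -/
def coefs (z : C.Amb U) : Fin n → Γ(X, U ⊓ V₀) :=
  C.coef inf_le_right (tangent.res inf_le_left z.D)

theorem coefs_add (z w : C.Amb U) : coefs (z + w) = coefs z + coefs w := rfl

theorem coefs_smul (g : Γ(X, U)) (z : C.Amb U) :
    coefs (g • z) = (fres inf_le_left g : Γ(X, U ⊓ V₀)) • coefs z := by
  funext i
  rw [coefs, smul_D, tangent.res_smul, C.coef_smul]
  rfl

theorem fres_coefs (h : V ≤ U) (z : C.Amb U) :
    (fun i => fres (inf_le_inf_right V₀ h) (coefs z i)) = coefs (res h z) := by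
  funext i
  rw [coefs, C.fres_coef]
  rfl

/-- The bracket of pairs. -/
def br (z w : C.Amb U) : C.Amb U :=
  ⟨⁅z.D, w.D⁆, C.sbr inf_le_right (coefs z) (coefs w) z.s w.s⟩

theorem br_D (z w : C.Amb U) : (br z w).D = ⁅z.D, w.D⁆ := rfl
theorem br_s (z w : C.Amb U) :
    (br z w).s = C.sbr inf_le_right (coefs z) (coefs w) z.s w.s := rfl

theorem res_br (h : V ≤ U) (z w : C.Amb U) : res h (br z w) = br (res h z) (res h w) := by
  refine Amb.ext rfl ?_
  rw [res_s, br_s, br_s, mres_sbr, fres_coefs, fres_coefs]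
  rfl

theorem br_add_left (z z' w : C.Amb U) : br (z + z') w = br z w + br z' w := by
  refine Amb.ext (tangent.ext fun V h g => ?_) ?_
  · simp [br_D, Derivation.commutator_apply]
  · rw [br_s, coefs_add, add_s, sbr_add_left]
    rfl

variable (hinj : ∀ U : X.Opens, Function.Injective (BasicOp.ad F p U))

include hinj in
theorem br_skew (z w : C.Amb U) : br z w = -br w z := by
  refine Amb.ext (tangent.ext fun V h g => ?_) ?_
  · simp [br_D, Derivation.commutator_apply]
  · rw [br_s, C.sbr_skew hinj]
    rfl

include hinj in
theorem br_add_right (z w w' : C.Amb U) : br z (w + w') = br z w + br z w' := by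
  rw [br_skew hinj, br_add_left, br_skew hinj z w, br_skew hinj z w', neg_add]

/-- Pairs `(D, s)` for which `D` is the anchor of the section `s + ∑ D(t_i) P_i`. -/
def Good (z : C.Amb U) : Prop :=
  tangent.res inf_le_left z.D = tangent.incl π p (U ⊓ V₀) (F.anchor _ z.s) +
    ∑ i, coefs z i • (BasicOp.res inf_le_right (C.P i)).symbol

theorem Good.add {z w : C.Amb U} (hz : Good z) (hw : Good w) : Good (z + w) := by
  rw [Good, add_D, map_add, hz, hw, add_s, map_add, map_add, coefs_add]
  simp only [Pi.add_apply, add_smul, Finset.sum_add_distrib]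
  abel

theorem Good.smul {z : C.Amb U} (hz : Good z) (g : Γ(X, U)) : Good (g • z) := by
  rw [Good, smul_D, tangent.res_smul, hz, smul_s, map_smul, tangent.incl_smul, coefs_smul]
  simp only [Pi.smul_apply, smul_eq_mul, mul_smul, smul_add, Finset.smul_sum]

theorem good_zero : Good (0 : C.Amb U) := by
  have : coefs (0 : C.Amb U) = 0 := rfl
  simp [Good, this]

/-- The Leibniz rule. It involves the anchor of `w`, hence holds only when the vector field of `w`
is this anchor. -/
theorem br_smul_left {w : C.Amb U} (hw : Good w) (g : Γ(X, U)) (z : C.Amb U) :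
    br (g • z) w = g • br z w - w.D.der le_rfl g • z := by
  refine Amb.ext (tangent.ext fun V h k => ?_) ?_
  · simp only [br_D, smul_D, sub_D, tangent.lie_der, tangent.sub_der, tangent.smul_der,
      Derivation.commutator_apply, Derivation.smul_apply, Derivation.sub_apply,
      Derivation.leibniz, smul_eq_mul, tangent.fres_der]
    ring
  · unfold Good at hw
    rw [br_s, coefs_smul, smul_s, sbr_smul_left, ← hw]
    simp only [sub_s, smul_s, tangent.fres_der, tangent.res_der]
    rfl

include hinj in
theorem br_smul_right {z : C.Amb U} (hz : Good z) (g : Γ(X, U)) (w : C.Amb U) :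
    br z (g • w) = g • br z w + z.D.der le_rfl g • w := by
  rw [br_skew hinj, br_smul_left hz, br_skew hinj z w, smul_neg]
  abel

/-- The pair associated with an operator. -/
def IsGen (P : BasicOp F p U) (z : C.Amb U) : Prop :=
  z.D = P.symbol ∧ C.Coord inf_le_right (BasicOp.res inf_le_left P) z.s

theorem IsGen.good {P : BasicOp F p U} {z : C.Amb U} (h : IsGen P z) : Good z := by
  rw [Good, coefs, h.1]
  exact h.2.1

theorem IsGen.res {P : BasicOp F p U} {z : C.Amb U} (h : IsGen P z) (h' : V ≤ U) :
    IsGen (BasicOp.res h' P) (Amb.res h' z) :=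
  ⟨congrArg (tangent.res h') h.1, h.2.res (inf_le_inf_right V₀ h')⟩

theorem IsGen.add {P Q : BasicOp F p U} {z w : C.Amb U} (h : IsGen P z) (k : IsGen Q w) :
    IsGen (P + Q) (z + w) :=
  ⟨congr($(h.1) + $(k.1)), h.2.add k.2⟩

/-- On pairs associated with operators, the bracket is the commutator of operators. -/
theorem IsGen.lie [IsIntegral X] {P Q : BasicOp F p U} {z w : C.Amb U} (h : IsGen P z)
    (k : IsGen Q w) : IsGen ⁅P, Q⁆ (br z w) := by
  refine ⟨congr(⁅$(h.1), $(k.1)⁆), ?_⟩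
  rw [br_s, coefs, coefs, h.1, k.1]
  exact h.2.lie k.2

include hinj in
theorem IsGen.unique {P : BasicOp F p U} {z w : C.Amb U} (h : IsGen P z) (k : IsGen P w) :
    z = w :=
  Amb.ext (h.1.trans k.1.symm) (h.2.unique hinj k.2)

theorem isGen_zero : IsGen (0 : BasicOp F p U) (0 : C.Amb U) :=
  ⟨rfl, coord_zero inf_le_right⟩

include hinj in
theorem exists_isGen {P : BasicOp F p U} (hP : υ.IsLift P) : ∃ z : C.Amb U, IsGen P z := by
  obtain ⟨s, hs⟩ := exists_coord (C := C) hinj inf_le_right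
    (hP.res (inf_le_left : U ⊓ V₀ ≤ U))
  exact ⟨⟨P.symbol, s⟩, rfl, hs⟩

/-- The span of the pairs associated with lifts along the flat section. -/
def genSpan (C : LiftedFrame υ n V₀) (U : X.Opens) : Submodule Γ(X, U) (C.Amb U) :=
  Submodule.span _ {z | ∃ P, υ.IsLift P ∧ IsGen P z}

theorem res_mem_genSpan (h : V ≤ U) {z : C.Amb U} (hz : z ∈ genSpan C U) :
    res h z ∈ genSpan C V := by
  induction hz using Submodule.span_induction with
  | mem z hz =>
    obtain ⟨P, h1, h2⟩ := hz
    exact Submodule.subset_span ⟨_, h1.res h, h2.res h⟩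
  | zero => rw [map_zero]; exact Submodule.zero_mem _
  | add x y _ _ hx hy => rw [map_add]; exact Submodule.add_mem _ hx hy
  | smul g x _ hx => rw [res_smul]; exact Submodule.smul_mem _ _ hx

theorem good_of_mem_genSpan {z : C.Amb U} (hz : z ∈ genSpan C U) : Good z := by
  induction hz using Submodule.span_induction with
  | mem z hz =>
    obtain ⟨P, h1, h2⟩ := hz
    exact h2.good
  | zero => exact good_zero
  | add x y _ _ hx hy => exact hx.add hy
  | smul g x _ hx => exact hx.smul g

theorem br_zero_left (w : C.Amb U) : br 0 w = 0 := by
  have := br_add_left 0 0 w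
  rw [add_zero] at this
  exact left_eq_add.mp this

include hinj in
theorem br_zero_right (w : C.Amb U) : br w 0 = 0 := by
  rw [br_skew hinj, br_zero_left, neg_zero]

include hinj in
theorem br_mem_genSpan [IsIntegral X] {z w : C.Amb U} (hz : z ∈ genSpan C U)
    (hw : w ∈ genSpan C U) : br z w ∈ genSpan C U := by
  induction hw using Submodule.span_induction with
  | mem w hw =>
    obtain ⟨Q, k1, k2⟩ := hw
    induction hz using Submodule.span_induction with
    | mem z hz =>
      obtain ⟨P, h1, h2⟩ := hz
      exact Submodule.subset_span ⟨_, h1.lie k1, h2.lie k2⟩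
    | zero => rw [br_zero_left]; exact Submodule.zero_mem _
    | add x y _ _ hx hy => rw [br_add_left]; exact Submodule.add_mem _ hx hy
    | smul g x hx' hx =>
      rw [br_smul_left k2.good]
      exact Submodule.sub_mem _ (Submodule.smul_mem _ g hx) (Submodule.smul_mem _ _ hx')
  | zero => rw [br_zero_right hinj]; exact Submodule.zero_mem _
  | add x y _ _ hx hy => rw [br_add_right hinj]; exact Submodule.add_mem _ hx hy
  | smul g x hx' hx =>
    rw [br_smul_right hinj (good_of_mem_genSpan hz)]
    exact Submodule.add_mem _ (Submodule.smul_mem _ g hx) (Submodule.smul_mem _ _ hx')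

/-- The Jacobiator. -/
def jac (z w u : C.Amb U) : C.Amb U := br z (br w u) + br w (br u z) + br u (br z w)

theorem jac_rotate (z w u : C.Amb U) : jac z w u = jac w u z := by
  rw [jac, jac]
  abel

/-- On pairs associated with operators, the Jacobi identity is the one for commutators. -/
theorem IsGen.jac_eq_zero [IsIntegral X] {P Q R : BasicOp F p U} {z w u : C.Amb U}
    (hz : IsGen P z) (hw : IsGen Q w) (hu : IsGen R u)
    (hinj : ∀ U : X.Opens, Function.Injective (BasicOp.ad F p U)) : jac z w u = 0 := by
  have h := ((hz.lie (hw.lie hu)).add (hw.lie (hu.lie hz))).add (hu.lie (hz.lie hw))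
  have e : ⁅P, ⁅Q, R⁆⁆ + ⁅Q, ⁅R, P⁆⁆ + ⁅R, ⁅P, Q⁆⁆ = 0 := by
    refine BasicOp.ext (tangent.ext fun V h g => ?_) fun V h s => ?_
    · simp only [BasicOp.symbol_add, BasicOp.symbol_lie, tangent.add_der, tangent.lie_der,
        Derivation.add_apply, Derivation.commutator_apply, map_sub]
      change _ = (0 : Γ(X, V))
      abel
    · simp only [BasicOp.act_add, BasicOp.act_lie, map_sub]
      change _ = (0 : Γ(F.sheaf, V))
      abel
  rw [e] at h
  exact h.unique hinj isGen_zero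

include hinj in
/-- The Jacobiator is linear in its first argument, so it suffices to let this argument run through
generators. -/
theorem jac_eq_zero_of_gen [IsIntegral X] {w u : C.Amb U} (hw : w ∈ genSpan C U)
    (hu : u ∈ genSpan C U) (H : ∀ P z, υ.IsLift P → IsGen P z → jac z w u = 0) {z : C.Amb U}
    (hz : z ∈ genSpan C U) : jac z w u = 0 := by
  induction hz using Submodule.span_induction with
  | mem z hz =>
    obtain ⟨P, h1, h2⟩ := hz
    exact H P z h1 h2
  | zero => simp [jac, br_zero_left, br_zero_right hinj]
  | add x y _ _ hx hy =>
    have : jac (x + y) w u = jac x w u + jac y w u := by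
      simp only [jac, br_add_left, br_add_right hinj]
      abel
    rw [this, hx, hy, add_zero]
  | smul g x hx' hx =>
    have gw := good_of_mem_genSpan hw
    have gu := good_of_mem_genSpan hu
    have gx := good_of_mem_genSpan hx'
    have gwu := good_of_mem_genSpan (br_mem_genSpan hinj hw hu)
    have : jac (g • x) w u = g • jac x w u := by
      have e1 : (br w u).D.der le_rfl g = w.D.der le_rfl (u.D.der le_rfl g) -
        u.D.der le_rfl (w.D.der le_rfl g) := rfl
      rw [jac, br_smul_left gwu, br_smul_right hinj gu, br_smul_left gw, br_add_right hinj,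
        br_smul_right hinj gw, br_smul_right hinj gw, sub_eq_add_neg (g • br x w), ← neg_smul,
        br_add_right hinj, br_smul_right hinj gu, br_smul_right hinj gu, e1, jac, br_skew hinj x w,
        map_neg]
      simp only [smul_add, sub_smul, neg_smul, smul_neg]
      rw [br_skew hinj u x]
      simp only [smul_neg]
      abel
    rw [this, hx, smul_zero]

include hinj in
/-- The Jacobi identity. -/
theorem jac_eq_zero [IsIntegral X] {z w u : C.Amb U} (hz : z ∈ genSpan C U)
    (hw : w ∈ genSpan C U) (hu : u ∈ genSpan C U) : jac z w u = 0 := by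
  refine jac_eq_zero_of_gen hinj hw hu (fun P z hP hz => ?_) hz
  have hz' : z ∈ genSpan C U := Submodule.subset_span ⟨P, hP, hz⟩
  rw [jac_rotate]
  refine jac_eq_zero_of_gen hinj hu hz' (fun Q w hQ hw => ?_) hw
  have hw' : w ∈ genSpan C U := Submodule.subset_span ⟨Q, hQ, hw⟩
  rw [jac_rotate]
  refine jac_eq_zero_of_gen hinj hz' hw' (fun R u hR hu => ?_) hu
  exact hu.jac_eq_zero hz hw hinj

end Amb

end LiftedFrame

end LieAlgd

end

noncomputable section

namespace LieAlgd

variable {X Y S : Scheme.{0}} {π : X ⟶ S} {F : Family π} {p : S ⟶ Y} {U V : X.Opens} {n : ℕ}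

namespace LiftedFrame

variable {V₀ : X.Opens} {υ : FlatSection F p}

namespace Amb

variable {C : LiftedFrame υ n V₀}

theorem eq_of_locally (z w : C.Amb U)
    (H : ∀ x ∈ U, ∃ (V : X.Opens) (h : V ≤ U), x ∈ V ∧ res h z = res h w) : z = w := by
  refine Amb.ext (tangent.eq_of_locally _ _ fun x hx => ?_)
    (mres_eq_of_locally _ _ _ fun x hx => ?_)
  · obtain ⟨V, h, hxV, e⟩ := H x hx
    exact ⟨V, h, hxV, congrArg Amb.D e⟩
  · obtain ⟨V, h, hxV, e⟩ := H x hx.1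
    exact ⟨V ⊓ V₀, inf_le_inf_right V₀ h, ⟨hxV, hx.2⟩, congrArg Amb.s e⟩

/-- Compatible local pairs glue. -/
theorem exists_glue {ι : Type} (U : ι → X.Opens) (z : ∀ i, C.Amb (U i))
    (hz : ∀ i j, res (inf_le_left : U i ⊓ U j ≤ U i) (z i) =
      res (inf_le_right : U i ⊓ U j ≤ U j) (z j)) :
    ∃ w : C.Amb (iSup U), ∀ i, res (le_iSup U i) w = z i := by
  obtain ⟨D, hD⟩ := tangent.exists_glue (f := π ≫ p) (iSup U)
    (fun V D => ∃ (i : ι) (h : V ≤ U i), D = tangent.res h (z i).D) (fun x hx => by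
      obtain ⟨i, hi⟩ := Opens.mem_iSup.mp hx
      exact ⟨U i, le_iSup U i, hi, _, i, le_rfl, rfl⟩) (by
    rintro V - _ _ ⟨i, hi, rfl⟩ ⟨j, hj, rfl⟩
    exact congrArg (tangent.res (le_inf hi hj)) (congrArg Amb.D (hz i j))) (by
    rintro V V' h - _ ⟨i, hi, rfl⟩
    exact ⟨i, h.trans hi, rfl⟩)
  obtain ⟨s, hs⟩ := exists_mglue F.sheaf (iSup U ⊓ V₀)
    (fun V s => ∃ (i : ι) (h : V ≤ U i ⊓ V₀), s = mres F.sheaf h (z i).s) (fun x hx => by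
      obtain ⟨i, hi⟩ := Opens.mem_iSup.mp hx.1
      exact ⟨U i ⊓ V₀, inf_le_inf_right V₀ (le_iSup U i), ⟨hi, hx.2⟩, _, i, le_rfl, rfl⟩) (by
    rintro V - _ _ ⟨i, hi, rfl⟩ ⟨j, hj, rfl⟩
    have h : V ≤ U i ⊓ U j ⊓ V₀ :=
      le_inf (le_inf (hi.trans inf_le_left) (hj.trans inf_le_left)) (hi.trans inf_le_right)
    have := congrArg (mres F.sheaf h) (congrArg Amb.s (hz i j))
    rwa [res_s, res_s, mres_mres, mres_mres] at this) (by
    rintro V V' h - _ ⟨i, hi, rfl⟩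
    exact ⟨i, h.trans hi, mres_mres _ _ _ _⟩)
  refine ⟨⟨D, s⟩, fun i => Amb.ext ?_ ?_⟩
  · exact hD (U i) (le_iSup U i) _ ⟨i, le_rfl, rfl⟩
  · exact hs (U i ⊓ V₀) _ _ ⟨i, le_rfl, (mres_self _ _ _).symm⟩

end Amb

variable (C : LiftedFrame υ n V₀)

/-- Sections over `U` of the unfolding: pairs which locally lie in the span of the pairs
associated with lifts. -/
def sec (U : X.Opens) : Submodule Γ(X, U) (C.Amb U) where
  carrier := {z | ∀ x ∈ U, ∃ (V : X.Opens) (h : V ≤ U), x ∈ V ∧ Amb.res h z ∈ Amb.genSpan C V}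
  zero_mem' x hx := ⟨U, le_rfl, hx, by rw [map_zero]; exact Submodule.zero_mem _⟩
  add_mem' {z w} hz hw x hx := by
    obtain ⟨V, h, hxV, e⟩ := hz x hx
    obtain ⟨V', h', hxV', e'⟩ := hw x hx
    refine ⟨V ⊓ V', inf_le_left.trans h, ⟨hxV, hxV'⟩, ?_⟩
    have a := Amb.res_mem_genSpan (V := V ⊓ V') inf_le_left e
    have b := Amb.res_mem_genSpan (V := V ⊓ V') inf_le_right e'
    rw [Amb.res_res] at a b
    rw [map_add]
    exact Submodule.add_mem _ a b
  smul_mem' g z hz x hx := by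
    obtain ⟨V, h, hxV, e⟩ := hz x hx
    exact ⟨V, h, hxV, by rw [Amb.res_smul]; exact Submodule.smul_mem _ _ e⟩

variable {C}

theorem res_mem_sec (h : V ≤ U) {z : C.Amb U} (hz : z ∈ C.sec U) : Amb.res h z ∈ C.sec V := by
  intro x hx
  obtain ⟨V', h', hxV', e⟩ := hz x (h hx)
  refine ⟨V ⊓ V', inf_le_left, ⟨hx, hxV'⟩, ?_⟩
  have := Amb.res_mem_genSpan (V := V ⊓ V') inf_le_right e
  rwa [Amb.res_res] at this ⊢

theorem mem_sec_of_mem_genSpan {z : C.Amb U} (hz : z ∈ Amb.genSpan C U) : z ∈ C.sec U :=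
  fun _ hx => ⟨U, le_rfl, hx, Amb.res_mem_genSpan le_rfl hz⟩

variable (C)

/-- Restriction of sections of the unfolding. -/
def resSec (h : V ≤ U) : C.sec U →+ C.sec V where
  toFun z := ⟨Amb.res h z.1, res_mem_sec h z.2⟩
  map_zero' := Subtype.ext (map_zero (Amb.res h))
  map_add' z w := Subtype.ext (map_add (Amb.res h) z.1 w.1)

/-- The sheaf of abelian groups underlying the unfolding. -/
def secPresheaf : TopCat.Presheaf Ab X where
  obj U := AddCommGrpCat.of (C.sec U.unop)
  map i := AddCommGrpCat.ofHom (C.resSec i.unop.le)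
  map_id _ := AddCommGrpCat.hom_ext (AddMonoidHom.ext fun z =>
    Subtype.ext (Amb.res_self le_rfl z.1))
  map_comp i j := AddCommGrpCat.hom_ext (AddMonoidHom.ext fun z =>
    Subtype.ext (Amb.res_res i.unop.le j.unop.le z.1).symm)

theorem secPresheaf_isSheaf : C.secPresheaf.IsSheaf := by
  rw [TopCat.Presheaf.isSheaf_iff_isSheafUniqueGluing]
  intro ι U sf hsf
  let z : ∀ i, C.sec (U i) := sf
  obtain ⟨w, hw⟩ := Amb.exists_glue U (fun i => (z i).1)
    fun i j => congrArg Subtype.val (hsf i j)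
  refine ⟨(⟨w, fun x hx => ?_⟩ : C.sec (iSup U)), fun i => Subtype.ext (hw i), fun w' hw' => ?_⟩
  · obtain ⟨i, hi⟩ := Opens.mem_iSup.mp hx
    obtain ⟨V, h, hxV, e⟩ := (z i).2 x hi
    refine ⟨V, h.trans (le_iSup U i), hxV, ?_⟩
    rw [← hw i, Amb.res_res] at e
    exact e
  · let w'' : C.sec (iSup U) := w'
    refine Subtype.ext (Amb.eq_of_locally w''.1 w fun x hx => ?_)
    obtain ⟨i, hi⟩ := Opens.mem_iSup.mp hx
    exact ⟨U i, le_iSup U i, hi, (congrArg Subtype.val (hw' i)).trans (hw i).symm⟩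

/-- The sheaf of modules underlying the unfolding. -/
def sheaf : X.Modules :=
  ⟨@PresheafOfModules.ofPresheaf _ _ X.ringCatSheaf.obj C.secPresheaf
    (fun U => inferInstanceAs (Module Γ(X, U.unop) (C.sec U.unop)))
    (fun {U _} i g z => Subtype.ext (Amb.res_smul i.unop.le g
      ((show C.sec U.unop from z) : C.Amb U.unop))), C.secPresheaf_isSheaf⟩

/-- Sections of the unfolding as pairs. -/
def toAmb (U : X.Opens) : Γ(C.sheaf, U) →ₗ[Γ(X, U)] C.Amb U := (C.sec U).subtype

theorem toAmb_injective (U : X.Opens) : Function.Injective (C.toAmb U) := Subtype.val_injective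

theorem toAmb_mem (z : Γ(C.sheaf, U)) : C.toAmb U z ∈ C.sec U :=
  (show C.sec U from z).2

theorem toAmb_mres (h : V ≤ U) (z : Γ(C.sheaf, U)) :
    C.toAmb V (mres C.sheaf h z) = Amb.res h (C.toAmb U z) := rfl

variable {C}

/-- The section of the unfolding given by a pair. -/
def ofAmb {z : C.Amb U} (hz : z ∈ C.sec U) : Γ(C.sheaf, U) := (⟨z, hz⟩ : C.sec U)

@[simp] theorem toAmb_ofAmb {z : C.Amb U} (hz : z ∈ C.sec U) : C.toAmb U (ofAmb hz) = z := rfl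

end LiftedFrame

end LieAlgd

end

noncomputable section

namespace LieAlgd

variable {X Y S : Scheme.{0}} {π : X ⟶ S} {F : Family π} {p : S ⟶ Y} {U V : X.Opens} {n : ℕ}

namespace LiftedFrame

variable {V₀ : X.Opens} {υ : FlatSection F p} {C : LiftedFrame υ n V₀}

theorem Amb.br_smul_left_of_mem_sec {z : C.Amb U} (hz : z ∈ C.sec U) (g : Γ(X, U)) (w : C.Amb U) :
    Amb.br (g • w) z = g • Amb.br w z - z.D.der le_rfl g • w := by
  refine Amb.eq_of_locally _ _ fun x hx => ?_
  obtain ⟨V, h, hxV, e⟩ := hz x hx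
  refine ⟨V, h, hxV, ?_⟩
  rw [Amb.res_br, Amb.res_smul, Amb.br_smul_left (Amb.good_of_mem_genSpan e), map_sub,
    Amb.res_smul, Amb.res_smul, Amb.res_br, tangent.fres_der]
  rfl

variable (hinj : ∀ U : X.Opens, Function.Injective (BasicOp.ad F p U))

include hinj in
theorem br_mem_sec [IsIntegral X] {z w : C.Amb U} (hz : z ∈ C.sec U) (hw : w ∈ C.sec U) :
    Amb.br z w ∈ C.sec U := by
  intro x hx
  obtain ⟨V, h, hxV, e⟩ := hz x hx
  obtain ⟨V', h', hxV', e'⟩ := hw x hx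
  have a := Amb.res_mem_genSpan (V := V ⊓ V') inf_le_left e
  have b := Amb.res_mem_genSpan (V := V ⊓ V') inf_le_right e'
  rw [Amb.res_res] at a b
  refine ⟨V ⊓ V', inf_le_left.trans h, ⟨hxV, hxV'⟩, ?_⟩
  rw [Amb.res_br]
  exact Amb.br_mem_genSpan hinj a b

include hinj in
theorem jac_eq_zero_of_mem_sec [IsIntegral X] {z w u : C.Amb U} (hz : z ∈ C.sec U)
    (hw : w ∈ C.sec U) (hu : u ∈ C.sec U) : Amb.jac z w u = 0 := by
  refine Amb.eq_of_locally _ _ fun x hx => ?_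
  obtain ⟨V1, h1, hx1, e1⟩ := hz x hx
  obtain ⟨V2, h2, hx2, e2⟩ := hw x hx
  obtain ⟨V3, h3, hx3, e3⟩ := hu x hx
  have a := Amb.res_mem_genSpan (V := V1 ⊓ V2 ⊓ V3) (inf_le_left.trans inf_le_left) e1
  have b := Amb.res_mem_genSpan (V := V1 ⊓ V2 ⊓ V3) (inf_le_left.trans inf_le_right) e2
  have c := Amb.res_mem_genSpan (V := V1 ⊓ V2 ⊓ V3) inf_le_right e3
  rw [Amb.res_res] at a b c
  refine ⟨V1 ⊓ V2 ⊓ V3, (inf_le_left.trans inf_le_left).trans h1, ⟨⟨hx1, hx2⟩, hx3⟩, ?_⟩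
  rw [map_zero, ← Amb.jac_eq_zero hinj a b c]
  simp only [Amb.jac, map_add, Amb.res_br]

/-! ### The structure of a Lie algebroid -/

variable (C)

/-- The anchor. -/
def anchor (U : X.Opens) : Γ(C.sheaf, U) →ₗ[Γ(X, U)] tangent (π ≫ p) U where
  toFun z := (C.toAmb U z).D
  map_add' z w := congrArg Amb.D (map_add (C.toAmb U) z w)
  map_smul' g z := congrArg Amb.D (map_smul (C.toAmb U) g z)

theorem anchor_mres (h : V ≤ U) (z : Γ(C.sheaf, U)) :
    C.anchor V (mres C.sheaf h z) = tangent.res h (C.anchor U z) := rfl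

/-- The bracket. -/
def bracket [IsIntegral X] (U : X.Opens) : Γ(C.sheaf, U) →+ Γ(C.sheaf, U) →+ Γ(C.sheaf, U) :=
  AddMonoidHom.mk' (fun z => AddMonoidHom.mk'
    (fun w => ofAmb (br_mem_sec hinj (C.toAmb_mem z) (C.toAmb_mem w)))
    fun w w' => C.toAmb_injective U <| by
      simp only [map_add, toAmb_ofAmb]
      exact Amb.br_add_right hinj _ _ _)
    fun z z' => AddMonoidHom.ext fun w => C.toAmb_injective U <| by
      simp only [AddMonoidHom.add_apply, AddMonoidHom.mk'_apply, map_add, toAmb_ofAmb]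
      exact Amb.br_add_left _ _ _

theorem toAmb_bracket [IsIntegral X] (z w : Γ(C.sheaf, U)) :
    C.toAmb U (C.bracket hinj U z w) = Amb.br (C.toAmb U z) (C.toAmb U w) := rfl

theorem bracket_leibniz [IsIntegral X] (g : Γ(X, U)) (z w : Γ(C.sheaf, U)) :
    C.bracket hinj U (g • z) w = g • C.bracket hinj U z w - (C.anchor U w).der le_rfl g • z := by
  apply C.toAmb_injective U
  rw [toAmb_bracket, map_smul, map_sub, map_smul, map_smul, toAmb_bracket,
    Amb.br_smul_left_of_mem_sec (C.toAmb_mem w)]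
  rfl

variable {C}

/-- The pair associated with a section of `𝒜_S`. -/
def ofF (s : Γ(F.sheaf, U)) : C.Amb U :=
  ⟨tangent.incl π p U (F.anchor U s), mres F.sheaf inf_le_left s⟩

theorem isGen_ofF (s : Γ(F.sheaf, U)) : Amb.IsGen (BasicOp.ad F p U s) (ofF s : C.Amb U) :=
  ⟨rfl, by rw [BasicOp.res_ad]; exact coord_ad _ _⟩

theorem ofF_mem_sec (s : Γ(F.sheaf, U)) : ofF s ∈ C.sec U :=
  mem_sec_of_mem_genSpan (Submodule.subset_span ⟨_, υ.isLift_ad s, isGen_ofF s⟩)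

theorem res_ofF (h : V ≤ U) (s : Γ(F.sheaf, U)) :
    Amb.res h (ofF s : C.Amb U) = ofF (mres F.sheaf h s) := by
  refine Amb.ext ?_ ?_
  · change tangent.incl π p V (tangent.res h (F.anchor U s)) = _
    rw [← F.anchor_res]
    rfl
  · change mres F.sheaf _ (mres F.sheaf _ s) = mres F.sheaf _ (mres F.sheaf _ s)
    rw [mres_mres, mres_mres]

variable (C)

/-- The inclusion of `𝒜_S` on sections. -/
def inclApp (U : X.Opens) : Γ(F.sheaf, U) →ₗ[Γ(X, U)] Γ(C.sheaf, U) where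
  toFun s := ofAmb (ofF_mem_sec s)
  map_add' s t := C.toAmb_injective U <| by
    rw [map_add]
    exact Amb.ext (by simp [ofF]) (by simp [ofF])
  map_smul' g s := C.toAmb_injective U <| by
    rw [map_smul]
    exact Amb.ext (by simp [ofF, tangent.incl_smul]) (by simp [ofF, mres_smul])

theorem toAmb_inclApp (s : Γ(F.sheaf, U)) : C.toAmb U (C.inclApp U s) = ofF s := rfl

theorem inclApp_mres (h : V ≤ U) (s : Γ(F.sheaf, U)) :
    C.inclApp V (mres F.sheaf h s) = mres C.sheaf h (C.inclApp U s) := by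
  apply C.toAmb_injective V
  rw [toAmb_mres, toAmb_inclApp, toAmb_inclApp, res_ofF]

theorem anchor_inclApp (s : Γ(F.sheaf, U)) :
    C.anchor U (C.inclApp U s) = tangent.incl π p U (F.anchor U s) := rfl

/-- A pair remembers `s` only over `V₀`, but sections of `𝒜_S` are determined by their restriction
to a non-empty open subset. -/
theorem inclApp_injective [IsIntegral X] (h₀ : (V₀ : Set X).Nonempty) (U : X.Opens) :
    Function.Injective (C.inclApp U) := by
  intro s t e
  refine mres_eq_of_locally _ _ _ fun x hx => ⟨U, le_rfl, hx, ?_⟩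
  rw [mres_self, mres_self]
  refine F.mres_injective (inf_le_left : U ⊓ V₀ ≤ U)
    (nonempty_preirreducible_inter U.2 V₀.2 ⟨x, hx⟩ h₀) ?_
  exact congrArg Amb.s (congrArg (C.toAmb U) e)

include hinj in
/-- The bracket with the pair associated with `P` is `P`, by `[P, {s, -}] = {P s, -}`. -/
theorem br_ofF [IsIntegral X] {P : BasicOp F p U} {z : C.Amb U} (hz : Amb.IsGen P z)
    (s : Γ(F.sheaf, U)) : Amb.br z (ofF s) = ofF (P.act le_rfl s) := by
  have h := hz.lie (isGen_ofF s)
  rw [BasicOp.lie_ad P s (P.symbol_lie_anchor s)] at h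
  exact h.unique hinj (isGen_ofF _)

theorem bracket_inclApp [IsIntegral X] (s t : Γ(F.sheaf, U)) :
    C.bracket hinj U (C.inclApp U s) (C.inclApp U t) = C.inclApp U (F.bracket U s t) := by
  apply C.toAmb_injective U
  rw [toAmb_bracket, toAmb_inclApp, toAmb_inclApp, toAmb_inclApp, br_ofF C hinj (isGen_ofF s),
    BasicOp.act_ad, mres_self]

theorem exists_inclApp_eq_of_locally [IsIntegral X] (h₀ : (V₀ : Set X).Nonempty)
    (z : Γ(C.sheaf, U)) (H : ∀ x ∈ U, ∃ (V : X.Opens) (h : V ≤ U) (s : Γ(F.sheaf, V)), x ∈ V ∧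
      mres C.sheaf h z = C.inclApp V s) : ∃ s, z = C.inclApp U s := by
  obtain ⟨s, hs⟩ := exists_mglue F.sheaf U
    (fun V s => ∃ h : V ≤ U, mres C.sheaf h z = C.inclApp V s) (fun x hx => by
      obtain ⟨V, h, s, hxV, e⟩ := H x hx
      exact ⟨V, h, hxV, s, h, e⟩) (by
    rintro V - s s' ⟨h, e⟩ ⟨_, e'⟩
    exact C.inclApp_injective h₀ V (e.symm.trans e')) (by
    rintro V V' h - s ⟨h', e⟩
    exact ⟨h.trans h', by rw [C.inclApp_mres, ← e, mres_mres]⟩)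
  refine ⟨s, mres_eq_of_locally _ _ _ fun x hx => ?_⟩
  obtain ⟨V, h, s', hxV, e⟩ := H x hx
  exact ⟨V, h, hxV, by rw [← C.inclApp_mres, hs V h s' ⟨h, e⟩, e]⟩

/-! ### Local decomposition -/

variable {C}

/-- Change of coordinates: if `P = {s, -} + ∑ c_i P'_i` in the frame `C'` and `P'_i` has component
`m_i` in the frame `C`, then `P` has component `s + ∑ c_i m_i` in the frame `C`. -/
theorem Coord.trans {C' : LiftedFrame υ n V} {h : U ≤ V₀} {h' : U ≤ V} {P : BasicOp F p U}
    {s : Γ(F.sheaf, U)} (H : C'.Coord h' P s) {m : Fin n → Γ(F.sheaf, U)}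
    (K : ∀ i, C.Coord h (BasicOp.res h' (C'.P i)) (m i)) :
    C.Coord h P (s + ∑ i, C'.coef h' P.symbol i • m i) := by
  have hc : ∀ k, C.coef h P.symbol k =
      ∑ i, C'.coef h' P.symbol i * C.coef h (BasicOp.res h' (C'.P i)).symbol k := by
    intro k
    conv_lhs => rw [H.1, C.coef_add, C.coef_incl, zero_add, Frame.coef, tangent.sum_der]
    refine Finset.sum_congr rfl fun i _ => ?_
    exact C.coef_smul h _ _ k
  constructor
  · conv_lhs => rw [H.1]
    rw [map_add, map_add, map_sum, map_sum, add_assoc]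
    congr 1
    simp only [hc, Finset.sum_smul]
    rw [Finset.sum_comm, ← Finset.sum_add_distrib]
    refine Finset.sum_congr rfl fun i _ => ?_
    conv_lhs => rw [(K i).1]
    simp only [map_smul, tangent.incl_smul, smul_add, Finset.smul_sum, mul_smul]
  · intro V1 h1 r
    rw [H.2 V1 h1 r]
    simp only [hc, map_add, map_sum, mres_smul, AddMonoidHom.add_apply, add_assoc,
      AddMonoidHom.finsetSum_apply, map_mul, Finset.sum_smul]
    congr 1
    rw [Finset.sum_comm, ← Finset.sum_add_distrib]
    refine Finset.sum_congr rfl fun i _ => ?_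
    rw [F.leibniz, (K i).2 V1 h1 r, C'.fres_coef, C'.der_coef (h1.trans h') (P.symbol_basic.res h1),
      zero_smul, sub_zero]
    simp only [smul_add, Finset.smul_sum, mul_smul]

/-- Generators of the unfolding over the domain of a second frame `C'`. -/
def IsGens (C : LiftedFrame υ n V₀) (C' : LiftedFrame υ n V) (j : Fin n → Γ(C.sheaf, V)) : Prop :=
  ∀ i, Amb.IsGen (C'.P i) (C.toAmb V (j i))

theorem isLift (C' : LiftedFrame υ n V) (i : Fin n) : υ.IsLift (C'.P i) :=
  ⟨C'.W, C'.le, C'.v i, C'.val_v i⟩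

include hinj in
theorem exists_isGens (C : LiftedFrame υ n V₀) (C' : LiftedFrame υ n V) :
    ∃ j, C.IsGens C' j := by
  choose z hz using fun i => Amb.exists_isGen (C := C) hinj (C'.isLift i)
  exact ⟨fun i => ofAmb (mem_sec_of_mem_genSpan (Submodule.subset_span
    ⟨_, C'.isLift i, hz i⟩)), hz⟩

theorem IsGens.related {C' : LiftedFrame υ n V} {j : Fin n → Γ(C.sheaf, V)} (hj : C.IsGens C' j)
    (h : U ≤ V) (i : Fin n) :
    Related π p (C.anchor U (mres C.sheaf h (j i))) (C'.v i) := by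
  have : C.anchor U (mres C.sheaf h (j i)) = tangent.res h (C'.P i).symbol :=
    congrArg (tangent.res h) (hj i).1
  rw [this]
  exact C'.related_res h i

include hinj in
/-- Decomposition of elements of the span in the frame `C'`. -/
theorem exists_eq_of_mem_genSpan {C' : LiftedFrame υ n V} {j : Fin n → Γ(C.sheaf, V)}
    (hj : C.IsGens C' j) (h : U ≤ V) {z : C.Amb U} (hz : z ∈ Amb.genSpan C U) :
    ∃ s, z = ofF s + ∑ i, C'.coef h z.D i • Amb.res h (C.toAmb V (j i)) := by
  have sum_D : ∀ w : Fin n → C.Amb U, (∑ i, w i).D = ∑ i, (w i).D := fun w =>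
    map_sum (AddMonoidHom.mk' (fun z : C.Amb U => z.D) Amb.add_D) w Finset.univ
  have sum_s : ∀ w : Fin n → C.Amb U, (∑ i, w i).s = ∑ i, (w i).s := fun w =>
    map_sum (AddMonoidHom.mk' (fun z : C.Amb U => z.s) Amb.add_s) w Finset.univ
  have ofF_add : ∀ s t : Γ(F.sheaf, U), (ofF (s + t) : C.Amb U) = ofF s + ofF t := fun s t =>
    congrArg (C.toAmb U) (map_add (C.inclApp U) s t)
  have ofF_smul : ∀ (g : Γ(X, U)) (s : Γ(F.sheaf, U)), (ofF (g • s) : C.Amb U) = g • ofF s :=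
    fun g s => congrArg (C.toAmb U) (map_smul (C.inclApp U) g s)
  have ofF_zero : (ofF 0 : C.Amb U) = 0 := congrArg (C.toAmb U) (map_zero (C.inclApp U))
  induction hz using Submodule.span_induction with
  | mem z hz =>
    obtain ⟨P, h1, h2⟩ := hz
    obtain ⟨s, hs⟩ := exists_coord (C := C') hinj h h1
    refine ⟨s, Amb.ext ?_ ?_⟩
    · rw [h2.1, Amb.add_D, sum_D]
      conv_lhs => rw [hs.1]
      refine congr_arg₂ _ rfl (Finset.sum_congr rfl fun i _ => ?_)
      rw [Amb.smul_D, ((hj i).res h).1]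
    · have key := (hs.res (inf_le_left : U ⊓ V₀ ≤ U)).trans
        (C := C) (h := inf_le_right) fun i => ((hj i).res h).2
      rw [h2.2.unique hinj key, Amb.add_s, sum_s]
      refine congr_arg₂ _ rfl (Finset.sum_congr rfl fun i _ => ?_)
      rw [Amb.smul_s, h2.1, C'.fres_coef]
      rfl
  | zero => exact ⟨0, by simp [ofF_zero, C'.coef_zero]⟩
  | add z w _ _ hz hw =>
    obtain ⟨s, hs⟩ := hz
    obtain ⟨t, ht⟩ := hw
    refine ⟨s + t, ?_⟩
    simp only [Amb.add_D, C'.coef_add, add_smul, Finset.sum_add_distrib, ofF_add]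
    nth_rewrite 1 [hs, ht]
    abel
  | smul g z _ hz =>
    obtain ⟨s, hs⟩ := hz
    refine ⟨g • s, ?_⟩
    simp only [Amb.smul_D, C'.coef_smul, mul_smul, ← Finset.smul_sum, ofF_smul, ← smul_add]
    exact congrArg (g • ·) hs

include hinj in
/-- Over the domain of a frame, the unfolding is the sum of `𝒜_S` and a free module. -/
theorem IsGens.exists_eq [IsIntegral X] (h₀ : (V₀ : Set X).Nonempty) {C' : LiftedFrame υ n V}
    {j : Fin n → Γ(C.sheaf, V)} (hj : C.IsGens C' j) (h : U ≤ V) (z : Γ(C.sheaf, U)) :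
    ∃ s, z = C.inclApp U s + ∑ i, C'.coef h (C.anchor U z) i • mres C.sheaf h (j i) := by
  obtain ⟨s, hs⟩ := C.exists_inclApp_eq_of_locally h₀
    (z - ∑ i, C'.coef h (C.anchor U z) i • mres C.sheaf h (j i)) (by
    intro x hx
    obtain ⟨V', h', hxV', e⟩ := C.toAmb_mem z x hx
    obtain ⟨s, hs⟩ := exists_eq_of_mem_genSpan hinj hj (h'.trans h) e
    refine ⟨V', h', s, hxV', ?_⟩
    apply C.toAmb_injective
    rw [map_sub, map_sub, Unfolding.mres_sum, toAmb_mres, hs, toAmb_inclApp, map_sum]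
    refine sub_eq_of_eq_add (congr_arg₂ _ rfl (Finset.sum_congr rfl fun i _ => ?_))
    rw [map_smul, C'.fres_coef, mres_mres]
    rfl)
  exact ⟨s, by rw [← hs]; abel⟩

end LiftedFrame

end LieAlgd

end

noncomputable section

namespace LieAlgd

variable {X Y S : Scheme.{0}} {π : X ⟶ S} {F : Family π} {p : S ⟶ Y} {U V : X.Opens} {n : ℕ}

/-! ### Locally free modules -/

section LocallyFree

variable {R Q : Type} [CommRing R] [AddCommGroup Q] [Module R Q] {s : Set R} {A : s → Type}
  [∀ g, CommRing (A g)] [∀ g, Algebra R (A g)] [∀ g, IsLocalization.Away g.1 (A g)]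

theorem finite_of_localized_free (hs : Ideal.span s = ⊤) (φ : ∀ g, Q →ₗ[R] Fin n → A g)
    [∀ g, IsLocalizedModule.Away g.1 (φ g)] : Module.Finite R Q :=
  Module.Finite.of_localizationSpan' s hs (Rₚ := A) φ fun _ => inferInstance

/-- A module which is locally free of finite rank is projective. -/
theorem projective_of_localized_free (hs : Ideal.span s = ⊤) (φ : ∀ g, Q →ₗ[R] Fin n → A g)
    [∀ g, IsLocalizedModule.Away g.1 (φ g)] : Module.Projective R Q := by
  have : Module.FinitePresentation R Q :=
    Module.FinitePresentation.of_localizationSpan' s hs (Rₚ := A) φ fun _ => inferInstance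
  have : Module.Flat R Q := by
    refine Module.flat_of_isLocalized_span R Q s hs _ φ fun g => ?_
    have : Module.Flat R (A g) := IsLocalization.flat (A g) (.powers g.1)
    exact Module.Flat.trans R (A g) (Fin n → A g)
  exact Module.Flat.projective_of_finitePresentation

theorem finrank_of_localized_free [IsDomain R] (hs : Ideal.span s = ⊤)
    (φ : ∀ g, Q →ₗ[R] Fin n → A g) [∀ g, IsLocalizedModule.Away g.1 (φ g)] :
    Module.finrank R Q = n := by
  obtain ⟨g, hg, hg0⟩ : ∃ g ∈ s, g ≠ 0 := by
    by_contra! h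
    have : Ideal.span s ≤ ⊥ := Ideal.span_le.mpr fun g hg => h g hg
    rw [hs] at this
    exact bot_ne_top (top_le_iff.mp this)
  have hp : Submonoid.powers g ≤ nonZeroDivisors R :=
    powers_le_nonZeroDivisors_of_noZeroDivisors hg0
  have hl : IsLocalizedModule (.powers (⟨g, hg⟩ : s).1) (φ ⟨g, hg⟩) := inferInstance
  have hA : IsLocalization (.powers (⟨g, hg⟩ : s).1) (A ⟨g, hg⟩) := inferInstance
  have hd : IsDomain (A ⟨g, hg⟩) := IsLocalization.isDomain_of_le_nonZeroDivisors _ hp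
  rw [← IsLocalizedModule.finrank_eq (.powers g) (φ ⟨g, hg⟩) hp,
    ← IsLocalization.finrank_eq (A ⟨g, hg⟩) (.powers g) hp]
  simp

/-- An extension of a projective module by a reflexive module is reflexive. -/
theorem isReflexive_of_projective_quotient {M N : Type} [AddCommGroup M] [Module R M]
    [AddCommGroup N] [Module R N] [Module.IsReflexive R N] (i : N →ₗ[R] M)
    (hi : Function.Injective i) [Module.Finite R (M ⧸ LinearMap.range i)]
    [Module.Projective R (M ⧸ LinearMap.range i)] : Module.IsReflexive R M := by
  obtain ⟨σ, hσ⟩ := Module.projective_lifting_property (LinearMap.range i).mkQ LinearMap.id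
    (Submodule.mkQ_surjective _)
  have hσ' : ∀ q, (LinearMap.range i).mkQ (σ q) = q := fun q => congr($hσ q)
  let f : N × (M ⧸ LinearMap.range i) →ₗ[R] M := i.coprod σ
  have hf : Function.Bijective f := by
    constructor
    · rw [injective_iff_map_eq_zero]
      rintro ⟨a, q⟩ h
      have h : i a + σ q = 0 := h
      have h1 := congrArg (LinearMap.range i).mkQ h
      have h2 : (LinearMap.range i).mkQ (i a) = 0 := by simp
      rw [map_add, h2, hσ', zero_add, map_zero] at h1
      rw [h1, map_zero, add_zero] at h
      exact Prod.ext ((map_eq_zero_iff i hi).mp h) h1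
    · intro m
      have h : m - σ ((LinearMap.range i).mkQ m) ∈ LinearMap.range i := by
        rw [← Submodule.Quotient.mk_eq_zero, ← Submodule.mkQ_apply, map_sub, hσ', sub_self]
      obtain ⟨a, ha⟩ := h
      exact ⟨(a, (LinearMap.range i).mkQ m), by
        change i a + σ ((LinearMap.range i).mkQ m) = m
        rw [ha, sub_add_cancel]⟩
  exact Module.equiv (LinearEquiv.ofBijective f hf)

end LocallyFree

namespace LiftedFrame

variable {V₀ : X.Opens} {υ : FlatSection F p} {C : LiftedFrame υ n V₀}
variable (hinj : ∀ U : X.Opens, Function.Injective (BasicOp.ad F p U))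

/-! ### Coherence of the unfolding -/

theorem exists_pow_smul_eq {ι : Type} [Finite ι] {R : Type} [CommRing R] {P : ι → R → Prop}
    (f : R) (hP : ∀ i g h, P i g → P i (h * g)) (H : ∀ i, ∃ k : ℕ, P i (f ^ k)) :
    ∃ k : ℕ, ∀ i, P i (f ^ k) := by
  choose k hk using H
  obtain ⟨N, hN⟩ := Finite.bddAbove_range k
  refine ⟨N, fun i => ?_⟩
  rw [← Nat.sub_add_cancel (hN ⟨i, rfl⟩ : k i ≤ N), pow_add]
  exact hP _ _ _ (hk i)

include hinj in
/-- Both summands of the local decomposition localize. -/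
theorem localizesOn [IsIntegral X] (h₀ : (V₀ : Set X).Nonempty) (C' : LiftedFrame υ n V)
    (hU : IsAffineOpen U) (h : U ≤ V) : LocalizesOn C.sheaf U := by
  obtain ⟨j, hj⟩ := exists_isGens hinj C C'
  intro f
  have hFl := localizesOn_of_isQuasicoherent F.quasicoherent hU f
  constructor
  · intro z hz
    by_cases hf : (X.basicOpen f : Set X).Nonempty
    · have hc : ∀ i, C'.coef h (C.anchor U z) i = 0 := fun i => by
        refine (map_eq_zero_iff _ (fres_injective (X.basicOpen_le f) hf)).mp ?_
        rw [C'.fres_coef, ← C.anchor_mres, hz, map_zero, C'.coef_zero]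
      obtain ⟨s, hs⟩ := hj.exists_eq hinj h₀ h z
      simp only [hc, zero_smul, Finset.sum_const_zero, add_zero] at hs
      rw [hs, ← C.inclApp_mres] at hz
      have hs0 : s = 0 := (map_eq_zero_iff _ (F.mres_injective (X.basicOpen_le f) hf)).mp
        ((map_eq_zero_iff _ (C.inclApp_injective h₀ _)).mp hz)
      exact ⟨0, by rw [hs, hs0, map_zero, smul_zero]⟩
    · have : f = 0 := by
        rw [← basicOpen_eq_bot_iff]
        exact Opens.ext (Set.not_nonempty_iff_eq_empty.mp hf)
      exact ⟨1, by rw [this, pow_one, zero_smul]⟩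
  · intro t
    obtain ⟨s, hs⟩ := hj.exists_eq hinj h₀ ((X.basicOpen_le f).trans h) t
    obtain ⟨m, s', hs'⟩ := hFl.2 s
    obtain ⟨k, hk⟩ := exists_pow_smul_eq (P := fun i g => ∃ a,
      fres (X.basicOpen_le f) g * C'.coef ((X.basicOpen_le f).trans h) (C.anchor _ t) i =
        fres (X.basicOpen_le f) a) f (by
      rintro i g g' ⟨a, ha⟩
      exact ⟨g' * a, by rw [map_mul, mul_assoc, ha, map_mul]⟩)
      fun i => exists_fres_mul_eq hU f _
    choose a ha using hk
    refine ⟨m + k, C.inclApp U (f ^ k • s') + ∑ i, (f ^ m * a i) • mres C.sheaf h (j i), ?_⟩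
    conv_rhs => rw [hs]
    rw [map_add, Unfolding.mres_sum, ← C.inclApp_mres, mres_smul, hs', smul_add, map_smul, map_smul,
      Finset.smul_sum, map_pow, smul_smul, ← pow_add, add_comm k m]
    refine congr_arg₂ _ rfl (Finset.sum_congr rfl fun i _ => ?_)
    rw [map_mul, ← ha, mres_mres, smul_smul, pow_add, map_pow, map_pow, mul_assoc]

include hinj in
theorem isQuasicoherent [IsIntegral X] (h₀ : (V₀ : Set X).Nonempty) (hF : HasFrames π p n) :
    SheafOfModules.IsQuasicoherent C.sheaf := by
  refine isQuasicoherent_of_localizesOn fun x => ?_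
  obtain ⟨V, hxV, ⟨C'⟩⟩ := υ.exists_liftedFrame hinj hF x
  obtain ⟨W, hW, hxW, hWV⟩ := Opens.isBasis_iff_nbhd.mp X.isBasis_affineOpens hxV
  exact ⟨W, hxW, hW, localizesOn hinj h₀ C' hW hWV⟩

variable (C) in
/-- The coefficients of sections of the unfolding over the domain `D(f)` of a frame. -/
def quotCoef {f : Γ(X, U)} (C' : LiftedFrame υ n (X.basicOpen f)) :
    (Γ(C.sheaf, U) ⧸ LinearMap.range (C.inclApp U)) →ₗ[Γ(X, U)] (Fin n → Γ(X, X.basicOpen f)) :=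
  (LinearMap.range (C.inclApp U)).liftQ
    { toFun := fun z => C'.coef le_rfl (C.anchor _ (mres C.sheaf (X.basicOpen_le f) z))
      map_add' := fun z w => by rw [map_add, map_add]; rfl
      map_smul' := fun g z => by
        funext i
        rw [mres_smul, map_smul, C'.coef_smul]
        rfl } (by
    rintro _ ⟨s, rfl⟩
    funext i
    change C'.coef le_rfl (C.anchor _ (mres C.sheaf (X.basicOpen_le f) (C.inclApp U s))) i = 0
    rw [← C.inclApp_mres, C.anchor_inclApp, C'.coef_incl])

theorem quotCoef_mk {f : Γ(X, U)} (C' : LiftedFrame υ n (X.basicOpen f)) (z : Γ(C.sheaf, U)) :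
    C.quotCoef C' (Submodule.Quotient.mk z) =
      C'.coef le_rfl (C.anchor _ (mres C.sheaf (X.basicOpen_le f) z)) := rfl

include hinj in
/-- Over `D(f)`, the quotient of the unfolding by `𝒜_S` is free on the lifts of the coordinate vector
fields. -/
theorem isLocalizedModule_quotCoef [IsIntegral X] (h₀ : (V₀ : Set X).Nonempty)
    (hF : HasFrames π p n) (hU : IsAffineOpen U) {f : Γ(X, U)}
    (C' : LiftedFrame υ n (X.basicOpen f)) : IsLocalizedModule.Away f (C.quotCoef C') := by
  obtain ⟨j, hj⟩ := exists_isGens hinj C C'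
  have hl := localizesOn_of_isQuasicoherent (C.isQuasicoherent hinj h₀ hF) hU f
  have hFl := localizesOn_of_isQuasicoherent F.quasicoherent hU f
  refine IsLocalizedModule.Away.mk_of_addCommGroup ?_ (fun c => ?_) fun q hq => ?_
  · have hu : IsUnit (fres (X.basicOpen_le f) f) := isUnit_fres_basicOpen le_rfl
    obtain ⟨u, hu⟩ := hu
    rw [Module.End.isUnit_iff]
    have key : ∀ c : Fin n → Γ(X, X.basicOpen f),
        (algebraMap Γ(X, U) (Module.End Γ(X, U) _) f) c = (u : Γ(X, X.basicOpen f)) • c := by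
      intro c
      rw [hu]
      rfl
    constructor
    · intro c c' h
      rw [key, key] at h
      exact MulAction.injective u h
    · intro c
      exact ⟨u⁻¹ • c, (key _).trans (smul_inv_smul u c)⟩
  · obtain ⟨m, z, hz⟩ := hl.2 (∑ i, c i • j i)
    refine ⟨m, Submodule.Quotient.mk z, ?_⟩
    rw [quotCoef_mk, hz, map_smul]
    funext i
    rw [C'.coef_smul, map_sum]
    simp only [map_smul]
    rw [C'.coef_sum_smul le_rfl fun i => by
      have := hj.related le_rfl i
      rwa [mres_self] at this]
    rw [← map_pow]
    rfl
  · obtain ⟨z, rfl⟩ := Submodule.Quotient.mk_surjective _ q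
    rw [quotCoef_mk] at hq
    obtain ⟨s, hs⟩ := hj.exists_eq hinj h₀ le_rfl (mres C.sheaf (X.basicOpen_le f) z)
    simp only [hq, Pi.zero_apply, zero_smul, Finset.sum_const_zero, add_zero] at hs
    obtain ⟨m, s', hs'⟩ := hFl.2 s
    obtain ⟨k, hk⟩ := hl.1 (f ^ m • z - C.inclApp U s') (by
      rw [map_sub, mres_smul, ← C.inclApp_mres, hs', map_smul, map_pow, hs, sub_self])
    refine ⟨k + m, ?_⟩
    rw [← Submodule.Quotient.mk_smul, Submodule.Quotient.mk_eq_zero]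
    refine ⟨f ^ k • s', ?_⟩
    rw [smul_sub, sub_eq_zero] at hk
    rw [map_smul, ← hk, smul_smul, pow_add]

/-- An affine open subset is covered by distinguished open subsets which are domains of frames. -/
theorem span_liftedFrame (υ : FlatSection F p) (hF : HasFrames π p n)
    (hinj : ∀ U : X.Opens, Function.Injective (BasicOp.ad F p U)) (hU : IsAffineOpen U) :
    Ideal.span {f : Γ(X, U) | Nonempty (LiftedFrame υ n (X.basicOpen f))} = ⊤ := by
  rw [← hU.iSup_basicOpen_eq_self_iff]
  refine le_antisymm (iSup_le fun f => X.basicOpen_le _) fun x hx => ?_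
  obtain ⟨V, hxV, ⟨C'⟩⟩ := υ.exists_liftedFrame hinj hF x
  obtain ⟨f, hf, hxf⟩ := exists_basicOpen_le hU (inf_le_left : U ⊓ V ≤ U) ⟨hx, hxV⟩
  exact Opens.mem_iSup.mpr ⟨⟨f, ⟨C'.res (hf.trans inf_le_right)⟩⟩, hxf⟩

include hinj in
/-- The quotient of the unfolding by `𝒜_S` is locally free of rank `n`. -/
theorem quotient_locallyFree [IsIntegral X] (h₀ : (V₀ : Set X).Nonempty) (hF : HasFrames π p n)
    (hU : IsAffineOpen U) :
    Module.Finite Γ(X, U) (Γ(C.sheaf, U) ⧸ LinearMap.range (C.inclApp U)) ∧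
    Module.Projective Γ(X, U) (Γ(C.sheaf, U) ⧸ LinearMap.range (C.inclApp U)) ∧
    ((U : Set X).Nonempty →
      Module.finrank Γ(X, U) (Γ(C.sheaf, U) ⧸ LinearMap.range (C.inclApp U)) = n) := by
  have hs := span_liftedFrame υ hF hinj hU
  have hloc : ∀ f : Γ(X, U), IsLocalization.Away f Γ(X, X.basicOpen f) := fun f =>
    hU.isLocalization_basicOpen f
  have hφ : ∀ g : {f : Γ(X, U) | Nonempty (LiftedFrame υ n (X.basicOpen f))},
      IsLocalizedModule.Away g.1 (C.quotCoef g.2.some) := fun g =>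
    isLocalizedModule_quotCoef hinj h₀ hF hU g.2.some
  refine ⟨finite_of_localized_free hs fun g => C.quotCoef g.2.some,
    projective_of_localized_free hs fun g => C.quotCoef g.2.some, fun ⟨x, hx⟩ => ?_⟩
  have : Nonempty U := ⟨⟨x, hx⟩⟩
  exact finrank_of_localized_free hs fun g => C.quotCoef g.2.some

include hinj in
theorem finite_sections [IsIntegral X] (h₀ : (V₀ : Set X).Nonempty) (hF : HasFrames π p n)
    (hU : IsAffineOpen U) : Module.Finite Γ(X, U) Γ(C.sheaf, U) := by
  have := (quotient_locallyFree (C := C) hinj h₀ hF hU).1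
  have := F.finite U hU
  have : Module.Finite Γ(X, U) (LinearMap.range (C.inclApp U)) := inferInstance
  exact Module.Finite.of_submodule_quotient (LinearMap.range (C.inclApp U))

include hinj in
theorem isReflexive_sections [IsIntegral X] (h₀ : (V₀ : Set X).Nonempty) (hF : HasFrames π p n)
    (hU : IsAffineOpen U) : Module.IsReflexive Γ(X, U) Γ(C.sheaf, U) := by
  obtain ⟨h1, h2, -⟩ := quotient_locallyFree (C := C) hinj h₀ hF hU
  have := F.reflexive U hU
  exact isReflexive_of_projective_quotient (C.inclApp U) (C.inclApp_injective h₀ U)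

include hinj in
theorem finrank_sections [IsIntegral X] (h₀ : (V₀ : Set X).Nonempty) (hF : HasFrames π p n)
    (hU : IsAffineOpen U) (hne : (U : Set X).Nonempty) :
    Module.finrank Γ(X, U) Γ(C.sheaf, U) = Module.finrank Γ(X, U) Γ(F.sheaf, U) + n := by
  have h3 := (quotient_locallyFree (C := C) hinj h₀ hF hU).2.2 hne
  have := C.finite_sections hinj h₀ hF hU
  obtain ⟨x, hx⟩ := hne
  have : Nonempty U := ⟨⟨x, hx⟩⟩
  rw [← Submodule.finrank_quotient_add_finrank (LinearMap.range (C.inclApp U)), h3,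
    LinearMap.finrank_range_of_inj (C.inclApp_injective h₀ U), add_comm]

end LiftedFrame

end LieAlgd

end

noncomputable section

namespace LieAlgd

variable {X Y S : Scheme.{0}} {π : X ⟶ S} {F : Family π} {p : S ⟶ Y} {U V : X.Opens} {n : ℕ}

/-! ### The unfolding defined by a flat section -/

namespace LiftedFrame

variable {V₀ : X.Opens} {υ : FlatSection F p}

/-- The Lie algebroid generated by the lifts along a flat section. -/
def alg [IsIntegral X] (C : LiftedFrame υ n V₀)
    (hinj : ∀ U : X.Opens, Function.Injective (BasicOp.ad F p U)) (h₀ : (V₀ : Set X).Nonempty)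
    (hF : HasFrames π p n) : LieAlgebroid (π ≫ p) where
  sheaf := C.sheaf
  quasicoherent := isQuasicoherent hinj h₀ hF
  finite _ hU := finite_sections hinj h₀ hF hU
  reflexive _ hU := isReflexive_sections hinj h₀ hF hU
  anchor := C.anchor
  anchor_res := C.anchor_mres
  bracket := C.bracket hinj
  bracket_res h z w := C.toAmb_injective _ (Amb.res_br h (C.toAmb _ z) (C.toAmb _ w))
  bracket_smul_base e c z w := by
    rw [bracket_leibniz, tangent.der_pull, zero_smul, sub_zero]
  skew z w := C.toAmb_injective _ <| by
    rw [map_neg]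
    exact Amb.br_skew hinj _ _
  jacobi z w u := C.toAmb_injective _ <| by
    rw [map_add, map_add, map_zero]
    exact jac_eq_zero_of_mem_sec hinj (C.toAmb_mem z) (C.toAmb_mem w) (C.toAmb_mem u)
  leibniz := C.bracket_leibniz hinj

/-- The unfolding generated by the lifts along a flat section. -/
def unfolding [IsIntegral X] (C : LiftedFrame υ n V₀)
    (hinj : ∀ U : X.Opens, Function.Injective (BasicOp.ad F p U)) (h₀ : (V₀ : Set X).Nonempty)
    (hF : HasFrames π p n) (hd : topologicalKrullDim S = n) : Unfolding F p where
  alg := C.alg hinj h₀ hF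
  ι := homOfLinear C.inclApp fun _ _ h s => C.inclApp_mres h s
  ι_injective := C.inclApp_injective h₀
  anchor_ι _ s := C.anchor_inclApp s
  bracket_ι _ s t := C.bracket_inclApp hinj s t
  preimage U z H := by
    obtain ⟨s, hs⟩ := C.exists_inclApp_eq_of_locally h₀ z fun x hx => by
      obtain ⟨V, h, s, hxV, e⟩ := H x hx
      obtain ⟨V', hxV', ⟨C'⟩⟩ := υ.exists_liftedFrame hinj hF x
      obtain ⟨j, hj⟩ := exists_isGens hinj C C'
      obtain ⟨t, ht⟩ := hj.exists_eq hinj h₀ (inf_le_right : V ⊓ V' ≤ V')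
        (mres C.sheaf (inf_le_left.trans h) z)
      have hc : ∀ i, C'.coef inf_le_right
          (C.anchor (V ⊓ V') (mres C.sheaf (inf_le_left.trans h) z)) i = 0 := fun i => by
        have : C.anchor (V ⊓ V') (mres C.sheaf (inf_le_left.trans h) z) =
            tangent.incl π p _ (tangent.res inf_le_left (F.anchor V s)) :=
          congrArg (tangent.res (inf_le_left : V ⊓ V' ≤ V)) e
        rw [this, C'.coef_incl]
      simp only [hc, zero_smul, Finset.sum_const_zero, add_zero] at ht
      exact ⟨V ⊓ V', inf_le_left.trans h, t, ⟨hxV, hxV'⟩, ht⟩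
    exact ⟨s, hs.symm⟩
  rank U hU hne := by
    rw [hd]
    exact_mod_cast congrArg (Nat.cast (R := WithBot ℕ∞)) (finrank_sections hinj h₀ hF hU hne)

variable [IsIntegral X] {C : LiftedFrame υ n V₀}
  {hinj : ∀ U : X.Opens, Function.Injective (BasicOp.ad F p U)} {h₀ : (V₀ : Set X).Nonempty}
  {hF : HasFrames π p n} {hd : topologicalKrullDim S = n}

theorem isTransversal_unfolding : (C.unfolding hinj h₀ hF hd).IsTransversal := by
  rw [Unfolding.isTransversal_iff]
  constructor
  · intro U D z e x hx
    obtain ⟨V, hxV, ⟨C'⟩⟩ := υ.exists_liftedFrame hinj hF x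
    obtain ⟨j, hj⟩ := exists_isGens hinj C C'
    let z' : Γ(C.sheaf, U) := z
    have e : tangent.incl π p U D = C.anchor U z' := e
    obtain ⟨s, hs⟩ := hj.exists_eq hinj h₀ (inf_le_right : U ⊓ V ≤ V)
      (mres C.sheaf inf_le_left z')
    have hD : C.anchor (U ⊓ V) (mres C.sheaf inf_le_left z') =
        tangent.incl π p _ (tangent.res inf_le_left D) := by
      rw [C.anchor_mres, ← e, tangent.incl_res]
    have hc : ∀ i, C'.coef inf_le_right
        (C.anchor (U ⊓ V) (mres C.sheaf inf_le_left z')) i = 0 := fun i => by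
      rw [hD, C'.coef_incl]
    simp only [hc, zero_smul, Finset.sum_const_zero, add_zero] at hs
    refine ⟨U ⊓ V, inf_le_left, s, ⟨hx, hxV⟩, tangent.incl_injective π p _ ?_⟩
    rw [← hD, hs, C.anchor_inclApp]
  · intro U D x hx
    obtain ⟨V, hxV, ⟨C'⟩⟩ := υ.exists_liftedFrame hinj hF x
    obtain ⟨j, hj⟩ := exists_isGens hinj C C'
    obtain ⟨E, hE⟩ := C'.exists_incl_eq_sub (inf_le_right : U ⊓ V ≤ V)
      (fun i => hj.related inf_le_right i) (tangent.res inf_le_left D)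
    let z : Γ(C.sheaf, U ⊓ V) := ∑ i, C'.coef inf_le_right (tangent.res inf_le_left D) i •
      mres C.sheaf inf_le_right (j i)
    refine ⟨U ⊓ V, inf_le_left, E, z, ⟨hx, hxV⟩, ?_⟩
    have hz : C.anchor _ z = ∑ i, C'.coef inf_le_right (tangent.res inf_le_left D) i •
        C.anchor _ (mres C.sheaf inf_le_right (j i)) := by
      rw [map_sum]
      exact Finset.sum_congr rfl fun i _ => map_smul _ _ _
    change _ = tangent.incl π p _ E + C.anchor _ z
    rw [hE, hz]
    exact (sub_add_cancel _ _).symm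

/-- The pair associated with an operator induces this operator. -/
theorem induces_ofAmb {P : BasicOp F p U} {z : C.Amb U} (hz : Amb.IsGen P z)
    (hz' : z ∈ C.sec U) : (C.unfolding hinj h₀ hF hd).Induces (ofAmb hz') P := by
  refine ⟨hz.1.symm, fun V h s => ?_⟩
  refine C.toAmb_injective V ?_
  exact (br_ofF C hinj (hz.res h) s).symm

end LiftedFrame

/-- If `𝒜_S` embeds into its derivations, every flat section comes from a transversal
unfolding. -/
theorem FlatSection.exists_unfolding [IsIntegral X] (υ : FlatSection F p)
    (hinj : ∀ U : X.Opens, Function.Injective (BasicOp.ad F p U)) (hF : HasFrames π p n)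
    (hd : topologicalKrullDim S = n) : ∃ A : Unfolding F p, A.IsTransversal ∧
      ∀ (W : S.Opens) (v : tangent p W), ∀ x ∈ π ⁻¹ᵁ W, ∃ (V : X.Opens) (e : V ≤ π ⁻¹ᵁ W)
        (z : Γ(A.alg.sheaf, V)) (P : BasicOp F p V), x ∈ V ∧ A.Induces z P ∧
          υ.val e v = uClass P := by
  obtain ⟨V₀, hx₀, ⟨C⟩⟩ := υ.exists_liftedFrame hinj hF (Classical.arbitrary X)
  refine ⟨C.unfolding hinj ⟨_, hx₀⟩ hF hd, LiftedFrame.isTransversal_unfolding, fun W v x hx => ?_⟩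
  obtain ⟨V, e, P, hxV, hP⟩ := exists_local_uClass (υ.val le_rfl v) x hx
  have hP' : υ.val e v = uClass P := by rw [← hP, υ.ures_val]
  obtain ⟨z, hz⟩ := LiftedFrame.Amb.exists_isGen (C := C) hinj ⟨W, e, v, hP'⟩
  exact ⟨V, e, _, P, hxV, LiftedFrame.induces_ofAmb hz
    (LiftedFrame.mem_sec_of_mem_genSpan (Submodule.subset_span ⟨P, ⟨W, e, v, hP'⟩, hz⟩)), hP'⟩

end LieAlgd

end

theorem theorem2 {X S : Scheme.{0}} (p : S ⟶ Spec (CommRingCat.of ℂ)) (π : X ⟶ S)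
    [IsIntegral X] [Smooth (π ≫ p)] [Smooth π]
    [LocallyOfFiniteType p] [QuasiCompact p] [IrreducibleSpace S]
    (F : LieAlgd.Family π) :
    ∃ Φ : Quotient (LieAlgd.transversalSetoid F p) → LieAlgd.FlatSection F p,
      (∀ (A : LieAlgd.TransversalUnfolding F p) (W : S.Opens) (U : X.Opens) (e : U ≤ π ⁻¹ᵁ W)
        (v : LieAlgd.tangent p W) (x : (A.1.alg.sheaf.presheaf.obj (op U) : Ab)),
        LieAlgd.Related π p (A.1.alg.anchor U x) v →
        ∃ P : LieAlgd.BasicOp F p U, A.1.Induces x P ∧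
          (Φ (Quotient.mk _ A)).hom.app (op U) (LieAlgd.invSection π e v) = LieAlgd.uClass P) ∧
      ((∀ U : X.Opens, Function.Injective (LieAlgd.BasicOp.ad F p U)) → Function.Bijective Φ) := by
  have hl : LieAlgd.HasLifts π p := LieAlgd.hasLifts_of_smooth π p
  obtain ⟨n, hF, hd⟩ := LieAlgd.exists_hasFrames π p
  choose φ hφ using fun A : LieAlgd.TransversalUnfolding F p =>
    A.2.exists_flatSection hl
  -- a section of `𝔲` which agrees with `φ A` on vector fields that lift to `A` equals `φ A`
  have φ_eq : ∀ (A : LieAlgd.TransversalUnfolding F p) (υ : LieAlgd.FlatSection F p),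
      (∀ (W : S.Opens) (v : LieAlgd.tangent p W) (V : X.Opens) (e : V ≤ π ⁻¹ᵁ W)
        (x : (A.1.alg.sheaf.presheaf.obj (op V) : Ab)) (P : LieAlgd.BasicOp F p V),
        LieAlgd.Related π p (A.1.alg.anchor V x) v → A.1.Induces x P →
          υ.val e v = LieAlgd.uClass P) → φ A = υ := by
    intro A υ H
    refine LieAlgd.FlatSection.ext_of_locally fun W v x hx => ?_
    obtain ⟨V, e, z, hxV, hz⟩ := A.2.exists_related hl v x hx
    obtain ⟨P, hP⟩ := A.2.exists_induces z (hz.isBasic e)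
    exact ⟨V, e, hxV, (hφ A W v V e z P hz hP).trans (H W v V e z P hz hP).symm⟩
  have φ_iso : ∀ A B : LieAlgd.TransversalUnfolding F p, A ≈ B → φ A = φ B := by
    rintro A B ⟨f, h1, h2, h3⟩
    refine φ_eq A _ fun W v V e x P hx hP => hφ B W v V e (f.hom.app V x) P ?_ ⟨?_, ?_⟩
    · rwa [h2]
    · rw [h2, hP.1]
    · intro V' h s
      have e1 : ∀ t, B.1.ι.app V' t = f.hom.app V' (A.1.ι.app V' t) := fun t => by
        rw [← h1]
        rfl
      rw [e1, e1, hP.2, h3, LieAlgd.app_mres]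
  refine ⟨Quotient.lift φ φ_iso, fun A W U e v x hx => ?_, fun hinj => ⟨?_, fun υ => ?_⟩⟩
  · obtain ⟨P, hP⟩ := A.2.exists_induces x (hx.isBasic e)
    exact ⟨P, hP, hφ A W v U e x P hx hP⟩
  · rintro ⟨A⟩ ⟨B⟩ h
    have h : φ A = φ B := h
    refine Quotient.sound (LieAlgd.Unfolding.isIsomorphic_of_haveCommonLifts hinj A.2 B.2 hF ?_)
    exact A.2.haveCommonLifts B.2 hl (φ A) (hφ A) (h ▸ hφ B)
  · obtain ⟨A, hA, H⟩ := υ.exists_unfolding hinj hF hd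
    refine ⟨Quotient.mk _ ⟨A, hA⟩, ?_⟩
    refine LieAlgd.FlatSection.ext_of_locally fun W v x hx => ?_
    obtain ⟨V, e, z, P, hxV, hP, hv⟩ := H W v x hx
    exact ⟨V, e, hxV, (hφ ⟨A, hA⟩ W v V e z P (hP.1 ▸ υ.symbol e v P hv) hP).trans hv.symm⟩
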